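/- Let $u\in C^2(\mathbb R)$ be real-valued, and let $U(\psi)=u(|\psi|^2)$ and $F(\psi)=-\nabla U(\psi)$ for $\psi\in\mathbb C$, where the gradient is taken with respect to $(\mathrm{Re}\,\psi,\mathrm{Im}\,\psi)$ and $\mathbb C$ is identified with $\mathbb R^2$. Let $m>0$ and assume that $U(\psi)\ge A-B|\psi|^2$ for all $\psi\in\mathbb C$, where $A\in\mathbb R$ and $0\le B<m$. Let $\mathcal E=H^1(\mathbb R)\oplus L^2(\mathbb R)$ be the Hilbert space of (complex-valued) states $\Psi=(\psi,\pi)$ with the norm $\|\Psi\|_{\mathcal E}^2=\|\pi\|_{L^2(\mathbb R)}^2+\|\psi'\|_{L^2(\mathbb R)}^2+m^2\|\psi\|_{L^2(\mathbb R)}^2$, and let $\mathcal E_F$ be the same vector space with the topology defined by the seminorms $\|\Psi\|_{\mathcal E,R}$, $R>0$, where $\|\Psi\|_{\mathcal E,R}^2=\|\pi\|_{L^2(-R,R)}^2+\|\psi'\|_{L^2(-R,R)}^2+m^2\|\psi\|_{L^2(-R,R)}^2$. For $\Psi=(\psi,\pi)\in\mathcal E$ put $$\mathcal H(\Psi)=\frac12\int_{\mathbb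 R}\left(|\pi|^2+|\psi'|^2+m^2|\psi|^2\right)dx+U(\psi(0)),$$ where $\psi(0)$ is the value at $0$ of the continuous representative of $\psi$. Consider the Cauchy problem for $\Psi(t)=(\psi(\cdot,t),\pi(\cdot,t))$, $$\dot\psi=\pi,\qquad \dot\pi=\psi''-m^2\psi+\delta(x)F(\psi(0,t)),\qquad \Psi|_{t=0}=\Psi_0,\qquad x\in\mathbb R,\ t\in\mathbb R,$$ where dots and primes are derivatives in $t$ and in $x$, and the equations are understood in the sense of distributions of $(x,t)\in\mathbb R^2$. Then: (i) For every $\Psi_0\in\mathcal E$ the Cauchy problem has a unique solution $\Psi\in C(\mathbb R,\mathcal E)$. (ii) For each $t\in\mathbb R$ the map $W(t):\Psi_0\mapsto\Psi(t)$ is continuous from $\mathcal E$ to $\mathcal E$ and from $\mathcal E_F$ to $\mathcal E_F$. (iii) The energy is conserved: $\mathcal H(\Psi(t))=\mathcal H(\Psi_0)$ for all $t\in\mathbb R$. (iv) For every $\Psi_0\in\mathcal E$ there is a constant $C(\Psi_0)$ such that $\|\Psi(t)\|_{\mathcal E}\le C(\Psi_0)$ for all $t\in\mathbb R$. -/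

import Mathlib

open MeasureTheory
open scoped ContDiff

noncomputable section

namespace KleinGordonOscillator

/-- The complex Hilbert space `L²(ℝ)`. -/
abbrev L2 : Type := Lp ℂ 2 (volume : Measure ℝ)

/-- `g` is the derivative of `f` on `ℝ` in the sense of distributions. -/
def IsWeakDeriv (f g : ℝ → ℂ) : Prop :=
  ∀ φ : ℝ → ℝ, ContDiff ℝ ∞ φ → HasCompactSupport φ →
    ∫ x, deriv φ x • f x = -∫ x, φ x • g x

lemma L2.locallyIntegrable (f : L2) : LocallyIntegrable (f : ℝ → ℂ) volume :=
  (Lp.memLp f).locallyIntegrable (by norm_num)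

lemma L2.integrable_smul (f : L2) {φ : ℝ → ℝ} (hφ : Continuous φ) (hc : HasCompactSupport φ) :
    Integrable (fun x => φ x • f x) volume :=
  (L2.locallyIntegrable f).integrable_smul_left_of_hasCompactSupport hφ hc

lemma IsWeakDeriv.unique {f : ℝ → ℂ} {g h : L2} (hg : IsWeakDeriv f g) (hh : IsWeakDeriv f h) :
    g = h := by
  have key : ∀ᵐ x ∂(volume : Measure ℝ), (g - h : L2) x = 0 := by
    refine ae_eq_zero_of_integral_contDiff_smul_eq_zero (L2.locallyIntegrable _) ?_
    intro φ hφ hc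
    have e : ∫ x, φ x • (g - h : L2) x = ∫ x, (φ x • g x - φ x • h x) := by
      refine integral_congr_ae ?_
      filter_upwards [Lp.coeFn_sub g h] with x hx
      rw [hx, Pi.sub_apply, smul_sub]
    rw [e, integral_sub (L2.integrable_smul g hφ.continuous hc)
      (L2.integrable_smul h hφ.continuous hc)]
    have h1 := hg φ hφ hc
    have h2 := hh φ hφ hc
    rw [h1] at h2
    rw [neg_injective h2, sub_self]
  have hz : (g - h : L2) = 0 := by
    refine Lp.ext ?_
    filter_upwards [key, Lp.coeFn_zero ℂ 2 (volume : Measure ℝ)] with x hx h0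
    rw [hx, h0, Pi.zero_apply]
  exact sub_eq_zero.mp hz

lemma IsWeakDeriv.zero : IsWeakDeriv (0 : L2) (0 : L2) := by
  intro φ _ _
  have e : ∀ ρ : ℝ → ℝ, ∫ x, ρ x • (0 : L2) x = 0 := by
    intro ρ
    rw [← integral_zero ℝ ℂ (μ := volume)]
    refine integral_congr_ae ?_
    filter_upwards [Lp.coeFn_zero ℂ 2 (volume : Measure ℝ)] with x h0
    rw [h0, Pi.zero_apply, smul_zero]
  rw [e, e, neg_zero]

lemma IsWeakDeriv.add {f f' g g' : L2} (hf : IsWeakDeriv f g) (hf' : IsWeakDeriv f' g') :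
    IsWeakDeriv (f + f' : L2) (g + g' : L2) := by
  intro φ hφ hc
  have e : ∀ (ρ : ℝ → ℝ) (a b : L2), Continuous ρ → HasCompactSupport ρ →
      ∫ x, ρ x • (a + b : L2) x = (∫ x, ρ x • a x) + ∫ x, ρ x • b x := by
    intro ρ a b hρ hρc
    rw [← integral_add (L2.integrable_smul a hρ hρc) (L2.integrable_smul b hρ hρc)]
    refine integral_congr_ae ?_
    filter_upwards [Lp.coeFn_add a b] with x hx
    rw [hx, Pi.add_apply, smul_add]
  rw [e _ _ _ (hφ.continuous_deriv (by simp)) hc.deriv, e _ _ _ hφ.continuous hc,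
    hf φ hφ hc, hf' φ hφ hc, neg_add]

lemma IsWeakDeriv.smul (c : ℂ) {f g : L2} (hf : IsWeakDeriv f g) :
    IsWeakDeriv (c • f : L2) (c • g : L2) := by
  intro φ hφ hc
  have e : ∀ (ρ : ℝ → ℝ) (a : L2), ∫ x, ρ x • (c • a : L2) x = c • ∫ x, ρ x • a x := by
    intro ρ a
    rw [← integral_smul]
    refine integral_congr_ae ?_
    filter_upwards [Lp.coeFn_smul c a] with x hx
    rw [hx, Pi.smul_apply, smul_comm]
  rw [e, e, hf φ hφ hc, smul_neg]

/-- The Sobolev space `H¹(ℝ) = {ψ ∈ L²(ℝ) : ψ' ∈ L²(ℝ)}`. -/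
def H1 : Submodule ℂ L2 where
  carrier := {ψ | ∃ g : L2, IsWeakDeriv ψ g}
  add_mem' := fun ⟨g, hg⟩ ⟨g', hg'⟩ => ⟨g + g', hg.add hg'⟩
  zero_mem' := ⟨0, IsWeakDeriv.zero⟩
  smul_mem' := fun c _ ⟨g, hg⟩ => ⟨c • g, hg.smul c⟩

/-- The derivative `ψ' ∈ L²(ℝ)` of `ψ ∈ H¹(ℝ)`. -/
def H1.deriv (ψ : H1) : L2 := ψ.2.choose

lemma H1.isWeakDeriv (ψ : H1) : IsWeakDeriv (ψ : L2) (H1.deriv ψ) := ψ.2.choose_spec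

lemma H1.deriv_add (ψ φ : H1) : H1.deriv (ψ + φ) = H1.deriv ψ + H1.deriv φ :=
  (H1.isWeakDeriv (ψ + φ)).unique ((H1.isWeakDeriv ψ).add (H1.isWeakDeriv φ))

lemma H1.deriv_smul (c : ℂ) (ψ : H1) : H1.deriv (c • ψ) = c • H1.deriv ψ :=
  (H1.isWeakDeriv (c • ψ)).unique ((H1.isWeakDeriv ψ).smul c)

open Classical in
/-- The value `ψ(x)` of `ψ ∈ H¹(ℝ)`: the value at `x` of the continuous representative of `ψ`.
(By the Sobolev embedding every `ψ ∈ H¹(ℝ)` has one, so the second branch never occurs.) -/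
def H1.eval (ψ : H1) (x : ℝ) : ℂ :=
  if h : ∃ g : ℝ → ℂ, Continuous g ∧ (ψ : L2) =ᵐ[volume] g then h.choose x else 0

lemma H1.eval_eq (ψ : H1) {g : ℝ → ℂ} (hg : Continuous g) (h : (ψ : L2) =ᵐ[volume] g) (x : ℝ) :
    H1.eval ψ x = g x := by
  have hex : ∃ g : ℝ → ℂ, Continuous g ∧ (ψ : L2) =ᵐ[volume] g := ⟨g, hg, h⟩
  have := (hex.choose_spec.1.ae_eq_iff_eq volume hg).mp (hex.choose_spec.2.symm.trans h)
  rw [H1.eval, dif_pos hex, this]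

/-- The set (complex vector space) `H¹(ℝ) ⊕ L²(ℝ)` of the states `Ψ = (ψ, π)` of finite energy.
No topology is attached to the type: the topologies of `𝓔` and of `𝓔_F` are introduced below. -/
def State : Type := H1 × L2

instance : AddCommGroup State := inferInstanceAs (AddCommGroup (H1 × L2))

instance : Module ℂ State := inferInstanceAs (Module ℂ (H1 × L2))

/-- The component `ψ` of `Ψ = (ψ, π)`. -/
def State.psi (Ψ : State) : H1 := Prod.fst Ψ

/-- The component `π` of `Ψ = (ψ, π)`. -/
def State.mom (Ψ : State) : L2 := Prod.snd Ψ

lemma State.psi_add (Ψ Φ : State) : (Ψ + Φ).psi = Ψ.psi + Φ.psi := rfl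

lemma State.mom_add (Ψ Φ : State) : (Ψ + Φ).mom = Ψ.mom + Φ.mom := rfl

lemma State.psi_smul (c : ℂ) (Ψ : State) : (c • Ψ).psi = c • Ψ.psi := rfl

lemma State.mom_smul (c : ℂ) (Ψ : State) : (c • Ψ).mom = c • Ψ.mom := rfl

lemma sqrt_triangle (m : ℝ) {a b c a' b' c' p q r : ℝ} (hp : 0 ≤ p) (hq : 0 ≤ q) (hr : 0 ≤ r)
    (h1 : p ≤ a + a') (h2 : q ≤ b + b') (h3 : r ≤ c + c') :
    √(p ^ 2 + q ^ 2 + m ^ 2 * r ^ 2) ≤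
      √(a ^ 2 + b ^ 2 + m ^ 2 * c ^ 2) + √(a' ^ 2 + b' ^ 2 + m ^ 2 * c' ^ 2) := by
  have e : ∀ x y z : ℝ, √(x ^ 2 + y ^ 2 + m ^ 2 * z ^ 2) = ‖!₂[x, y, m * z]‖ := by
    intro x y z
    rw [EuclideanSpace.norm_eq]
    simp [Fin.sum_univ_three, mul_pow]
  have h := norm_add_le !₂[a, b, m * c] !₂[a', b', m * c']
  have e' : !₂[a, b, m * c] + !₂[a', b', m * c'] = !₂[a + a', b + b', m * (c + c')] := by
    ext i
    fin_cases i <;> simp [mul_add]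
  rw [e', ← e, ← e, ← e] at h
  refine le_trans (Real.sqrt_le_sqrt ?_) h
  gcongr

lemma sqrt_homogeneous (m k a b c : ℝ) (hk : 0 ≤ k) :
    √((k * a) ^ 2 + (k * b) ^ 2 + m ^ 2 * (k * c) ^ 2) = k * √(a ^ 2 + b ^ 2 + m ^ 2 * c ^ 2) := by
  rw [show (k * a) ^ 2 + (k * b) ^ 2 + m ^ 2 * (k * c) ^ 2
      = k ^ 2 * (a ^ 2 + b ^ 2 + m ^ 2 * c ^ 2) by ring,
    Real.sqrt_mul (sq_nonneg k), Real.sqrt_sq hk]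

/-- The norm `‖Ψ‖_𝓔`, where `‖Ψ‖_𝓔² = ‖π‖² + ‖ψ'‖² + m² ‖ψ‖²` (norms of `L²(ℝ)`). -/
def energyNorm (m : ℝ) : Seminorm ℂ State :=
  Seminorm.of
    (fun Ψ => √(‖Ψ.mom‖ ^ 2 + ‖H1.deriv Ψ.psi‖ ^ 2 + m ^ 2 * ‖Ψ.psi‖ ^ 2))
    (fun Ψ Φ => by
      refine sqrt_triangle m (norm_nonneg _) (norm_nonneg _) (norm_nonneg _) ?_ ?_ ?_
      · rw [State.mom_add]
        exact norm_add_le _ _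
      · rw [State.psi_add, H1.deriv_add]
        exact norm_add_le _ _
      · rw [State.psi_add]
        exact norm_add_le _ _)
    (fun c Ψ => by
      rw [State.mom_smul, State.psi_smul, H1.deriv_smul, norm_smul, norm_smul, norm_smul]
      exact sqrt_homogeneous m _ _ _ _ (norm_nonneg c))

/-- The norm of `L²(-R, R)`. -/
def localNorm (R : ℝ) (f : L2) : ℝ :=
  (eLpNorm f 2 (volume.restrict (Set.Ioo (-R) R))).toReal

lemma L2.memLp_restrict (f : L2) (R : ℝ) :
    MemLp f 2 (volume.restrict (Set.Ioo (-R) R)) :=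
  (Lp.memLp f).mono_measure Measure.restrict_le_self

lemma localNorm_nonneg (R : ℝ) (f : L2) : 0 ≤ localNorm R f := ENNReal.toReal_nonneg

lemma localNorm_add_le (R : ℝ) (f g : L2) : localNorm R (f + g) ≤ localNorm R f + localNorm R g := by
  have hf := L2.memLp_restrict f R
  have hg := L2.memLp_restrict g R
  unfold localNorm
  rw [eLpNorm_congr_ae (ae_restrict_of_ae (Lp.coeFn_add f g)),
    ← ENNReal.toReal_add hf.2.ne hg.2.ne]
  exact ENNReal.toReal_mono (ENNReal.add_ne_top.mpr ⟨hf.2.ne, hg.2.ne⟩)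
    (eLpNorm_add_le hf.1 hg.1 (by norm_num))

lemma localNorm_smul (R : ℝ) (c : ℂ) (f : L2) : localNorm R (c • f) = ‖c‖ * localNorm R f := by
  unfold localNorm
  rw [eLpNorm_congr_ae (ae_restrict_of_ae (Lp.coeFn_smul c f)), eLpNorm_const_smul,
    ENNReal.toReal_mul]
  simp

/-- The seminorm `‖Ψ‖_{𝓔,R}`, where `‖Ψ‖_{𝓔,R}² = ‖π‖² + ‖ψ'‖² + m² ‖ψ‖²`
(norms of `L²(-R, R)`). -/
def localEnergyNorm (m R : ℝ) : Seminorm ℂ State :=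
  Seminorm.of
    (fun Ψ => √(localNorm R Ψ.mom ^ 2 + localNorm R (H1.deriv Ψ.psi) ^ 2
      + m ^ 2 * localNorm R (Ψ.psi : L2) ^ 2))
    (fun Ψ Φ => by
      refine sqrt_triangle m (localNorm_nonneg _ _) (localNorm_nonneg _ _)
        (localNorm_nonneg _ _) ?_ ?_ ?_
      · rw [State.mom_add]
        exact localNorm_add_le _ _ _
      · rw [State.psi_add, H1.deriv_add]
        exact localNorm_add_le _ _ _
      · rw [State.psi_add]
        exact localNorm_add_le _ _ _)
    (fun c Ψ => by
      rw [State.mom_smul, State.psi_smul, H1.deriv_smul, Submodule.coe_smul, localNorm_smul,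
        localNorm_smul, localNorm_smul]
      exact sqrt_homogeneous m _ _ _ _ (norm_nonneg c))

/-- The topology of the space `𝓔`: the one of the norm `‖·‖_𝓔`. -/
@[reducible]
def energyTopology (m : ℝ) : TopologicalSpace State :=
  (energyNorm m).toSeminormedAddCommGroup.toUniformSpace.toTopologicalSpace

/-- The topology of the space `𝓔_F`: the one defined by the seminorms `‖·‖_{𝓔,R}`, `R > 0`. -/
@[reducible]
def localEnergyTopology (m : ℝ) : TopologicalSpace State :=
  (SeminormFamily.moduleFilterBasis
    (fun R : Set.Ioi (0 : ℝ) => localEnergyNorm m R : SeminormFamily ℂ State _)).topology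

/-- The Hamilton functional
`𝓗(Ψ) = ½ ∫ (|π|² + |ψ'|² + m² |ψ|²) dx + U(ψ(0))`. -/
def hamiltonian (m : ℝ) (U : ℂ → ℝ) (Ψ : State) : ℝ :=
  (1 / 2) * (∫ x, (‖Ψ.mom x‖ ^ 2 + ‖H1.deriv Ψ.psi x‖ ^ 2 + m ^ 2 * ‖(Ψ.psi : L2) x‖ ^ 2))
    + U (H1.eval Ψ.psi 0)

/-- `Ψ(t) = (ψ(·,t), π(·,t))` is a solution in `C(ℝ, 𝓔)` of the Cauchy problem
`∂ₜψ = π`, `∂ₜπ = ∂ₓ²ψ - m² ψ + δ(x) F(ψ(0,t))`, `Ψ(0) = Ψ₀`.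
The two equations hold in the sense of distributions on the plane of the variables `(x, t)`. -/
structure IsSolution (m : ℝ) (F : ℂ → ℂ) (Ψ₀ : State) (Ψ : ℝ → State) : Prop where
  continuous : @Continuous ℝ State _ (energyTopology m) Ψ
  eq_psi : ∀ φ : ℝ × ℝ → ℝ, ContDiff ℝ ∞ φ → HasCompactSupport φ →
    -(∫ t, ∫ x, deriv (fun s => φ (x, s)) t • ((Ψ t).psi : L2) x)
      = ∫ t, ∫ x, φ (x, t) • (Ψ t).mom x
  eq_mom : ∀ φ : ℝ × ℝ → ℝ, ContDiff ℝ ∞ φ → HasCompactSupport φ →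
    -(∫ t, ∫ x, deriv (fun s => φ (x, s)) t • (Ψ t).mom x)
      = (∫ t, ∫ x, (iteratedDeriv 2 (fun y => φ (y, t)) x - m ^ 2 * φ (x, t))
            • ((Ψ t).psi : L2) x)
        + ∫ t, φ (0, t) • F (H1.eval (Ψ t).psi 0)
  initial : Ψ 0 = Ψ₀

end KleinGordonOscillator

end

noncomputable section

namespace KleinGordonOscillator

open Set Filter Topology
open scoped InnerProductSpace Interval

/-! ### Primitives, weak derivatives and integration by parts -/

section

open intervalIntegral

/-! The Riemann invariants π + ε ψ', ε = ±1, split the equation into two transport equations ∂ₜv = ε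
∂ₓv - m²ψ + δ(x) f with f(t) = F(ψ(0,t)). In coordinates moving along the characteristics, the point
source deposits the values f(s) for s between 0 and t at distinct points, so it contributes the
truncated function `cut f 0 t`, whose L² norm is that of f between 0 and t. The singular source is
therefore harmless in 𝓔, and the mass term can be treated as one more source. `IsMild` is this
integrated form; `IsSolution.isMild` and `IsMild.isSolution` identify it with the distributional
one.

Integration in time against the weight exp(l|t|) gains 1/l for the L² source and 1/√l for the point
source (`IsMild.sumNorm_le`). For large l this gives a contraction when the nonlinearity is globally
Lipschitz (`exists_isMild_of_lipschitz`) and a Gronwall inequality (`IsMild.sumNorm_le_exp`). Since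
signals travel at unit speed, the estimates hold on domains of dependence as well as on the whole
line. With F locally Lipschitz, `IsSolution.stability` then yields uniqueness and continuity of the
flow both in 𝓔 and in 𝓔_F.

Energy conservation cannot be obtained by simply pairing the equation with ∂ₜψ, because π has no
point value at 0. Instead π(t) is paired with ψ(t+h) - ψ(t-h). Integrating the derivative of this
pairing, dividing by h and letting h → 0 expresses the increment of the free energy as the limiting
work of the source (`IsMild.tendsto_work`). By |ψ(0)|² ≤ ‖ψ‖ ‖ψ'‖ the trace satisfies |ψ(0,t+h) -
ψ(0,t)|² = o(h), so a Taylor bound with quadratic remainder turns this work into minus the increment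
of 2U(ψ(0,·)) (`IsMild.hamiltonian_eq`).

Finally the sharp inequality 2m|ψ(0)|² ≤ ‖ψ'‖² + m²‖ψ‖² and B < m make the Hamiltonian coercive
(`freeEnergy_le`). For global existence F is replaced outside a large ball by a globally Lipschitz
G. As long as the trace stays in the ball the original energy is conserved, and coercivity then
keeps the trace strictly inside it, so the truncation is never felt. The same coercivity bounds the
energy norm for all times. -/

lemma _root_.MeasureTheory.LocallyIntegrable.intervalIntegrable_real {g : ℝ → ℂ}
    (hg : LocallyIntegrable g volume) (a b : ℝ) : IntervalIntegrable g volume a b :=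
  intervalIntegrable_iff.mpr ((hg.integrableOn_isCompact isCompact_uIcc).mono_set uIoc_subset_uIcc)

/-- The primitive of a locally integrable complex function is absolutely continuous. -/
lemma absolutelyContinuousOnInterval_primitive {g : ℝ → ℂ} (hg : LocallyIntegrable g volume)
    (a b : ℝ) : AbsolutelyContinuousOnInterval (fun x => ∫ t in a..x, g t) a b := by
  have hi := hg.intervalIntegrable_real a b
  have hre : IntervalIntegrable (fun t => (g t).re) volume a b :=
    ⟨hi.1.re, hi.2.re⟩
  have him : IntervalIntegrable (fun t => (g t).im) volume a b :=
    ⟨hi.1.im, hi.2.im⟩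
  have h1 := hre.absolutelyContinuousOnInterval_intervalIntegral (c := a) (by simp)
  have h2 := him.absolutelyContinuousOnInterval_intervalIntegral (c := a) (by simp)
  have hc : ∀ z : ℂ, AbsolutelyContinuousOnInterval (fun _ : ℝ => z) a b := fun z =>
    (LipschitzWith.const z).lipschitzOnWith.absolutelyContinuousOnInterval
  have h3 := (h1.fun_smul (hc 1)).fun_add (h2.fun_smul (hc Complex.I))
  refine cast ?_ h3
  congr 1
  funext x
  have hx := hg.intervalIntegrable_real a x
  have e1 : ∫ t in a..x, (g t).re = (∫ t in a..x, g t).re := by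
    simpa using (Complex.reCLM.intervalIntegral_comp_comm hx)
  have e2 : ∫ t in a..x, (g t).im = (∫ t in a..x, g t).im := by
    simpa using (Complex.imCLM.intervalIntegral_comp_comm hx)
  simp only [e1, e2, Complex.real_smul, mul_one]
  exact Complex.re_add_im _

/-- Integration by parts against a primitive of a locally integrable function. -/
lemma integral_deriv_smul_add_smul {φ : ℝ → ℝ} (hφ : ContDiff ℝ 1 φ) {g G : ℝ → ℂ}
    (hg : LocallyIntegrable g volume) (hG : ∀ x, G x = G 0 + ∫ t in (0 : ℝ)..x, g t) (a b : ℝ) :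
    ∫ x in a..b, (deriv φ x • G x + φ x • g x) = φ b • G b - φ a • G a := by
  have hii := hg.intervalIntegrable_real
  have hGa : ∀ x, G x = G a + ∫ t in a..x, g t := by
    intro x
    rw [hG x, hG a, add_assoc, integral_add_adjacent_intervals (hii _ _) (hii _ _)]
  have hGac : AbsolutelyContinuousOnInterval G a b := by
    have h := (LipschitzWith.const (α := ℝ) (G a)).lipschitzOnWith
      (s := uIcc a b) |>.absolutelyContinuousOnInterval.fun_add
        (absolutelyContinuousOnInterval_primitive hg a b)
    exact cast (by congr 1; funext x; exact (hGa x).symm) h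
  have hGc : Continuous G := by
    have : G = fun x => G 0 + ∫ t in (0 : ℝ)..x, g t := funext hG
    rw [this]
    exact continuous_const.add (continuous_primitive hii 0)
  have hφac : AbsolutelyContinuousOnInterval φ a b :=
    hφ.contDiffOn.absolutelyContinuousOnInterval
  have hprod := hφac.fun_smul hGac
  have hloc : LocallyIntegrable (fun x => deriv φ x • G x + φ x • g x) volume := by
    refine LocallyIntegrable.add ?_ ?_
    · exact ((hφ.continuous_deriv le_rfl).smul hGc).locallyIntegrable
    · exact hg.continuous_smul hφ.continuous
  have hprim := absolutelyContinuousOnInterval_primitive hloc a b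
  -- The product φG minus the primitive of its a.e. derivative is absolutely continuous with
  -- derivative zero a.e., hence constant. Comparing the two end points gives the formula.
  obtain ⟨C, hC⟩ := (hprod.fun_sub hprim).const_of_ae_hasDerivAt_zero (by
    filter_upwards [_root_.LocallyIntegrable.ae_hasDerivAt_integral hg,
      _root_.LocallyIntegrable.ae_hasDerivAt_integral hloc] with x h1 h2 _
    have d1 : HasDerivAt G (g x) x := by
      have := (h1 0).const_add (G 0)
      rwa [show (fun x => G 0 + ∫ t in (0 : ℝ)..x, g t) = G from (funext hG).symm] at this
    have d2 := ((hφ.differentiable (by simp)) x).hasDerivAt.fun_smul d1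
    refine (d2.fun_sub (h2 a)).congr_deriv ?_
    rw [add_comm, sub_self])
  have ha := hC a left_mem_uIcc
  have hb := hC b right_mem_uIcc
  simp only [integral_same, sub_zero] at ha
  rw [← ha] at hb
  rw [← hb]; ring

/-- The primitive of a locally integrable function has it as its weak derivative. -/
lemma isWeakDeriv_primitive {g G : ℝ → ℂ} (hg : LocallyIntegrable g volume)
    (hG : ∀ x, G x = G 0 + ∫ t in (0 : ℝ)..x, g t) : IsWeakDeriv G g := by
  intro φ hφ hc
  have hGc : Continuous G := by
    have : G = fun x => G 0 + ∫ t in (0 : ℝ)..x, g t := funext hG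
    rw [this]
    exact continuous_const.add (continuous_primitive hg.intervalIntegrable_real 0)
  obtain ⟨R, hR⟩ := hc.isCompact.isBounded.subset_closedBall 0
  -- The extra 1 makes φ vanish at ±r too, so there are no boundary terms, and keeps the interval
  -- nondegenerate when R is negative.
  set r := max R 0 + 1
  have hr : ∀ x, x ∉ Ioc (-r) r → φ x = 0 := by
    intro x hx
    by_contra h
    have := hR (subset_tsupport _ h)
    rw [mem_closedBall_zero_iff, Real.norm_eq_abs, abs_le] at this
    have h1 : R ≤ max R 0 := le_max_left _ _
    exact hx ⟨by simp only [r]; linarith, by simp only [r]; linarith⟩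
  have hr' : ∀ x, x ∉ Ioc (-r) r → deriv φ x = 0 := by
    intro x hx
    by_contra h
    have := hR ((tsupport_deriv_subset (𝕜 := ℝ)) (subset_tsupport _ h))
    rw [mem_closedBall_zero_iff, Real.norm_eq_abs, abs_le] at this
    have h1 : R ≤ max R 0 := le_max_left _ _
    exact hx ⟨by simp only [r]; linarith, by simp only [r]; linarith⟩
  have hrr : -r ≤ r := by
    have : 0 ≤ max R 0 := le_max_right _ _
    simp only [r]; linarith
  have h := integral_deriv_smul_add_smul (hφ.of_le (by simp)) hg hG (-r) r
  have i1 : Integrable (fun x => deriv φ x • G x) volume :=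
    ((hφ.continuous_deriv (by simp)).smul hGc).integrable_of_hasCompactSupport
      hc.deriv.smul_right
  have i2 : Integrable (fun x => φ x • g x) volume :=
    hg.integrable_smul_left_of_hasCompactSupport hφ.continuous hc
  have hbd : φ r = 0 ∧ φ (-r) = 0 := by
    constructor
    · by_contra h
      have := hR (subset_tsupport _ h)
      rw [mem_closedBall_zero_iff, Real.norm_eq_abs, abs_le] at this
      have h1 : R ≤ max R 0 := le_max_left _ _
      simp only [r] at this; linarith [this.2]
    · exact hr _ (by simp)
  rw [hbd.1, hbd.2, zero_smul, zero_smul, sub_zero, integral_of_le hrr,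
    setIntegral_eq_integral_of_forall_compl_eq_zero, integral_add i1 i2] at h
  · exact eq_neg_of_add_eq_zero_left h
  · intro x hx
    rw [hr x hx, hr' x hx]; simp

/-- A smooth compactly supported function of vanishing integral is the derivative of such a
function. -/
lemma exists_test_primitive {η : ℝ → ℝ} (hη : ContDiff ℝ ∞ η) (hc : HasCompactSupport η)
    (h0 : ∫ x, η x = 0) : ∃ θ : ℝ → ℝ, ContDiff ℝ ∞ θ ∧ HasCompactSupport θ ∧ deriv θ = η := by
  obtain ⟨R, hR⟩ := hc.isCompact.isBounded.subset_closedBall 0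
  have hz : ∀ x, R < |x| → η x = 0 := by
    intro x hx
    by_contra h
    have := hR (subset_tsupport _ h)
    rw [mem_closedBall_zero_iff, Real.norm_eq_abs] at this
    linarith
  set r := max R 0 + 1
  have hr0 : 0 < r := by have : 0 ≤ max R 0 := le_max_right _ _; simp only [r]; linarith
  have hRr : R < r := by have : R ≤ max R 0 := le_max_left _ _; simp only [r]; linarith
  set θ : ℝ → ℝ := fun x => ∫ t in (-r)..x, η t
  have hd : ∀ x, HasDerivAt θ (η x) x := fun x =>
    integral_hasDerivAt_right (hη.continuous.intervalIntegrable _ _)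
      hη.continuous.stronglyMeasurable.stronglyMeasurableAtFilter hη.continuous.continuousAt
  have hderiv : deriv θ = η := funext fun x => (hd x).deriv
  refine ⟨θ, ?_, ?_, hderiv⟩
  · rw [contDiff_infty_iff_deriv, hderiv]
    exact ⟨fun x => (hd x).differentiableAt, hη⟩
  · refine HasCompactSupport.intro (isCompact_Icc (a := -r) (b := r)) ?_
    intro x hx
    rw [mem_Icc, not_and_or, not_le, not_le] at hx
    rcases hx with hx | hx
    · refine (integral_congr (g := fun _ => 0) ?_).trans (by simp)
      intro t ht
      rw [uIcc_of_ge hx.le] at ht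
      exact hz t (by rw [abs_of_neg (by linarith [ht.2])]; linarith [ht.2])
    · have hle : -r ≤ x := by linarith
      change ∫ t in (-r)..x, η t = 0
      rw [integral_of_le hle, setIntegral_eq_integral_of_forall_compl_eq_zero, h0]
      intro t ht
      rw [mem_Ioc, not_and_or, not_lt, not_le] at ht
      rcases ht with ht | ht
      · exact hz t (by rw [abs_of_neg (by linarith)]; linarith)
      · exact hz t (by rw [abs_of_pos (by linarith)]; linarith)

/-- A locally integrable function of vanishing weak derivative is constant. -/
lemma ae_const_of_weakDeriv_zero {f : ℝ → ℂ} (hf : LocallyIntegrable f volume)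
    (h : ∀ φ : ℝ → ℝ, ContDiff ℝ ∞ φ → HasCompactSupport φ → ∫ x, deriv φ x • f x = 0) :
    ∃ c : ℂ, f =ᵐ[volume] fun _ => c := by
  obtain ⟨ρ, -, hρc, hρ, hρr, hρ1⟩ :=
    exists_contDiff_tsupport_subset (E := ℝ) (n := ⊤) (x := 0) (s := univ) univ_mem
  have hρi : 0 < ∫ x, ρ x := by
    refine hρ.continuous.integral_pos_of_hasCompactSupport_nonneg_nonzero hρc
      (fun x => (hρr (mem_range_self x)).1) (x := 0) (by rw [hρ1]; norm_num)
  set k := ∫ x, ρ x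
  set c : ℂ := k⁻¹ • ∫ x, ρ x • f x
  refine ⟨c, ?_⟩
  have key := ae_eq_zero_of_integral_contDiff_smul_eq_zero (μ := volume)
    (hf.sub (locallyIntegrable_const c)) ?_
  · filter_upwards [key] with x hx
    simpa [sub_eq_zero] using hx
  intro φ hφ hc
  have i1 : ∀ {η : ℝ → ℝ}, Continuous η → HasCompactSupport η →
      Integrable (fun x => η x • f x) volume := fun h1 h2 =>
    hf.integrable_smul_left_of_hasCompactSupport h1 h2
  have j1 : ∀ {η : ℝ → ℝ}, Continuous η → HasCompactSupport η → Integrable η volume :=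
    fun h1 h2 => h1.integrable_of_hasCompactSupport h2
  -- Subtracting this multiple of the fixed bump ρ makes the integral vanish, so the difference is
  -- the derivative of a test function and is annihilated by f.
  set l := (∫ x, φ x) * k⁻¹
  have hηs : ContDiff ℝ ∞ (fun x => φ x - l * ρ x) := hφ.sub (contDiff_const.mul hρ)
  have hηc : HasCompactSupport (fun x => φ x - l * ρ x) :=
    hc.sub (hρc.mul_left (f := fun _ => l))
  obtain ⟨θ, hθ, hθc, hθd⟩ := exists_test_primitive hηs hηc (by
    rw [integral_sub (j1 hφ.continuous hc) ((j1 hρ.continuous hρc).const_mul l),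
      MeasureTheory.integral_const_mul]
    simp only [l]
    field_simp
    simp [k])
  have h2 := h θ hθ hθc
  rw [hθd] at h2
  have e1 : (fun x => (φ x - l * ρ x) • f x) = fun x => φ x • f x - l • (ρ x • f x) := by
    funext x; rw [sub_smul, mul_smul]
  rw [e1, MeasureTheory.integral_sub (i1 hφ.continuous hc)
    (show Integrable (fun x => l • (ρ x • f x)) volume from (i1 hρ.continuous hρc).smul l),
    MeasureTheory.integral_smul, sub_eq_zero] at h2
  simp only [Pi.sub_apply, smul_sub]
  have i3 : Integrable (fun x => φ x • c) volume := (j1 hφ.continuous hc).smul_const c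
  rw [MeasureTheory.integral_sub (i1 hφ.continuous hc) i3, h2, _root_.integral_smul_const,
    sub_eq_zero]
  simp only [c, l, mul_smul]

/-- A function with a locally integrable weak derivative is a primitive of it. -/
lemma IsWeakDeriv.exists_ae_eq_primitive {f g : ℝ → ℂ} (hf : LocallyIntegrable f volume)
    (hg : LocallyIntegrable g volume) (h : IsWeakDeriv f g) :
    ∃ c : ℂ, f =ᵐ[volume] fun x => c + ∫ t in (0 : ℝ)..x, g t := by
  set G : ℝ → ℂ := fun x => ∫ t in (0 : ℝ)..x, g t
  have hG : IsWeakDeriv G g := isWeakDeriv_primitive hg (fun x => by simp [G])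
  have hGc : Continuous G := continuous_primitive hg.intervalIntegrable_real 0
  obtain ⟨c, hc⟩ := ae_const_of_weakDeriv_zero (hf.sub hGc.locallyIntegrable) (by
    intro φ hφ hcφ
    have d1 := hφ.continuous_deriv (by simp)
    simp only [Pi.sub_apply, smul_sub]
    rw [integral_sub (hf.integrable_smul_left_of_hasCompactSupport d1 hcφ.deriv)
      (hGc.locallyIntegrable.integrable_smul_left_of_hasCompactSupport d1 hcφ.deriv),
      h φ hφ hcφ, hG φ hφ hcφ, sub_self])
  refine ⟨c, ?_⟩
  filter_upwards [hc] with x hx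
  rw [← hx]; simp [G]

/-- A continuous function with a continuous weak derivative is a primitive of it. -/
lemma IsWeakDeriv.eq_primitive {f g : ℝ → ℂ} (hf : Continuous f) (hg : Continuous g)
    (h : IsWeakDeriv f g) (x : ℝ) : f x = f 0 + ∫ t in (0 : ℝ)..x, g t := by
  obtain ⟨c, hc⟩ := h.exists_ae_eq_primitive hf.locallyIntegrable hg.locallyIntegrable
  have := (hf.ae_eq_iff_eq volume (continuous_const.add
    (continuous_primitive (fun a b => hg.intervalIntegrable a b) 0))).mp hc
  have h0 : f 0 = c := by simpa using congrFun this 0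
  rw [h0]
  exact congrFun this x

end

/-! ### Local L² norms -/

/-- The norm of `L²(J)`. -/
def setNorm (J : Set ℝ) (f : L2) : ℝ := (eLpNorm f 2 (volume.restrict J)).toReal

lemma norm_eq_setNorm_univ (f : L2) : ‖f‖ = setNorm univ f := by
  rw [setNorm, Measure.restrict_univ, Lp.norm_def]

lemma setNorm_nonneg (J : Set ℝ) (f : L2) : 0 ≤ setNorm J f := ENNReal.toReal_nonneg

lemma setNorm_mono {J K : Set ℝ} (h : J ⊆ K) (f : L2) : setNorm J f ≤ setNorm K f :=
  ENNReal.toReal_mono ((Lp.memLp f).restrict K).2.ne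
    (eLpNorm_mono_measure _ (Measure.restrict_mono h le_rfl))

lemma setNorm_le_norm (J : Set ℝ) (f : L2) : setNorm J f ≤ ‖f‖ := by
  rw [norm_eq_setNorm_univ]
  exact setNorm_mono (subset_univ _) f

/-- Restriction of functions to `J`. -/
def restr (J : Set ℝ) : L2 →L[ℂ] Lp ℂ 2 (volume.restrict J) := LpToLpRestrictCLM ℝ ℂ ℂ volume 2 J

lemma norm_restr (J : Set ℝ) (f : L2) : ‖restr J f‖ = setNorm J f := by
  rw [restr, Lp.norm_def, setNorm, eLpNorm_congr_ae (LpToLpRestrictCLM_coeFn ℂ J f)]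

lemma setNorm_add_le (J : Set ℝ) (f g : L2) : setNorm J (f + g) ≤ setNorm J f + setNorm J g := by
  simp only [← norm_restr, map_add]
  exact norm_add_le _ _

lemma setNorm_smul (J : Set ℝ) (c : ℂ) (f : L2) : setNorm J (c • f) = ‖c‖ * setNorm J f := by
  simp only [← norm_restr, map_smul, norm_smul]

lemma setNorm_sub_le (J : Set ℝ) (f g : L2) : setNorm J (f - g) ≤ setNorm J f + setNorm J g := by
  simp only [← norm_restr, map_sub]
  exact norm_sub_le _ _

lemma setNorm_sq (J : Set ℝ) (f : L2) : setNorm J f ^ 2 = ∫ x in J, ‖f x‖ ^ 2 := by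
  have h := (Lp.memLp f).restrict J
  have e := h.eLpNorm_eq_integral_rpow_norm (by norm_num) (by norm_num)
  have hn : 0 ≤ ∫ x in J, ‖f x‖ ^ 2 := by positivity
  rw [setNorm, e, ENNReal.toReal_ofReal (by positivity)]
  simp only [ENNReal.toReal_ofNat, Real.rpow_ofNat]
  rw [← Real.rpow_natCast, ← Real.rpow_mul hn]
  norm_num

lemma L2.integrable_norm_sq (f : L2) : Integrable (fun x => ‖f x‖ ^ 2) volume :=
  (memLp_two_iff_integrable_sq_norm (Lp.memLp f).1).mp (Lp.memLp f)

lemma L2.norm_sq_eq_integral (f : L2) : ‖f‖ ^ 2 = ∫ x, ‖f x‖ ^ 2 := by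
  rw [norm_eq_setNorm_univ, setNorm_sq, Measure.restrict_univ]

/-- Hölder's inequality on an interval of length one, which is why no constant appears. -/
lemma integral_norm_le_setNorm {J : Set ℝ} (hJ : Ioo 0 1 ⊆ J) (f : L2) :
    ∫ x in (0 : ℝ)..1, ‖f x‖ ≤ setNorm J f := by
  refine le_trans ?_ (setNorm_mono hJ f)
  rw [intervalIntegral.integral_of_le zero_le_one, integral_Ioc_eq_integral_Ioo]
  have hm := (Lp.memLp f).restrict (Ioo (0 : ℝ) 1)
  rw [integral_norm_eq_lintegral_enorm hm.1, ← eLpNorm_one_eq_lintegral_enorm]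
  refine ENNReal.toReal_mono hm.2.ne ?_
  refine (eLpNorm_le_eLpNorm_mul_rpow_measure_univ (p := 1) (q := 2) (by norm_num) hm.1).trans ?_
  simp

/-! ### Point values of H¹ functions and Sobolev inequalities -/

namespace H1

/-- A primitive of the weak derivative is a continuous representative, so `eval` always takes its
first branch and inherits the primitive formula. -/
lemma continuous_eval_and_ae_eq (ψ : H1) :
    Continuous (eval ψ) ∧ ((ψ : L2) : ℝ → ℂ) =ᵐ[volume] eval ψ ∧
      ∀ x, eval ψ x = eval ψ 0 + ∫ t in (0 : ℝ)..x, deriv ψ t := by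
  have hl := L2.locallyIntegrable (deriv ψ)
  obtain ⟨c, hc⟩ := (isWeakDeriv ψ).exists_ae_eq_primitive (L2.locallyIntegrable _) hl
  have hcont : Continuous (fun x => c + ∫ t in (0 : ℝ)..x, deriv ψ t) :=
    continuous_const.add (intervalIntegral.continuous_primitive hl.intervalIntegrable_real 0)
  have he : ∀ x, eval ψ x = c + ∫ t in (0 : ℝ)..x, deriv ψ t := eval_eq ψ hcont hc
  have he' : eval ψ = fun x => c + ∫ t in (0 : ℝ)..x, deriv ψ t := funext he
  refine ⟨he' ▸ hcont, he' ▸ hc, fun x => ?_⟩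
  rw [he x, he 0]
  simp

lemma continuous_eval (ψ : H1) : Continuous (eval ψ) := (continuous_eval_and_ae_eq ψ).1

lemma coe_ae_eq (ψ : H1) : ((ψ : L2) : ℝ → ℂ) =ᵐ[volume] eval ψ := (continuous_eval_and_ae_eq ψ).2.1

lemma eval_eq_primitive (ψ : H1) (x : ℝ) : eval ψ x = eval ψ 0 + ∫ t in (0 : ℝ)..x, deriv ψ t :=
  (continuous_eval_and_ae_eq ψ).2.2 x

lemma eval_sub (ψ φ : H1) (x : ℝ) : eval (ψ - φ) x = eval ψ x - eval φ x := by
  refine eval_eq _ (g := fun x => eval ψ x - eval φ x)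
    ((continuous_eval ψ).sub (continuous_eval φ)) ?_ x
  filter_upwards [Lp.coeFn_sub (ψ : L2) (φ : L2), coe_ae_eq ψ, coe_ae_eq φ] with x h1 h2 h3
  rw [Submodule.coe_sub, h1, Pi.sub_apply, h2, h3]

lemma deriv_neg (ψ : H1) : deriv (-ψ) = -deriv ψ := by
  have := deriv_smul (-1) ψ
  simpa using this

lemma deriv_sub (ψ φ : H1) : deriv (ψ - φ) = deriv ψ - deriv φ := by
  rw [sub_eq_add_neg, deriv_add, deriv_neg, sub_eq_add_neg]

/-- The element of `H¹(ℝ)` given by `f ∈ L²(ℝ)` and its weak derivative `g ∈ L²(ℝ)`. -/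
def ofWeakDeriv (f g : L2) (h : IsWeakDeriv f g) : H1 := ⟨f, g, h⟩

lemma deriv_ofWeakDeriv (f g : L2) (h : IsWeakDeriv f g) : deriv (ofWeakDeriv f g h) = g :=
  (isWeakDeriv (ofWeakDeriv f g h)).unique h

/-- The local Sobolev inequality. -/
lemma norm_eval_zero_le {J : Set ℝ} (hJ : Ioo 0 1 ⊆ J) (ψ : H1) :
    ‖eval ψ 0‖ ≤ setNorm J ψ + setNorm J (deriv ψ) := by
  have hl := L2.locallyIntegrable (deriv ψ)
  have hψ := L2.locallyIntegrable (ψ : L2)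
  -- The weight 1 - x equals 1 at 0 and 0 at 1, so integration by parts over [0,1] isolates the
  -- value at 0.
  have hφ : ContDiff ℝ 1 (fun x : ℝ => 1 - x) := contDiff_const.sub contDiff_id
  have hd : ∀ x : ℝ, _root_.deriv (fun x : ℝ => 1 - x) x = -1 := fun x => by
    simp
  have h := integral_deriv_smul_add_smul hφ hl (eval_eq_primitive ψ) 0 1
  have i1 := (hl.intervalIntegrable_real 0 1).norm
  have i2 := (hψ.intervalIntegrable_real 0 1).norm
  simp only [hd, sub_self, zero_smul, sub_zero, one_smul, zero_sub] at h
  rw [← norm_neg, ← h]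
  refine le_trans (b := ∫ x in (0 : ℝ)..1, (‖(ψ : L2) x‖ + ‖deriv ψ x‖)) ?_ ?_
  · refine intervalIntegral.norm_integral_le_of_norm_le zero_le_one ?_ (i2.add i1)
    filter_upwards [coe_ae_eq ψ] with x hx hx1
    rw [hx]
    refine (norm_add_le _ _).trans (add_le_add (by simp) ?_)
    rw [norm_smul]
    refine mul_le_of_le_one_left (norm_nonneg _) ?_
    rw [Real.norm_eq_abs, abs_le]
    constructor <;> linarith [hx1.1, hx1.2]
  · rw [intervalIntegral.integral_add i2 i1]
    exact add_le_add (integral_norm_le_setNorm hJ _) (integral_norm_le_setNorm hJ _)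

end H1

lemma integral_zero_exp_mul {a : ℝ} (ha : a ≠ 0) (x : ℝ) :
    ∫ t in (0 : ℝ)..x, Real.exp (a * t) = (Real.exp (a * x) - 1) / a := by
  have h : ∀ t ∈ uIcc 0 x, HasDerivAt (fun t => Real.exp (a * t) / a) (Real.exp (a * t)) t := by
    intro t _
    have := (((hasDerivAt_id t).const_mul a).exp).div_const a
    simpa [ha] using this
  rw [intervalIntegral.integral_eq_sub_of_hasDerivAt h
    ((by fun_prop : Continuous fun t => Real.exp (a * t)).intervalIntegrable _ _)]
  simp [sub_div]

/-- The half-line Sobolev inequality with an exponential weight, before the cut-off is removed. -/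
lemma norm_sq_le_halfLine_cutoff {g G : ℝ → ℂ} (hg : LocallyIntegrable g volume)
    (hG : ∀ x, G x = G 0 + ∫ t in (0 : ℝ)..x, g t) (hg2 : Integrable (fun x => ‖g x‖ ^ 2) volume)
    (hG2 : Integrable (fun x => ‖G x‖ ^ 2) volume) {l R : ℝ} (hl : 0 < l) (hR : 0 < R) :
    l * ‖G 0‖ ^ 2 ≤ (l + 1 / R) ^ 2 * (∫ x in Ioi 0, ‖G x‖ ^ 2) + ∫ x in Ioi 0, ‖g x‖ ^ 2 := by
  set c := l + 1 / R
  have hc : 0 < c := by positivity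
  have hGc : Continuous G := by
    have : G = fun x => G 0 + ∫ t in (0 : ℝ)..x, g t := funext hG
    rw [this]
    exact continuous_const.add (intervalIntegral.continuous_primitive hg.intervalIntegrable_real 0)
  -- The exponential is the extremal profile; the linear factor makes it vanish at R. On [0,R] one
  -- has |φ'| ≤ c exp(-lx), which is where c = l + 1/R comes from.
  set φ : ℝ → ℝ := fun x => (1 - x / R) * Real.exp (-l * x)
  have hφd : ∀ x, HasDerivAt φ
      (-(1 / R) * Real.exp (-l * x) + (1 - x / R) * (Real.exp (-l * x) * -l)) x := by
    intro x
    have h1 : HasDerivAt (fun x : ℝ => 1 - x / R) (-(1 / R)) x :=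
      ((hasDerivAt_id x).div_const R).const_sub 1
    have h2 : HasDerivAt (fun x : ℝ => Real.exp (-l * x)) (Real.exp (-l * x) * -l) x := by
      simpa using ((hasDerivAt_id x).const_mul (-l)).exp
    exact h1.mul h2
  have hφ : ContDiff ℝ 1 φ := by
    simp only [φ]
    fun_prop
  have h := integral_deriv_smul_add_smul hφ hg hG 0 R
  have hφ0 : φ 0 = 1 := by simp [φ]
  have hφR : φ R = 0 := by simp [φ, hR.ne']
  rw [hφ0, hφR, zero_smul, one_smul, zero_sub] at h
  set k : ℝ → ℝ := fun x => c * ‖G x‖ + ‖g x‖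
  have hk0 : ∀ x, 0 ≤ k x := fun x =>
    add_nonneg (mul_nonneg hc.le (norm_nonneg _)) (norm_nonneg _)
  have hki : IntervalIntegrable k volume 0 R :=
    ((continuous_const.mul hGc.norm).intervalIntegrable _ _).add
      (hg.intervalIntegrable_real 0 R).norm
  have hb : ‖G 0‖ ≤ ∫ x in (0 : ℝ)..R, Real.exp (-l * x) * k x := by
    rw [← norm_neg, ← h]
    refine intervalIntegral.norm_integral_le_of_norm_le hR.le ?_
      (hki.continuousOn_mul (by fun_prop))
    refine Eventually.of_forall fun x hx => ?_
    rw [(hφd x).deriv]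
    have hx0 : 0 ≤ x / R := div_nonneg hx.1.le hR.le
    have hx1 : x / R ≤ 1 := by rw [div_le_one hR]; exact hx.2
    have he := Real.exp_pos (-l * x)
    have hR' : 0 < 1 / R := by positivity
    refine (norm_add_le (_ : ℂ) _).trans ?_
    rw [norm_smul, norm_smul, mul_add, ← mul_assoc _ c]
    refine add_le_add ?_ ?_
    · refine mul_le_mul_of_nonneg_right ?_ (norm_nonneg _)
      rw [Real.norm_eq_abs, abs_le]
      set e := Real.exp (-l * x)
      have : (1 - x / R) * (e * l) ≤ 1 * (e * l) :=
        mul_le_mul_of_nonneg_right (by linarith) (by positivity)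
      have h3 : 0 ≤ (1 - x / R) * (e * l) := mul_nonneg (by linarith) (by positivity)
      have h4 : 0 < 1 / R * e := by positivity
      constructor <;> simp only [c] <;> nlinarith
    · refine mul_le_mul_of_nonneg_right ?_ (norm_nonneg _)
      simp only [φ]
      rw [Real.norm_eq_abs, abs_of_nonneg (mul_nonneg (by linarith) he.le)]
      exact mul_le_of_le_one_left he.le (by linarith)
  have hGm : AEStronglyMeasurable G volume := hGc.aestronglyMeasurable
  have hgm : AEStronglyMeasurable g volume := hg.aestronglyMeasurable
  have hGL : MemLp G 2 volume := (memLp_two_iff_integrable_sq_norm hGm).mpr hG2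
  have hgL : MemLp g 2 volume := (memLp_two_iff_integrable_sq_norm hgm).mpr hg2
  have hkL : MemLp k 2 volume := (hGL.norm.const_mul c).add hgL.norm
  have hkL' : MemLp k 2 (volume.restrict (Ioc 0 R)) := hkL.restrict _
  have heL : MemLp (fun x => Real.exp (-l * x)) 2 (volume.restrict (Ioc 0 R)) := by
    have hcont : Continuous fun x => Real.exp (-l * x) := by fun_prop
    refine (memLp_two_iff_integrable_sq hcont.aestronglyMeasurable).mpr ?_
    exact ((hcont.pow 2).integrableOn_Icc (a := 0) (b := R)).mono_set Ioc_subset_Icc_self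
  -- Cauchy–Schwarz against the weight: ∫ exp(-2lx) ≤ 1/(2l), while k² ≤ 2(c²|G|² + |g|²), so the
  -- factors 2 cancel.
  have hCS := integral_mul_le_Lp_mul_Lq_of_nonneg (μ := volume.restrict (Ioc 0 R))
    (Real.HolderConjugate.two_two) (f := fun x => Real.exp (-l * x)) (g := k)
    (Eventually.of_forall fun x => (Real.exp_pos _).le) (Eventually.of_forall hk0)
    (by simpa using heL) (by simpa using hkL')
  rw [← intervalIntegral.integral_of_le hR.le] at hCS
  have hsq : ‖G 0‖ ^ 2 ≤ (∫ x in Ioc 0 R, Real.exp (-l * x) ^ 2) * ∫ x in Ioc 0 R, k x ^ 2 := by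
    have hA : 0 ≤ ∫ x in Ioc 0 R, Real.exp (-l * x) ^ 2 := by positivity
    have hB : 0 ≤ ∫ x in Ioc 0 R, k x ^ 2 := by positivity
    have h1 := hb.trans hCS
    simp only [Real.rpow_ofNat] at h1
    rw [← Real.sqrt_eq_rpow, ← Real.sqrt_eq_rpow] at h1
    have h2 := pow_le_pow_left₀ (norm_nonneg _) h1 2
    rwa [mul_pow, Real.sq_sqrt hA, Real.sq_sqrt hB] at h2
  have hexp : ∫ x in Ioc 0 R, Real.exp (-l * x) ^ 2 ≤ 1 / (2 * l) := by
    have e1 : ∀ x : ℝ, Real.exp (-l * x) ^ 2 = Real.exp ((-2 * l) * x) := by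
      intro x; rw [← Real.exp_nat_mul]; congr 1; push_cast; ring
    simp only [e1]
    rw [← intervalIntegral.integral_of_le hR.le, integral_zero_exp_mul (by linarith),
      ← neg_div_neg_eq]
    have := Real.exp_pos (-2 * l * R)
    gcongr <;> linarith
  have hk2 : ∫ x in Ioc 0 R, k x ^ 2 ≤
      2 * (c ^ 2 * (∫ x in Ioi 0, ‖G x‖ ^ 2) + ∫ x in Ioi 0, ‖g x‖ ^ 2) := by
    have i1 : IntegrableOn (fun x => 2 * (c ^ 2 * ‖G x‖ ^ 2 + ‖g x‖ ^ 2)) (Ioi 0) volume :=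
      (((hG2.const_mul _).add hg2).const_mul 2).integrableOn
    calc ∫ x in Ioc 0 R, k x ^ 2 ≤ ∫ x in Ioi 0, k x ^ 2 :=
          setIntegral_mono_set hkL.integrable_sq.integrableOn
            (Eventually.of_forall fun x => sq_nonneg _) (Ioc_subset_Ioi_self.eventuallyLE)
      _ ≤ ∫ x in Ioi 0, 2 * (c ^ 2 * ‖G x‖ ^ 2 + ‖g x‖ ^ 2) := by
          refine setIntegral_mono hkL.integrable_sq.integrableOn i1 fun x => ?_
          simp only [k]
          nlinarith [sq_nonneg (c * ‖G x‖ - ‖g x‖)]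
      _ = _ := by
          rw [integral_const_mul, integral_add (hG2.const_mul _).integrableOn hg2.integrableOn,
            integral_const_mul]
  have hB : 0 ≤ ∫ x in Ioc 0 R, k x ^ 2 := by positivity
  have h5 := hsq.trans (mul_le_mul hexp hk2 hB (by positivity))
  calc l * ‖G 0‖ ^ 2 ≤ l * _ := mul_le_mul_of_nonneg_left h5 hl.le
    _ = _ := by field_simp

/-- The half-line Sobolev inequality. -/
lemma norm_sq_le_halfLine {g G : ℝ → ℂ} (hg : LocallyIntegrable g volume)
    (hG : ∀ x, G x = G 0 + ∫ t in (0 : ℝ)..x, g t) (hg2 : Integrable (fun x => ‖g x‖ ^ 2) volume)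
    (hG2 : Integrable (fun x => ‖G x‖ ^ 2) volume) {l : ℝ} (hl : 0 < l) :
    l * ‖G 0‖ ^ 2 ≤ l ^ 2 * (∫ x in Ioi 0, ‖G x‖ ^ 2) + ∫ x in Ioi 0, ‖g x‖ ^ 2 := by
  have ht : Tendsto (fun R : ℝ => (l + 1 / R) ^ 2 * (∫ x in Ioi 0, ‖G x‖ ^ 2)
      + ∫ x in Ioi 0, ‖g x‖ ^ 2) atTop
      (𝓝 (l ^ 2 * (∫ x in Ioi 0, ‖G x‖ ^ 2) + ∫ x in Ioi 0, ‖g x‖ ^ 2)) := by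
    have h1 : Tendsto (fun R : ℝ => l + 1 / R) atTop (𝓝 (l + 0)) :=
      tendsto_const_nhds.add (tendsto_const_nhds.div_atTop tendsto_id)
    rw [add_zero] at h1
    exact ((h1.pow 2).mul_const _).add_const _
  refine ge_of_tendsto ht ?_
  filter_upwards [eventually_gt_atTop 0] with R hR
  exact norm_sq_le_halfLine_cutoff hg hG hg2 hG2 hl hR

/-- The Sobolev inequality on the line, with the best constant. -/
lemma H1.norm_eval_zero_sq_le (ψ : H1) {l : ℝ} (hl : 0 < l) :
    2 * l * ‖eval ψ 0‖ ^ 2 ≤ l ^ 2 * ‖ψ‖ ^ 2 + ‖deriv ψ‖ ^ 2 := by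
  have hloc := L2.locallyIntegrable (deriv ψ)
  have hg2 := L2.integrable_norm_sq (deriv ψ)
  have hae : (fun x => ‖(ψ : L2) x‖ ^ 2) =ᵐ[volume] fun x => ‖eval ψ x‖ ^ 2 := by
    filter_upwards [coe_ae_eq ψ] with x hx
    rw [hx]
  have hG2 : Integrable (fun x => ‖eval ψ x‖ ^ 2) volume :=
    (L2.integrable_norm_sq (ψ : L2)).congr hae
  have h1 := norm_sq_le_halfLine hloc (eval_eq_primitive ψ) hg2 hG2 hl
  -- Reflection gives the bound on the left half-line. Adding the two halves counts the value at 0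
  -- twice, whence the factor 2.
  have hloc' : LocallyIntegrable (fun x => -(deriv ψ) (-x)) volume :=
    ((Lp.memLp (deriv ψ)).comp_measurePreserving
      (Measure.measurePreserving_neg volume)).neg.locallyIntegrable (by norm_num)
  have h2 := norm_sq_le_halfLine (G := fun x => eval ψ (-x)) hloc' (fun x => by
    rw [intervalIntegral.integral_neg, intervalIntegral.integral_comp_neg (fun x => deriv ψ x),
      eval_eq_primitive ψ (-x), neg_zero, intervalIntegral.integral_symm 0 (-x), neg_neg]
    ) (by simpa using hg2.comp_neg) hG2.comp_neg hl
  simp only [neg_zero, norm_neg] at h2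
  rw [integral_comp_neg_Ioi (0 : ℝ) (fun x => ‖eval ψ x‖ ^ 2),
    integral_comp_neg_Ioi (0 : ℝ) (fun x => ‖deriv ψ x‖ ^ 2), neg_zero] at h2
  have e1 := intervalIntegral.integral_Iic_add_Ioi (b := 0) hG2.integrableOn hG2.integrableOn
  have e2 := intervalIntegral.integral_Iic_add_Ioi (b := 0) hg2.integrableOn hg2.integrableOn
  rw [Submodule.coe_norm, L2.norm_sq_eq_integral, L2.norm_sq_eq_integral, integral_congr_ae hae,
    ← e1, ← e2]
  linarith

/-- The interpolation inequality `|ψ(0)|² ≤ ‖ψ‖ ‖ψ'‖`. -/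
lemma H1.norm_eval_zero_sq_le_mul (ψ : H1) : ‖eval ψ 0‖ ^ 2 ≤ ‖ψ‖ * ‖deriv ψ‖ := by
  set a := ‖ψ‖
  set b := ‖deriv ψ‖
  have ha : 0 ≤ a := norm_nonneg _
  have hb : 0 ≤ b := norm_nonneg _
  have key : ∀ ε > 0, ‖eval ψ 0‖ ^ 2 ≤ (a + ε) * (b + ε) := by
    intro ε hε
    have hA : 0 < a + ε := by linarith
    have hB : 0 < b + ε := by linarith
    -- The optimal l is ‖ψ'‖ / ‖ψ‖; the shift by ε keeps numerator and denominator positive.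
    have h := norm_eval_zero_sq_le ψ (l := (b + ε) / (a + ε)) (by positivity)
    change _ ≤ _ * a ^ 2 + b ^ 2 at h
    have h3 : ((b + ε) / (a + ε)) ^ 2 * a ^ 2 ≤ (b + ε) ^ 2 := by
      rw [div_pow, div_mul_eq_mul_div, div_le_iff₀ (by positivity)]
      gcongr; linarith
    have h4 : b ^ 2 ≤ (b + ε) ^ 2 := by gcongr; linarith
    have h5 : 2 * ((b + ε) / (a + ε)) * ‖eval ψ 0‖ ^ 2 ≤ 2 * (b + ε) ^ 2 := by linarith
    rw [mul_assoc, div_mul_eq_mul_div] at h5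
    have h6 : (b + ε) * ‖eval ψ 0‖ ^ 2 / (a + ε) ≤ (b + ε) ^ 2 := by linarith
    rw [div_le_iff₀ hA] at h6
    nlinarith
  have ht : Tendsto (fun ε : ℝ => (a + ε) * (b + ε)) (𝓝[>] 0) (𝓝 ((a + 0) * (b + 0))) :=
    (Continuous.tendsto (by fun_prop) 0).mono_left nhdsWithin_le_nhds
  rw [add_zero, add_zero] at ht
  refine ge_of_tendsto ht ?_
  filter_upwards [self_mem_nhdsWithin] with ε hε
  exact key ε hε

/-! ### Rigid motions of the line acting on `L²(ℝ)` -/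

lemma measurePreserving_motion (ε : ℤˣ) (c : ℝ) :
    MeasurePreserving (fun x : ℝ => ((ε : ℤ) : ℝ) * x + c) volume volume := by
  rcases Int.units_eq_one_or ε with rfl | rfl
  · simpa using measurePreserving_add_right (volume : Measure ℝ) c
  · simpa [← sub_eq_neg_add] using Measure.measurePreserving_sub_left (volume : Measure ℝ) c

/-- The composition of `g ∈ L²(ℝ)` with the motion `x ↦ ε x + c`, `ε = ±1`. -/
def move (ε : ℤˣ) (c : ℝ) : L2 →ₗᵢ[ℂ] L2 :=
  Lp.compMeasurePreservingₗᵢ ℂ _ (measurePreserving_motion ε c)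

lemma coeFn_move (ε : ℤˣ) (c : ℝ) (g : L2) :
    (move ε c g : ℝ → ℂ) =ᵐ[volume] fun x => g (((ε : ℤ) : ℝ) * x + c) :=
  Lp.coeFn_compMeasurePreserving g (measurePreserving_motion ε c)

lemma move_eq_of_ae {ε : ℤˣ} {c : ℝ} {g h : L2} {k : ℝ → ℂ} (hg : (g : ℝ → ℂ) =ᵐ[volume] k)
    (hh : (h : ℝ → ℂ) =ᵐ[volume] fun x => k (((ε : ℤ) : ℝ) * x + c)) : move ε c g = h := by
  refine Lp.ext ?_
  filter_upwards [coeFn_move ε c g, hh,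
    (measurePreserving_motion ε c).quasiMeasurePreserving.ae_eq_comp hg] with x h1 h2 h3
  rw [h1, h2]
  exact h3

lemma move_move (ε δ : ℤˣ) (c d : ℝ) (g : L2) :
    move ε c (move δ d g) = move (δ * ε) (((δ : ℤ) : ℝ) * c + d) g := by
  refine move_eq_of_ae (coeFn_move δ d g) ?_
  filter_upwards [coeFn_move (δ * ε) (((δ : ℤ) : ℝ) * c + d) g] with x hx
  rw [hx]
  congr 1
  push_cast
  ring

lemma move_one_zero (g : L2) : move 1 0 g = g :=
  move_eq_of_ae (EventuallyEq.refl _ _) (by simp)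

lemma units_mul_self (ε : ℤˣ) : ((ε : ℤ) : ℝ) * ((ε : ℤ) : ℝ) = 1 := by
  rcases Int.units_eq_one_or ε with rfl | rfl <;> simp

lemma abs_units (ε : ℤˣ) : |((ε : ℤ) : ℝ)| = 1 := by
  rcases Int.units_eq_one_or ε with rfl | rfl <;> simp

lemma norm_units (ε : ℤˣ) : ‖((ε : ℤ) : ℂ)‖ = 1 := by
  rcases Int.units_eq_one_or ε with rfl | rfl <;> simp

lemma move_inv_move (ε : ℤˣ) (c : ℝ) (g : L2) :
    move ε (-((ε : ℤ) : ℝ) * c) (move ε c g) = g := by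
  rw [move_move, Int.units_mul_self, ← mul_assoc, mul_neg, units_mul_self, neg_one_mul,
    neg_add_cancel, move_one_zero]

/-- The adjoint of an isometric motion is its inverse, and the inverse of x ↦ εx + c is x ↦ εx - εc
because ε² = 1. -/
lemma inner_move_right (ε : ℤˣ) (c : ℝ) (f g : L2) :
    ⟪f, move ε c g⟫_ℂ = ⟪move ε (-((ε : ℤ) : ℝ) * c) f, g⟫_ℂ := by
  rw [← (move ε (-((ε : ℤ) : ℝ) * c)).inner_map_map f, move_inv_move]

/-- Strong continuity of translations on L²(ℝ), jointly in the shift and the function; continuity in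
the operator norm would fail. -/
lemma continuous_move (ε : ℤˣ) {Z : Type*} [TopologicalSpace Z] {c : Z → ℝ} {g : Z → L2}
    (hc : Continuous c) (hg : Continuous g) : Continuous fun z => move ε (c z) (g z) := by
  have hcont : Continuous fun z => (⟨fun x : ℝ => ((ε : ℤ) : ℝ) * x + c z, by fun_prop⟩ : C(ℝ, ℝ)) :=
    ContinuousMap.continuous_of_continuous_uncurry _ (by
      simp only [Function.uncurry_def, ContinuousMap.coe_mk]; fun_prop)
  exact Continuous.compMeasurePreservingLp hg hcont
    (fun z => measurePreserving_motion ε (c z)) (by norm_num)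

/-- The source of finite propagation speed: what a moved function does on J depends only on the
original function on the image of J. -/
lemma setNorm_move_le {ε : ℤˣ} {c : ℝ} {J K : Set ℝ} (hK : MeasurableSet K)
    (h : ∀ x ∈ J, ((ε : ℤ) : ℝ) * x + c ∈ K) (g : L2) : setNorm J (move ε c g) ≤ setNorm K g := by
  set e : ℝ → ℝ := fun x => ((ε : ℤ) : ℝ) * x + c
  have hmp := (measurePreserving_motion ε c).restrict_preimage hK
  refine (setNorm_mono (K := e ⁻¹' K) h _).trans ?_
  refine ENNReal.toReal_mono ((Lp.memLp g).restrict K).2.ne ?_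
  rw [eLpNorm_congr_ae (ae_restrict_of_ae (coeFn_move ε c g))]
  exact (eLpNorm_comp_measurePreserving ((Lp.memLp g).1.restrict) hmp).le

/-! ### Test functions -/

/-- The element of `L²(ℝ)` given by a real function (zero if the function is not in `L²`). -/
def toL2 (φ : ℝ → ℝ) : L2 :=
  open Classical in
  if h : MemLp (fun x => (φ x : ℂ)) 2 (volume : Measure ℝ) then h.toLp else 0

/-- Smooth compactly supported functions on the line. -/
structure IsTest (φ : ℝ → ℝ) : Prop where
  smooth : ContDiff ℝ ∞ φ
  supp : HasCompactSupport φ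

lemma coeFn_toL2_of_continuous {φ : ℝ → ℝ} (hφ : Continuous φ) (hc : HasCompactSupport φ) :
    (toL2 φ : ℝ → ℂ) =ᵐ[volume] fun x => (φ x : ℂ) := by
  have h : MemLp (fun x => (φ x : ℂ)) 2 (volume : Measure ℝ) :=
    Continuous.memLp_of_hasCompactSupport (by fun_prop) (hc.comp_left Complex.ofReal_zero)
  rw [toL2, dif_pos h]
  exact h.coeFn_toLp

lemma IsTest.coeFn_toL2 {φ : ℝ → ℝ} (hφ : IsTest φ) :
    (toL2 φ : ℝ → ℂ) =ᵐ[volume] fun x => (φ x : ℂ) :=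
  coeFn_toL2_of_continuous hφ.smooth.continuous hφ.supp

lemma IsTest.deriv {φ : ℝ → ℝ} (hφ : IsTest φ) : IsTest (deriv φ) :=
  ⟨(contDiff_infty_iff_deriv.mp hφ.smooth).2, hφ.supp.deriv⟩

lemma IsTest.comp_motion {φ : ℝ → ℝ} (hφ : IsTest φ) (ε : ℤˣ) (c : ℝ) :
    IsTest (fun x => φ (((ε : ℤ) : ℝ) * x + c)) := by
  refine ⟨hφ.smooth.comp (by fun_prop), ?_⟩
  have hcl : Topology.IsClosedEmbedding (fun x : ℝ => ((ε : ℤ) : ℝ) * x + c) := by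
    refine Isometry.isClosedEmbedding (Isometry.of_dist_eq fun x y => ?_)
    rw [Real.dist_eq, Real.dist_eq,
      show ((ε : ℤ) : ℝ) * x + c - (((ε : ℤ) : ℝ) * y + c) = ((ε : ℤ) : ℝ) * (x - y) by ring,
      abs_mul, abs_units, one_mul]
  exact hφ.supp.comp_isClosedEmbedding hcl

lemma IsTest.const_mul {φ : ℝ → ℝ} (hφ : IsTest φ) (c : ℝ) : IsTest (fun x => c * φ x) :=
  ⟨contDiff_const.mul hφ.smooth, hφ.supp.mul_left (f := fun _ => c)⟩

lemma IsTest.inner_toL2 {φ : ℝ → ℝ} (hφ : IsTest φ) (g : L2) :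
    ⟪toL2 φ, g⟫_ℂ = ∫ x, φ x • g x := by
  rw [L2.inner_def]
  refine integral_congr_ae ?_
  filter_upwards [hφ.coeFn_toL2] with x hx
  rw [hx]
  simp [RCLike.inner_apply, mul_comm]

lemma toL2_eq_of_ae {φ : ℝ → ℝ} (hφ : IsTest φ) {g : L2}
    (h : (g : ℝ → ℂ) =ᵐ[volume] fun x => (φ x : ℂ)) : toL2 φ = g :=
  Lp.ext (hφ.coeFn_toL2.trans h.symm)

lemma IsTest.move_toL2 {φ : ℝ → ℝ} (hφ : IsTest φ) (ε : ℤˣ) (c : ℝ) :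
    move ε c (toL2 φ) = toL2 (fun x => φ (((ε : ℤ) : ℝ) * x + c)) :=
  move_eq_of_ae hφ.coeFn_toL2 (hφ.comp_motion ε c).coeFn_toL2

lemma IsTest.smul_toL2 {φ : ℝ → ℝ} (hφ : IsTest φ) (c : ℝ) :
    (c : ℂ) • toL2 φ = toL2 (fun x => c * φ x) := by
  refine (toL2_eq_of_ae (hφ.const_mul c) ?_).symm
  filter_upwards [hφ.coeFn_toL2, Lp.coeFn_smul (c : ℂ) (toL2 φ)] with x h1 h2
  rw [h2, Pi.smul_apply, h1]
  simp

/-- Elements of `L²(ℝ)` are determined by their pairings with test functions. -/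
lemma L2.ext_of_test {f g : L2} (h : ∀ φ, IsTest φ → ⟪toL2 φ, f⟫_ℂ = ⟪toL2 φ, g⟫_ℂ) : f = g := by
  rw [← sub_eq_zero]
  have key : ∀ᵐ x ∂(volume : Measure ℝ), (f - g : L2) x = 0 := by
    refine ae_eq_zero_of_integral_contDiff_smul_eq_zero (L2.locallyIntegrable _) ?_
    intro φ hφ hc
    rw [← (IsTest.mk hφ hc).inner_toL2, inner_sub_right, h φ ⟨hφ, hc⟩, sub_self]
  refine Lp.ext ?_
  filter_upwards [key, Lp.coeFn_zero ℂ 2 (volume : Measure ℝ)] with x hx h0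
  rw [hx, h0, Pi.zero_apply]

lemma IsWeakDeriv.congr_ae {f f' g g' : ℝ → ℂ} (h : IsWeakDeriv f g) (hf : f =ᵐ[volume] f')
    (hg : g =ᵐ[volume] g') : IsWeakDeriv f' g' := by
  intro φ hφ hc
  have h1 := h φ hφ hc
  have e1 : ∫ x, _root_.deriv φ x • f x = ∫ x, _root_.deriv φ x • f' x :=
    integral_congr_ae (by filter_upwards [hf] with x hx; rw [hx])
  have e2 : ∫ x, φ x • g x = ∫ x, φ x • g' x :=
    integral_congr_ae (by filter_upwards [hg] with x hx; rw [hx])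
  rwa [e1, e2] at h1

lemma IsTest.isWeakDeriv {φ : ℝ → ℝ} (hφ : IsTest φ) : IsWeakDeriv (toL2 φ) (toL2 (_root_.deriv φ)) := by
  have hc : Continuous fun x => ((_root_.deriv φ x : ℝ) : ℂ) :=
    Complex.continuous_ofReal.comp hφ.deriv.smooth.continuous
  have h : IsWeakDeriv (fun x => (φ x : ℂ)) (fun x => ((_root_.deriv φ x : ℝ) : ℂ)) := by
    refine isWeakDeriv_primitive hc.locallyIntegrable fun x => ?_
    rw [intervalIntegral.integral_ofReal, intervalIntegral.integral_deriv_eq_sub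
      (fun x _ => (hφ.smooth.differentiable (by simp)) x)
      (hφ.deriv.smooth.continuous.intervalIntegrable _ _)]
    push_cast; ring
  exact h.congr_ae hφ.coeFn_toL2.symm hφ.deriv.coeFn_toL2.symm

/-- The element of `H¹(ℝ)` given by a test function. -/
def IsTest.toH1 {φ : ℝ → ℝ} (hφ : IsTest φ) : H1 := H1.ofWeakDeriv _ _ hφ.isWeakDeriv

lemma IsTest.coe_toH1 {φ : ℝ → ℝ} (hφ : IsTest φ) : (hφ.toH1 : L2) = toL2 φ := rfl

lemma IsTest.deriv_toH1 {φ : ℝ → ℝ} (hφ : IsTest φ) :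
    H1.deriv hφ.toH1 = toL2 (_root_.deriv φ) := H1.deriv_ofWeakDeriv _ _ _

lemma IsTest.eval_toH1 {φ : ℝ → ℝ} (hφ : IsTest φ) (x : ℝ) : H1.eval hφ.toH1 x = φ x :=
  H1.eval_eq _ (g := fun x => (φ x : ℂ)) (Complex.continuous_ofReal.comp hφ.smooth.continuous)
    hφ.coeFn_toL2 x

lemma isWeakDeriv_iff_inner {f g : L2} : IsWeakDeriv f g ↔
    ∀ φ, IsTest φ → ⟪toL2 (_root_.deriv φ), f⟫_ℂ = -⟪toL2 φ, g⟫_ℂ := by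
  constructor
  · intro h φ hφ
    rw [hφ.inner_toL2, hφ.deriv.inner_toL2]
    exact h φ hφ.smooth hφ.supp
  · intro h φ hφ hc
    have hφ' : IsTest φ := ⟨hφ, hc⟩
    have := h φ hφ'
    rwa [hφ'.inner_toL2, hφ'.deriv.inner_toL2] at this

/-- A norm bound in `L²(ℝ)` for functions bounded by `C` and supported in `[-R, R]`. -/
lemma L2.norm_le_of_bound {g : L2} {k : ℝ → ℂ} (hg : (g : ℝ → ℂ) =ᵐ[volume] k) {C R : ℝ}
    (hC : 0 ≤ C) (hk : ∀ x, ‖k x‖ ≤ C) (hR : ∀ x, R < |x| → k x = 0) :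
    ‖g‖ ≤ C * √(2 * |R|) := by
  have h1 : ‖g‖ ^ 2 ≤ C ^ 2 * (2 * |R|) := by
    rw [L2.norm_sq_eq_integral]
    have h0 : ∀ᵐ x, ‖g x‖ ^ 2 ≤ (Icc (-|R|) |R|).indicator (fun _ => C ^ 2) x := by
      filter_upwards [hg] with x hx
      rw [hx]
      by_cases hxR : x ∈ Icc (-|R|) |R|
      · rw [indicator_of_mem hxR]
        exact pow_le_pow_left₀ (norm_nonneg _) (hk x) 2
      · rw [indicator_of_notMem hxR, hR x]
        · simp
        · rw [mem_Icc, ← abs_le, not_le] at hxR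
          exact (le_abs_self R).trans_lt hxR
    refine (integral_mono_ae (L2.integrable_norm_sq g)
      ((integrable_indicator_iff measurableSet_Icc).mpr (by simp)) h0).trans ?_
    rw [integral_indicator measurableSet_Icc]
    simp only [integral_const, smul_eq_mul]
    rw [mul_comm]
    gcongr
    simp [measureReal_def]
    linarith
  have h2 := Real.sqrt_le_sqrt h1
  rwa [Real.sqrt_sq (norm_nonneg _), Real.sqrt_mul (by positivity), Real.sqrt_sq hC] at h2

/-- A smooth family of functions with locally uniformly bounded supports is differentiable as a
curve in `L²(ℝ)`. -/
lemma hasDerivAt_toL2 {Φ : ℝ × ℝ → ℝ} (hΦ : ContDiff ℝ ∞ Φ) {t₀ R : ℝ}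
    (hR : ∀ t, |t - t₀| < 1 → ∀ x, R < |x| → Φ (x, t) = 0) :
    HasDerivAt (fun t => toL2 fun x => Φ (x, t))
      (toL2 fun x => _root_.deriv (fun s => Φ (x, s)) t₀) t₀ := by
  set Φ' : ℝ × ℝ → ℝ := fun z => _root_.deriv (fun s => Φ (z.1, s)) z.2
  have hd : ∀ x t, HasDerivAt (fun s => Φ (x, s)) (Φ' (x, t)) t := fun x t =>
    ((hΦ.comp (by fun_prop : ContDiff ℝ ∞ fun s : ℝ => (x, s))).differentiable
      (by simp) t).hasDerivAt
  have hΦ'eq : ∀ z, Φ' z = fderiv ℝ Φ z (0, 1) := by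
    intro z
    have h1 : HasDerivAt (fun s : ℝ => (z.1, s)) ((0 : ℝ), (1 : ℝ)) z.2 :=
      (hasDerivAt_const _ _).prodMk (hasDerivAt_id _)
    exact (((hΦ.differentiable (by simp)) z).hasFDerivAt.comp_hasDerivAt z.2 h1).deriv
  have hΦ'c : ContDiff ℝ ∞ Φ' := by
    rw [show Φ' = fun z => fderiv ℝ Φ z (0, 1) from funext hΦ'eq]
    exact (hΦ.fderiv_right (by simp)).clm_apply contDiff_const
  have hR' : ∀ t, |t - t₀| < 1 → ∀ x, R < |x| → Φ' (x, t) = 0 := by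
    intro t ht x hx
    refine ((hasDerivAt_const t (0 : ℝ)).congr_of_eventuallyEq ?_).deriv
    have : ∀ᶠ s in 𝓝 t, |s - t₀| < 1 :=
      (by fun_prop : Continuous fun s : ℝ => |s - t₀|).continuousAt.eventually_lt_const ht
    filter_upwards [this] with s hs
    exact hR s hs x hx
  have hT : ∀ (Ψ : ℝ × ℝ → ℝ), ContDiff ℝ ∞ Ψ →
      (∀ t, |t - t₀| < 1 → ∀ x, R < |x| → Ψ (x, t) = 0) → ∀ t, |t - t₀| < 1 →
      IsTest (fun x => Ψ (x, t)) := by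
    intro Ψ hΨ hΨR t ht
    refine ⟨hΨ.comp (by fun_prop), HasCompactSupport.intro (isCompact_Icc (a := -R) (b := R)) ?_⟩
    intro x hx
    rw [mem_Icc, ← abs_le, not_le] at hx
    exact hΨR t ht x hx
  have h00 : |t₀ - t₀| < 1 := by simp
  rw [hasDerivAt_iff_isLittleO, Asymptotics.isLittleO_iff]
  intro c hc
  -- A pointwise bound η|t - t₀| on a set of length at most 2|R| costs a factor √(2|R|) in L², and
  -- this η absorbs it.
  set η := c / (√(2 * |R|) + 1)
  have hη : 0 < η := by positivity
  have huc : UniformContinuousOn Φ' (Icc (-|R|) |R| ×ˢ Icc (t₀ - 1) (t₀ + 1)) :=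
    (isCompact_Icc.prod isCompact_Icc).uniformContinuousOn_of_continuous hΦ'c.continuous.continuousOn
  rw [Metric.uniformContinuousOn_iff] at huc
  obtain ⟨δ, hδ, hδ'⟩ := huc η hη
  have hev : ∀ᶠ t in 𝓝 t₀, |t - t₀| < min δ 1 := by
    have : |t₀ - t₀| < min δ 1 := by simp [hδ]
    exact (by fun_prop : Continuous fun s : ℝ => |s - t₀|).continuousAt.eventually_lt_const this
  filter_upwards [hev] with t ht
  have ht1 : |t - t₀| < 1 := ht.trans_le (min_le_right _ _)
  have htδ : |t - t₀| < δ := ht.trans_le (min_le_left _ _)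
  have a1 := (hT Φ hΦ hR t ht1).coeFn_toL2
  have a2 := (hT Φ hΦ hR t₀ h00).coeFn_toL2
  have a3 := (hT Φ' hΦ'c hR' t₀ h00).coeFn_toL2
  have hae : ((toL2 (fun x => Φ (x, t)) - toL2 (fun x => Φ (x, t₀))
      - (t - t₀) • toL2 (fun x => Φ' (x, t₀)) : L2) : ℝ → ℂ) =ᵐ[volume]
      fun x => ((Φ (x, t) - Φ (x, t₀) - (t - t₀) * Φ' (x, t₀) : ℝ) : ℂ) := by
    filter_upwards [a1, a2, a3, Lp.coeFn_sub (toL2 (fun x => Φ (x, t)) - toL2 (fun x => Φ (x, t₀)))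
      ((t - t₀) • toL2 (fun x => Φ' (x, t₀))), Lp.coeFn_sub (toL2 (fun x => Φ (x, t)))
      (toL2 (fun x => Φ (x, t₀))), Lp.coeFn_smul (t - t₀) (toL2 (fun x => Φ' (x, t₀)))]
      with x h1 h2 h3 h4 h5 h6
    rw [h4, Pi.sub_apply, h5, Pi.sub_apply, h6, Pi.smul_apply, h1, h2, h3]
    simp
  have hz : ∀ x, R < |x| → Φ (x, t) - Φ (x, t₀) - (t - t₀) * Φ' (x, t₀) = 0 := by
    intro x hx
    rw [hR t ht1 x hx, hR t₀ h00 x hx, hR' t₀ h00 x hx]; simp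
  have hbound : ∀ x, |Φ (x, t) - Φ (x, t₀) - (t - t₀) * Φ' (x, t₀)| ≤ η * |t - t₀| := by
    intro x
    by_cases hx : R < |x|
    · rw [hz x hx, abs_zero]; positivity
    have hxm : x ∈ Icc (-|R|) |R| := by
      rw [mem_Icc, ← abs_le]; exact (not_lt.mp hx).trans (le_abs_self R)
    have hs : ∀ s ∈ uIcc t₀ t, |s - t₀| ≤ |t - t₀| := fun s hs => abs_sub_left_of_mem_uIcc hs
    -- Subtracting the linear term s Φ'(x,t₀) leaves a derivative that is at most η by uniform
    -- continuity, so the mean value inequality gives a bound independent of x.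
    have hder : ∀ s ∈ uIcc t₀ t, HasDerivWithinAt (fun s => Φ (x, s) - s * Φ' (x, t₀))
        (Φ' (x, s) - Φ' (x, t₀)) (uIcc t₀ t) s := fun s _ => by
      have := (hd x s).fun_sub ((hasDerivAt_id s).mul_const (Φ' (x, t₀)))
      simpa using this.hasDerivWithinAt
    have hle : ∀ s ∈ uIcc t₀ t, ‖Φ' (x, s) - Φ' (x, t₀)‖ ≤ η := by
      intro s hs'
      have h1 := hs s hs'
      have hm : ∀ r, |r - t₀| < 1 → (x, r) ∈ Icc (-|R|) |R| ×ˢ Icc (t₀ - 1) (t₀ + 1) := by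
        intro r hr
        rw [abs_lt] at hr
        exact ⟨hxm, by constructor <;> linarith [hr.1, hr.2]⟩
      rw [← dist_eq_norm]
      refine (hδ' _ (hm s (h1.trans_lt ht1)) _ (hm t₀ h00) ?_).le
      rw [Prod.dist_eq, dist_self, Real.dist_eq]
      exact max_lt hδ (h1.trans_lt htδ)
    have := (convex_uIcc t₀ t).norm_image_sub_le_of_norm_hasDerivWithin_le hder hle
      left_mem_uIcc right_mem_uIcc
    rw [Real.norm_eq_abs, Real.norm_eq_abs] at this
    refine le_trans (le_of_eq ?_) this
    congr 1
    ring
  have := L2.norm_le_of_bound hae (by positivity : 0 ≤ η * |t - t₀|)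
    (fun x => by rw [Complex.norm_real]; exact hbound x) (R := R)
    (fun x hx => by rw [hz x hx, Complex.ofReal_zero])
  refine this.trans ?_
  rw [Real.norm_eq_abs, mul_right_comm]
  gcongr
  simp only [η]
  rw [div_mul_eq_mul_div, div_le_iff₀ (by positivity)]
  gcongr
  linarith

/-- The product rule for `⟪φ s, q s⟫` at `t`, where `φ` is differentiable and `q` is continuous and
differentiable in the direction `φ t` only. -/
lemma HasDerivAt.inner_of_weak {E : Type*} [NormedAddCommGroup E] [InnerProductSpace ℂ E]
    {φ q : ℝ → E} {φ' : E} {l : ℂ} {t : ℝ} (h1 : HasDerivAt φ φ' t) (hq : ContinuousAt q t)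
    (h2 : HasDerivAt (fun s => ⟪φ t, q s⟫_ℂ) l t) :
    HasDerivAt (fun s => ⟪φ s, q s⟫_ℂ) (⟪φ', q t⟫_ℂ + l) t := by
  -- In this part the left factor vanishes at s = t, so the difference quotient falls on φ alone and
  -- continuity of q suffices.
  have h3 : HasDerivAt (fun s => ⟪φ s - φ t, q s⟫_ℂ) ⟪φ', q t⟫_ℂ t := by
    rw [hasDerivAt_iff_tendsto_slope] at h1 ⊢
    have := h1.inner (𝕜 := ℂ) (hq.tendsto.mono_left nhdsWithin_le_nhds : Tendsto q (𝓝[≠] t) _)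
    refine this.congr fun s => ?_
    simp only [slope, vsub_eq_sub, sub_self, inner_zero_left, sub_zero]
    rw [← algebraMap_smul ℂ (s - t)⁻¹ (φ s - φ t), inner_smul_left, Complex.real_smul,
      Complex.coe_algebraMap, Complex.conj_ofReal]
  refine (h3.fun_add h2).congr_of_eventuallyEq (Eventually.of_forall fun s => ?_)
  simp only [← inner_add_left, sub_add_cancel]

lemma inner_intervalIntegral (g : L2) {k : ℝ → L2} (hk : Continuous k) (a b : ℝ) :
    ⟪g, ∫ s in a..b, k s⟫_ℂ = ∫ s in a..b, ⟪g, k s⟫_ℂ :=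
  ((innerSL ℂ g).intervalIntegral_comp_comm (hk.intervalIntegrable a b)).symm

lemma hasDerivAt_primitive {E : Type*} [NormedAddCommGroup E] [NormedSpace ℝ E] [CompleteSpace E]
    {k : ℝ → E} (hk : Continuous k) (a t : ℝ) :
    HasDerivAt (fun s => ∫ r in a..s, k r) (k t) t :=
  intervalIntegral.integral_hasDerivAt_right (hk.intervalIntegrable _ _)
    hk.stronglyMeasurable.stronglyMeasurableAtFilter hk.continuousAt

/-- The motions act differentiably on `H¹(ℝ)`. -/
lemma H1.hasDerivAt_move (ε : ℤˣ) (ψ : H1) (c : ℝ) :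
    HasDerivAt (fun c => move ε c (ψ : L2)) (move ε c (deriv ψ)) c := by
  have hk : Continuous fun s => move ε s (deriv ψ) := continuous_move ε continuous_id continuous_const
  -- The integral identity is tested against smooth θ: the motion passes to θ, where it is
  -- classically differentiable, and the definition of the weak derivative returns the derivative to
  -- ψ.
  have key : ∀ c, move ε c (ψ : L2) = move ε 0 (ψ : L2) + ∫ s in (0 : ℝ)..c, move ε s (deriv ψ) := by
    intro c
    refine L2.ext_of_test fun θ hθ => ?_
    rw [inner_add_right, inner_intervalIntegral _ hk, ← sub_eq_iff_eq_add']
    have hd : ∀ s ∈ uIcc 0 c, HasDerivAt (fun s => ⟪toL2 θ, move ε s (ψ : L2)⟫_ℂ)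
        ⟪toL2 θ, move ε s (deriv ψ)⟫_ℂ s := by
      intro s _
      obtain ⟨R, hR⟩ := hθ.supp.isCompact.isBounded.subset_closedBall 0
      have hz : ∀ x, R < |x| → θ x = 0 := by
        intro x hx
        by_contra h
        have := hR (subset_tsupport _ h)
        rw [mem_closedBall_zero_iff, Real.norm_eq_abs] at this
        linarith
      have h1 := hasDerivAt_toL2 (Φ := fun z => θ (((ε : ℤ) : ℝ) * z.1 + -((ε : ℤ) : ℝ) * z.2))
        (hθ.smooth.comp (by fun_prop)) (t₀ := s) (R := R + |s| + 1) (by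
          intro t ht x hx
          refine hz _ ?_
          rw [neg_mul, ← mul_neg, ← mul_add, abs_mul, abs_units, one_mul]
          have a1 := abs_sub_abs_le_abs_sub x t
          have a2 := abs_sub_abs_le_abs_sub t s
          rw [sub_eq_add_neg x t] at a1
          linarith)
      have e1 : ∀ t, toL2 (fun x => θ (((ε : ℤ) : ℝ) * x + -((ε : ℤ) : ℝ) * t)) =
          move ε (-((ε : ℤ) : ℝ) * t) (toL2 θ) := fun t => (hθ.move_toL2 _ _).symm
      have hdx : ∀ x, _root_.deriv (fun y => θ (((ε : ℤ) : ℝ) * y + -((ε : ℤ) : ℝ) * s)) x =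
          ((ε : ℤ) : ℝ) * _root_.deriv θ (((ε : ℤ) : ℝ) * x + -((ε : ℤ) : ℝ) * s) := by
        intro x
        have := ((hθ.smooth.differentiable (by simp)) (((ε : ℤ) : ℝ) * x
          + -((ε : ℤ) : ℝ) * s)).hasDerivAt.comp x
          (((hasDerivAt_id x).const_mul ((ε : ℤ) : ℝ)).add_const (-((ε : ℤ) : ℝ) * s))
        rw [mul_one] at this
        rw [mul_comm ((ε : ℤ) : ℝ) (_root_.deriv θ _)]
        exact this.deriv
      have hds : ∀ x, _root_.deriv (fun t => θ (((ε : ℤ) : ℝ) * x + -((ε : ℤ) : ℝ) * t)) s =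
          -_root_.deriv (fun y => θ (((ε : ℤ) : ℝ) * y + -((ε : ℤ) : ℝ) * s)) x := by
        intro x
        rw [hdx x]
        have := ((hθ.smooth.differentiable (by simp)) (((ε : ℤ) : ℝ) * x
          + -((ε : ℤ) : ℝ) * s)).hasDerivAt.comp s
          (((hasDerivAt_id s).const_mul (-((ε : ℤ) : ℝ))).const_add (((ε : ℤ) : ℝ) * x))
        rw [mul_one] at this
        rw [mul_comm ((ε : ℤ) : ℝ) (_root_.deriv θ _), ← mul_neg]
        exact this.deriv
      have hθs := hθ.comp_motion ε (-((ε : ℤ) : ℝ) * s)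
      simp only [e1, hds] at h1
      have h2 := h1.inner ℂ (hasDerivAt_const s (ψ : L2))
      simp only [inner_zero_right, zero_add] at h2
      have e2 : ∀ t, ⟪move ε (-((ε : ℤ) : ℝ) * t) (toL2 θ), (ψ : L2)⟫_ℂ =
          ⟪toL2 θ, move ε t (ψ : L2)⟫_ℂ := fun t => (inner_move_right _ _ _ _).symm
      simp only [e2] at h2
      refine h2.congr_deriv ?_
      have e3 : (toL2 fun x => -_root_.deriv (fun y => θ (((ε : ℤ) : ℝ) * y
          + -((ε : ℤ) : ℝ) * s)) x) = -toL2 (_root_.deriv fun y => θ (((ε : ℤ) : ℝ) * y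
          + -((ε : ℤ) : ℝ) * s)) := by
        have := hθs.deriv.smul_toL2 (-1)
        simpa using this.symm
      rw [e3, inner_neg_left, isWeakDeriv_iff_inner.mp (isWeakDeriv ψ) _ hθs, neg_neg, e1,
        inner_move_right]
    rw [intervalIntegral.integral_eq_sub_of_hasDerivAt hd
      ((continuous_const.inner hk).intervalIntegrable _ _)]
  have h := (hasDerivAt_primitive hk 0 c).const_add (move ε 0 (ψ : L2))
  exact h.congr_of_eventuallyEq (Eventually.of_forall key)

/-! ### The contribution of a point source -/

/-- The signed restriction of `f` to the interval with end points `a` and `b`, in `L²(ℝ)`. -/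
def cut (f : ℝ → ℂ) (a b : ℝ) : L2 :=
  open Classical in
  if h : MemLp ((Ι a b).indicator f) 2 (volume : Measure ℝ) then
    (if a ≤ b then (1 : ℂ) else -1) • h.toLp else 0

lemma memLp_indicator_uIoc {f : ℝ → ℂ} (hf : Continuous f) (a b : ℝ) :
    MemLp ((Ι a b).indicator f) 2 (volume : Measure ℝ) := by
  rw [memLp_indicator_iff_restrict measurableSet_uIoc]
  refine (memLp_two_iff_integrable_sq_norm hf.aestronglyMeasurable).mpr ?_
  exact ((hf.norm.pow 2).integrableOn_uIcc).mono_set uIoc_subset_uIcc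

lemma coeFn_cut {f : ℝ → ℂ} (hf : Continuous f) (a b : ℝ) : (cut f a b : ℝ → ℂ) =ᵐ[volume]
    fun x => (if a ≤ b then (1 : ℂ) else -1) * (Ι a b).indicator f x := by
  have h := memLp_indicator_uIoc hf a b
  rw [cut, dif_pos h]
  filter_upwards [Lp.coeFn_smul (if a ≤ b then (1 : ℂ) else -1) h.toLp, h.coeFn_toLp] with x h1 h2
  rw [h1, Pi.smul_apply, h2, smul_eq_mul]

/-- The sign in `cut` is chosen so that pairings become oriented interval integrals. Additivity of
`cut` and both directions of time then need no case distinction. -/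
lemma inner_cut {f : ℝ → ℂ} (hf : Continuous f) (g : L2) (a b : ℝ) :
    ⟪g, cut f a b⟫_ℂ = ∫ x in a..b, ⟪g x, f x⟫_ℂ := by
  rw [L2.inner_def, intervalIntegral.intervalIntegral_eq_integral_uIoc,
    ← integral_indicator measurableSet_uIoc, ← integral_smul]
  refine integral_congr_ae ?_
  filter_upwards [coeFn_cut hf a b] with x hx
  rw [hx]
  by_cases hxI : x ∈ Ι a b
  · rw [indicator_of_mem hxI, indicator_of_mem hxI]
    split_ifs <;> simp
  · rw [indicator_of_notMem hxI, indicator_of_notMem hxI]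
    simp

/-- This makes a delta source with amplitude f a bounded source in L²(ℝ). -/
lemma norm_cut_sq {f : ℝ → ℂ} (hf : Continuous f) (a b : ℝ) :
    ‖cut f a b‖ ^ 2 = |∫ x in a..b, ‖f x‖ ^ 2| := by
  rw [L2.norm_sq_eq_integral, intervalIntegral.abs_integral_eq_abs_integral_uIoc,
    abs_of_nonneg (by positivity), ← integral_indicator measurableSet_uIoc]
  refine integral_congr_ae ?_
  filter_upwards [coeFn_cut hf a b] with x hx
  rw [hx]
  by_cases hxI : x ∈ Ι a b
  · rw [indicator_of_mem hxI, indicator_of_mem hxI]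
    split_ifs <;> simp
  · rw [indicator_of_notMem hxI, indicator_of_notMem hxI]
    simp

lemma intervalIntegrable_inner {f : ℝ → ℂ} (hf : Continuous f) (g : L2) (a b : ℝ) :
    IntervalIntegrable (fun x => ⟪g x, f x⟫_ℂ) volume a b := by
  have h := (L2.locallyIntegrable g).intervalIntegrable_real a b
  have h' : IntervalIntegrable (fun x => (starRingEnd ℂ) (g x)) volume a b :=
    ⟨Complex.conjCLE.integrable_comp_iff.mpr h.1, Complex.conjCLE.integrable_comp_iff.mpr h.2⟩
  simp only [RCLike.inner_apply]
  exact h'.continuousOn_mul hf.continuousOn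

lemma cut_sub_cut {f : ℝ → ℂ} (hf : Continuous f) (a b c : ℝ) :
    cut f a b - cut f a c = cut f c b := by
  refine ext_inner_left ℂ fun g => ?_
  rw [inner_sub_right, inner_cut hf, inner_cut hf, inner_cut hf,
    intervalIntegral.integral_interval_sub_left (intervalIntegrable_inner hf g _ _)
      (intervalIntegrable_inner hf g _ _)]

lemma cut_self (f : ℝ → ℂ) (a : ℝ) : cut f a a = 0 := by
  have h : MemLp ((Ι a a).indicator f) 2 (volume : Measure ℝ) := by simp
  rw [cut, dif_pos h]
  refine (Lp.ext ?_)
  filter_upwards [Lp.coeFn_smul (if a ≤ a then (1 : ℂ) else -1) h.toLp, h.coeFn_toLp,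
    Lp.coeFn_zero ℂ 2 (volume : Measure ℝ)] with x h1 h2 h3
  rw [h1, Pi.smul_apply, h2, h3]
  simp

lemma cut_sub {f g : ℝ → ℂ} (hf : Continuous f) (hg : Continuous g) (a b : ℝ) :
    cut (fun t => f t - g t) a b = cut f a b - cut g a b := by
  refine ext_inner_left ℂ fun k => ?_
  rw [inner_sub_right, inner_cut hf, inner_cut hg,
    inner_cut (f := fun t => f t - g t) (hf.sub hg),
    ← intervalIntegral.integral_sub (intervalIntegrable_inner hf k _ _)
      (intervalIntegrable_inner hg k _ _)]
  simp only [inner_sub_right]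

lemma continuous_cut {f : ℝ → ℂ} (hf : Continuous f) (a : ℝ) : Continuous fun t => cut f a t := by
  rw [continuous_iff_continuousAt]
  intro t
  rw [ContinuousAt, tendsto_iff_norm_sub_tendsto_zero]
  have hP : Continuous fun s => √|∫ x in t..s, ‖f x‖ ^ 2| :=
    (intervalIntegral.continuous_primitive
      (fun a b => (hf.norm.pow 2).intervalIntegrable a b) t).abs.sqrt
  have h0 := hP.tendsto t
  simp only [intervalIntegral.integral_same, abs_zero, Real.sqrt_zero] at h0
  refine h0.congr fun s => ?_
  rw [cut_sub_cut hf, ← norm_cut_sq hf, Real.sqrt_sq (norm_nonneg _)]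

/-! ### The transport equation -/

/-- `v` is the solution of `∂ₜv = ε ∂ₓv + h + δ(x) f` in the integrated form along the
characteristics. -/
structure IsTransport (ε : ℤˣ) (h : ℝ → L2) (f : ℝ → ℂ) (v : ℝ → L2) : Prop where
  continuous : Continuous v
  eq : ∀ t, move ε (-((ε : ℤ) : ℝ) * t) (v t) =
    move ε 0 (v 0) + (∫ s in (0 : ℝ)..t, move ε (-((ε : ℤ) : ℝ) * s) (h s)) + cut f 0 t

lemma continuous_move_comoving (ε : ℤˣ) {h : ℝ → L2} (hh : Continuous h) :
    Continuous fun s => move ε (-((ε : ℤ) : ℝ) * s) (h s) :=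
  continuous_move ε (by fun_prop) hh

/-- The solution of the transport equation with the initial value `g`. -/
def transport (ε : ℤˣ) (g : L2) (h : ℝ → L2) (f : ℝ → ℂ) (t : ℝ) : L2 :=
  move ε t (move ε 0 g + (∫ s in (0 : ℝ)..t, move ε (-((ε : ℤ) : ℝ) * s) (h s)) + cut f 0 t)

lemma transport_zero (ε : ℤˣ) (g : L2) (h : ℝ → L2) (f : ℝ → ℂ) : transport ε g h f 0 = g := by
  rw [transport, intervalIntegral.integral_same, cut_self, add_zero, add_zero, move_move,
    Int.units_mul_self, mul_zero, add_zero, move_one_zero]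

lemma isTransport_transport (ε : ℤˣ) (g : L2) {h : ℝ → L2} {f : ℝ → ℂ} (hh : Continuous h)
    (hf : Continuous f) : IsTransport ε h f (transport ε g h f) where
  continuous := continuous_move ε continuous_id ((continuous_const.add
    (intervalIntegral.continuous_primitive
      (fun a b => (continuous_move_comoving ε hh).intervalIntegrable a b) 0)).add
        (continuous_cut hf 0))
  eq t := by
    rw [transport_zero, transport, move_inv_move]

/-- The weak form of the transport equation, with test functions in `H¹(ℝ)`. -/
lemma IsTransport.hasDerivAt_inner {ε : ℤˣ} {h : ℝ → L2} {f : ℝ → ℂ} {v : ℝ → L2}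
    (hv : IsTransport ε h f v) (hh : Continuous h) (hf : Continuous f) (φ : H1) (t : ℝ) :
    HasDerivAt (fun s => ⟪(φ : L2), v s⟫_ℂ)
      (-((ε : ℤ) : ℂ) * ⟪H1.deriv φ, v t⟫_ℂ + ⟪(φ : L2), h t⟫_ℂ + ⟪H1.eval φ 0, f t⟫_ℂ) t := by
  set e : ℝ := ((ε : ℤ) : ℝ)
  have h1 : HasDerivAt (fun s => move ε (-e * s) (φ : L2))
      ((-e) • move ε (-e * t) (H1.deriv φ)) t := by
    have hl : HasDerivAt (fun s : ℝ => -e * s) (-e) t := by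
      simpa using (hasDerivAt_id t).const_mul (-e)
    exact (H1.hasDerivAt_move ε φ (-e * t)).scomp t hl
  have hq := continuous_move_comoving ε hv.continuous
  set M : L2 := move ε (-e * t) (φ : L2)
  have hM : (M : ℝ → ℂ) =ᵐ[volume] fun x => H1.eval φ (e * x + -e * t) := by
    filter_upwards [coeFn_move ε (-e * t) (φ : L2), (measurePreserving_motion ε
      (-e * t)).quasiMeasurePreserving.ae_eq_comp (H1.coe_ae_eq φ)] with x h1 h2
    rw [h1]; exact h2
  have hMc : Continuous fun x => H1.eval φ (e * x + -e * t) :=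
    (H1.continuous_eval φ).comp (by fun_prop)
  -- With the test vector frozen at time t, the comoving pairing is an explicit primitive of the
  -- sources, although v itself need not be differentiable in L².
  have h2 : HasDerivAt (fun s => ⟪M, move ε (-e * s) (v s)⟫_ℂ)
      (⟪M, move ε (-e * t) (h t)⟫_ℂ + ⟪H1.eval φ 0, f t⟫_ℂ) t := by
    have a1 := hasDerivAt_primitive (k := fun s => ⟪M, move ε (-e * s) (h s)⟫_ℂ)
      (continuous_const.inner (continuous_move_comoving ε hh)) 0 t
    have a2 := hasDerivAt_primitive (k := fun x => ⟪H1.eval φ (e * x + -e * t), f x⟫_ℂ)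
      (hMc.inner hf) 0 t
    have a3 := (a1.fun_add a2).const_add ⟪M, move ε 0 (v 0)⟫_ℂ
    -- At the comoving point t the moved φ takes the value φ(0): the moving end of `cut` acts as the
    -- delta function at the origin.
    rw [show e * t + -e * t = 0 by ring] at a3
    refine a3.congr_of_eventuallyEq (Eventually.of_forall fun s => ?_)
    simp only
    rw [hv.eq s, inner_add_right, inner_add_right, inner_cut hf,
      inner_intervalIntegral _ (continuous_move_comoving ε hh), add_assoc]
    congr 2
    refine intervalIntegral.integral_congr_ae ?_
    filter_upwards [hM] with x hx _
    rw [hx]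
  have h3 := HasDerivAt.inner_of_weak h1 hq.continuousAt h2
  simp only [LinearIsometry.inner_map_map, M, e] at h3
  refine h3.congr_deriv ?_
  rw [← algebraMap_smul ℂ (-e), inner_smul_left, LinearIsometry.inner_map_map]
  simp [e, add_assoc]

/-! ### Convergence in the energy space -/

lemma energyNorm_apply (m : ℝ) (Ψ : State) : energyNorm m Ψ =
    √(‖Ψ.mom‖ ^ 2 + ‖H1.deriv Ψ.psi‖ ^ 2 + m ^ 2 * ‖Ψ.psi‖ ^ 2) := rfl

lemma State.psi_sub (Ψ Φ : State) : (Ψ - Φ).psi = Ψ.psi - Φ.psi := rfl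

lemma State.mom_sub (Ψ Φ : State) : (Ψ - Φ).mom = Ψ.mom - Φ.mom := rfl

lemma State.ext_of_eq {Ψ Φ : State} (h1 : (Ψ.psi : L2) = Φ.psi) (h2 : Ψ.mom = Φ.mom) : Ψ = Φ :=
  Prod.ext (Subtype.ext h1) h2

/-- The sum of the norms on `J` of the components of a state. -/
def State.sumNorm (J : Set ℝ) (Ψ : State) : ℝ :=
  setNorm J Ψ.mom + setNorm J (H1.deriv Ψ.psi) + setNorm J (Ψ.psi : L2)

lemma State.sumNorm_nonneg (J : Set ℝ) (Ψ : State) : 0 ≤ Ψ.sumNorm J :=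
  add_nonneg (add_nonneg (setNorm_nonneg _ _) (setNorm_nonneg _ _)) (setNorm_nonneg _ _)

lemma sqrt_le_mul_add {m a b c : ℝ} (hm : 0 ≤ m) (ha : 0 ≤ a) (hb : 0 ≤ b) (hc : 0 ≤ c) :
    √(a ^ 2 + b ^ 2 + m ^ 2 * c ^ 2) ≤ (1 + m) * (a + b + c) := by
  refine Real.sqrt_le_iff.mpr ⟨by positivity, ?_⟩
  have h1 : a ^ 2 + b ^ 2 + m ^ 2 * c ^ 2 ≤ (a + b + m * c) ^ 2 := by
    have := mul_nonneg ha hb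
    have := mul_nonneg (mul_nonneg hm hc) ha
    have := mul_nonneg (mul_nonneg hm hc) hb
    nlinarith
  refine h1.trans (pow_le_pow_left₀ (by positivity) ?_ 2)
  nlinarith [mul_nonneg hm ha, mul_nonneg hm hb]

lemma add_le_mul_sqrt {m a b c : ℝ} (hm : 0 < m) :
    a + b + c ≤ (2 + 1 / m) * √(a ^ 2 + b ^ 2 + m ^ 2 * c ^ 2) := by
  set s := √(a ^ 2 + b ^ 2 + m ^ 2 * c ^ 2)
  have h1 : a ≤ s := Real.le_sqrt_of_sq_le (by nlinarith [sq_nonneg b, sq_nonneg (m * c)])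
  have h2 : b ≤ s := Real.le_sqrt_of_sq_le (by nlinarith [sq_nonneg a, sq_nonneg (m * c)])
  have h3 : m * c ≤ s := Real.le_sqrt_of_sq_le (by nlinarith [sq_nonneg b, sq_nonneg a])
  have h4 : c ≤ 1 / m * s := by
    rw [one_div, ← div_eq_inv_mul, le_div_iff₀ hm]; linarith
  linarith

lemma energyNorm_le {m : ℝ} (hm : 0 ≤ m) (Ψ : State) :
    energyNorm m Ψ ≤ (1 + m) * Ψ.sumNorm univ := by
  rw [energyNorm_apply, State.sumNorm, ← norm_eq_setNorm_univ, ← norm_eq_setNorm_univ,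
    ← norm_eq_setNorm_univ]
  exact sqrt_le_mul_add hm (norm_nonneg _) (norm_nonneg _) (norm_nonneg _)

lemma sumNorm_le_energyNorm {m : ℝ} (hm : 0 < m) (Ψ : State) :
    Ψ.sumNorm univ ≤ (2 + 1 / m) * energyNorm m Ψ := by
  rw [energyNorm_apply, State.sumNorm, ← norm_eq_setNorm_univ, ← norm_eq_setNorm_univ,
    ← norm_eq_setNorm_univ]
  exact add_le_mul_sqrt hm

lemma localEnergyNorm_le {m : ℝ} (hm : 0 ≤ m) (R : ℝ) (Ψ : State) :
    localEnergyNorm m R Ψ ≤ (1 + m) * Ψ.sumNorm (Ioo (-R) R) :=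
  sqrt_le_mul_add hm (localNorm_nonneg _ _) (localNorm_nonneg _ _) (localNorm_nonneg _ _)

lemma sumNorm_le_localEnergyNorm {m : ℝ} (hm : 0 < m) (R : ℝ) (Ψ : State) :
    Ψ.sumNorm (Ioo (-R) R) ≤ (2 + 1 / m) * localEnergyNorm m R Ψ :=
  add_le_mul_sqrt hm

lemma tendsto_nhds_energyTopology {X : Type*} {m : ℝ} {l : Filter X} {u : X → State} {Ψ : State} :
    Tendsto u l (@nhds State (energyTopology m) Ψ) ↔
      Tendsto (fun x => energyNorm m (u x - Ψ)) l (𝓝 0) := by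
  let _ := (energyNorm m).toSeminormedAddCommGroup
  exact tendsto_iff_norm_sub_tendsto_zero

lemma tendsto_nhds_energyTopology' {X : Type*} {m : ℝ} (hm : 0 < m) {l : Filter X} {u : X → State}
    {Ψ : State} : Tendsto u l (@nhds State (energyTopology m) Ψ) ↔
      Tendsto (fun x => (u x - Ψ).sumNorm univ) l (𝓝 0) := by
  rw [tendsto_nhds_energyTopology]
  constructor
  · intro h
    refine squeeze_zero (fun x => State.sumNorm_nonneg _ _)
      (fun x => sumNorm_le_energyNorm hm _) ?_
    simpa using h.const_mul (2 + 1 / m)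
  · intro h
    refine squeeze_zero (fun x => apply_nonneg _ _) (fun x => energyNorm_le hm.le _) ?_
    simpa using h.const_mul (1 + m)

lemma continuous_energyTopology_iff {m : ℝ} (hm : 0 < m) {Ψ : ℝ → State} :
    @Continuous ℝ State _ (energyTopology m) Ψ ↔ Continuous (fun t => ((Ψ t).psi : L2)) ∧
      Continuous (fun t => H1.deriv (Ψ t).psi) ∧ Continuous (fun t => (Ψ t).mom) := by
  simp only [@continuous_iff_continuousAt _ _ _ (energyTopology m), continuous_iff_continuousAt,
    ContinuousAt]
  rw [← forall_and, ← forall_and]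
  refine forall_congr' fun t => ?_
  rw [tendsto_nhds_energyTopology' hm, tendsto_iff_norm_sub_tendsto_zero (b := ((Ψ t).psi : L2)),
    tendsto_iff_norm_sub_tendsto_zero (b := H1.deriv _),
    tendsto_iff_norm_sub_tendsto_zero (b := (Ψ t).mom)]
  have e : ∀ s, (Ψ s - Ψ t).sumNorm univ = ‖(Ψ s).mom - (Ψ t).mom‖
      + ‖H1.deriv (Ψ s).psi - H1.deriv (Ψ t).psi‖
      + ‖((Ψ s).psi : L2) - (Ψ t).psi‖ := by
    intro s
    rw [State.sumNorm, ← norm_eq_setNorm_univ, ← norm_eq_setNorm_univ, ← norm_eq_setNorm_univ,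
      State.mom_sub, State.psi_sub, H1.deriv_sub, Submodule.coe_sub]
  simp only [e]
  constructor
  · intro h
    refine ⟨?_, ?_, ?_⟩ <;> refine squeeze_zero (fun s => norm_nonneg _) (fun s => ?_) h
    · exact le_add_of_nonneg_left (by positivity)
    · rw [add_right_comm]; exact le_add_of_nonneg_left (by positivity)
    · rw [add_assoc]; exact le_add_of_nonneg_right (by positivity)
  · rintro ⟨h1, h2, h3⟩
    simpa using (h3.add h2).add h1

lemma H1.norm_eval_zero_sub_le {J : Set ℝ} (hJ : Ioo 0 1 ⊆ J) (ψ φ : H1) :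
    ‖eval ψ 0 - eval φ 0‖ ≤ setNorm J ((ψ : L2) - φ) + setNorm J (deriv ψ - deriv φ) := by
  rw [← eval_sub, ← deriv_sub, ← Submodule.coe_sub]
  exact norm_eval_zero_le hJ _

lemma H1.continuous_eval_zero {ψ : ℝ → H1} (h1 : Continuous fun t => (ψ t : L2))
    (h2 : Continuous fun t => deriv (ψ t)) : Continuous fun t => eval (ψ t) 0 := by
  rw [continuous_iff_continuousAt]
  intro t
  rw [ContinuousAt, tendsto_iff_norm_sub_tendsto_zero]
  have h1' := tendsto_iff_norm_sub_tendsto_zero.mp (h1.tendsto t)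
  have h2' := tendsto_iff_norm_sub_tendsto_zero.mp (h2.tendsto t)
  refine squeeze_zero (fun s => norm_nonneg _)
    (fun s => norm_eval_zero_sub_le (subset_univ _) (ψ s) (ψ t)) ?_
  simp only [← norm_eq_setNorm_univ]
  simpa using h1'.add h2'

/-! ### The wave equation in integrated form -/

/-- `Ψ = (ψ, π)` solves `∂ₜψ = π`, `∂ₜπ = ∂ₓ²ψ + h + δ(x) f` in the integrated form. -/
structure IsMild (h : ℝ → L2) (f : ℝ → ℂ) (Ψ : ℝ → State) : Prop where
  psi_eq : ∀ t, ((Ψ t).psi : L2) = (Ψ 0).psi + ∫ s in (0 : ℝ)..t, (Ψ s).mom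
  transport : ∀ ε : ℤˣ, IsTransport ε h f
    (fun t => (Ψ t).mom + ((ε : ℤ) : ℂ) • H1.deriv (Ψ t).psi)

namespace IsMild

variable {h : ℝ → L2} {f : ℝ → ℂ} {Ψ : ℝ → State}

/-- Inverts the passage to the Riemann invariants, so that what holds for the two transport
equations carries over to the state. -/
lemma mom_eq (t : ℝ) : (Ψ t).mom = (1 / 2 : ℂ) •
    (((Ψ t).mom + (((1 : ℤˣ) : ℤ) : ℂ) • H1.deriv (Ψ t).psi)
      + ((Ψ t).mom + (((-1 : ℤˣ) : ℤ) : ℂ) • H1.deriv (Ψ t).psi)) := by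
  push_cast
  module

lemma deriv_eq (t : ℝ) : H1.deriv (Ψ t).psi = (1 / 2 : ℂ) •
    (((Ψ t).mom + (((1 : ℤˣ) : ℤ) : ℂ) • H1.deriv (Ψ t).psi)
      - ((Ψ t).mom + (((-1 : ℤˣ) : ℤ) : ℂ) • H1.deriv (Ψ t).psi)) := by
  push_cast
  module

lemma continuous_mom (H : IsMild h f Ψ) : Continuous fun t => (Ψ t).mom := by
  have := ((H.transport 1).continuous.add (H.transport (-1)).continuous).const_smul (1 / 2 : ℂ)
  exact this.congr fun t => (mom_eq t).symm

lemma continuous_deriv (H : IsMild h f Ψ) : Continuous fun t => H1.deriv (Ψ t).psi := by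
  have := ((H.transport 1).continuous.sub (H.transport (-1)).continuous).const_smul (1 / 2 : ℂ)
  exact this.congr fun t => (deriv_eq t).symm

lemma hasDerivAt_psi (H : IsMild h f Ψ) (t : ℝ) :
    HasDerivAt (fun t => ((Ψ t).psi : L2)) (Ψ t).mom t :=
  ((hasDerivAt_primitive H.continuous_mom 0 t).const_add ((Ψ 0).psi : L2)).congr_of_eventuallyEq
    (Eventually.of_forall H.psi_eq)

lemma continuous_psi (H : IsMild h f Ψ) : Continuous fun t => ((Ψ t).psi : L2) :=
  continuous_iff_continuousAt.mpr fun t => (H.hasDerivAt_psi t).continuousAt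

lemma continuous_eval (H : IsMild h f Ψ) : Continuous fun t => H1.eval (Ψ t).psi 0 :=
  H1.continuous_eval_zero H.continuous_psi H.continuous_deriv

/-- The weak form of the equation for `π`, with test functions in `H¹(ℝ)`. -/
lemma hasDerivAt_inner_mom (H : IsMild h f Ψ) (hh : Continuous h) (hf : Continuous f) (φ : H1)
    (t : ℝ) : HasDerivAt (fun s => ⟪(φ : L2), (Ψ s).mom⟫_ℂ)
      (-⟪H1.deriv φ, H1.deriv (Ψ t).psi⟫_ℂ + ⟪(φ : L2), h t⟫_ℂ + ⟪H1.eval φ 0, f t⟫_ℂ) t := by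
  have h1 := (((H.transport 1).hasDerivAt_inner hh hf φ t).fun_add
    ((H.transport (-1)).hasDerivAt_inner hh hf φ t)).const_mul (1 / 2 : ℂ)
  have h2 : ∀ s, ⟪(φ : L2), (Ψ s).mom⟫_ℂ = (1 / 2 : ℂ) *
      (⟪(φ : L2), (Ψ s).mom + (((1 : ℤˣ) : ℤ) : ℂ) • H1.deriv (Ψ s).psi⟫_ℂ
        + ⟪(φ : L2), (Ψ s).mom + (((-1 : ℤˣ) : ℤ) : ℂ) • H1.deriv (Ψ s).psi⟫_ℂ) := by
    intro s
    rw [← inner_add_right, ← inner_smul_right, ← mom_eq]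
  refine (h1.congr_of_eventuallyEq (Eventually.of_forall h2)).congr_deriv ?_
  simp only [inner_add_right, inner_smul_right]
  push_cast
  ring

end IsMild

/-- The integral transform of the sources and the initial state to the solution of the wave
equation. -/
lemma exists_isMild (Ψ₀ : State) {h : ℝ → L2} {f : ℝ → ℂ} (hh : Continuous h)
    (hf : Continuous f) : ∃ Ψ : ℝ → State, IsMild h f Ψ ∧ Ψ 0 = Ψ₀ := by
  set v : ℤˣ → ℝ → L2 := fun ε =>
    transport ε (Ψ₀.mom + ((ε : ℤ) : ℂ) • H1.deriv Ψ₀.psi) h f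
  have hv : ∀ ε, IsTransport ε h f (v ε) := fun ε => isTransport_transport ε _ hh hf
  have hv0 : ∀ ε, v ε 0 = Ψ₀.mom + ((ε : ℤ) : ℂ) • H1.deriv Ψ₀.psi := fun ε => transport_zero ε _ h f
  set q : ℝ → L2 := fun t => (1 / 2 : ℂ) • (v 1 t + v (-1) t)
  set d : ℝ → L2 := fun t => (1 / 2 : ℂ) • (v 1 t - v (-1) t)
  have hq : Continuous q :=
    ((hv 1).continuous.add (hv (-1)).continuous).const_smul (1 / 2 : ℂ)
  set p : ℝ → L2 := fun t => (Ψ₀.psi : L2) + ∫ s in (0 : ℝ)..t, q s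
  have hpd : ∀ t, HasDerivAt p (q t) t := fun t =>
    (hasDerivAt_primitive hq 0 t).const_add _
  have hp0 : p 0 = Ψ₀.psi := by simp [p]
  have hq0 : q 0 = Ψ₀.mom := by
    simp only [q, hv0]; push_cast; module
  have hd0 : d 0 = H1.deriv Ψ₀.psi := by
    simp only [d, hv0]; push_cast; module
  have hw : ∀ t, IsWeakDeriv (p t) (d t) := by
    intro t
    rw [isWeakDeriv_iff_inner]
    intro φ hφ
    -- The compatibility of d with the weak derivative of p propagates in time: the mass and point
    -- sources cancel in v₁ - v₋₁, the defect is constant, and it vanishes at time zero.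
    have hder : ∀ s, HasDerivAt (fun s => ⟪toL2 (deriv φ), p s⟫_ℂ + ⟪toL2 φ, d s⟫_ℂ) 0 s := by
      intro s
      have h1 := (hasDerivAt_const s (toL2 (deriv φ))).inner ℂ (hpd s)
      have h2 := (((hv 1).hasDerivAt_inner hh hf hφ.toH1 s).fun_sub
        ((hv (-1)).hasDerivAt_inner hh hf hφ.toH1 s)).const_mul (1 / 2 : ℂ)
      simp only [hφ.coe_toH1, hφ.deriv_toH1] at h2
      have e : ∀ s, ⟪toL2 φ, d s⟫_ℂ = 1 / 2 * (⟪toL2 φ, v 1 s⟫_ℂ - ⟪toL2 φ, v (-1) s⟫_ℂ) := by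
        intro s
        simp only [d, inner_smul_right, inner_sub_right]
      have h3 := h1.fun_add (h2.congr_of_eventuallyEq (Eventually.of_forall e))
      refine h3.congr_deriv ?_
      simp only [q, inner_smul_right, inner_add_right, inner_zero_left]
      push_cast
      ring
    have hc := is_const_of_deriv_eq_zero (fun s => (hder s).differentiableAt)
      (fun s => (hder s).deriv) t 0
    rw [hp0, hd0, isWeakDeriv_iff_inner.mp (H1.isWeakDeriv Ψ₀.psi) φ hφ, neg_add_cancel] at hc
    exact eq_neg_of_add_eq_zero_left hc
  refine ⟨fun t => (H1.ofWeakDeriv (p t) (d t) (hw t), q t), ⟨?_, ?_⟩, ?_⟩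
  · intro t
    change p t = p 0 + ∫ s in (0 : ℝ)..t, q s
    rw [hp0]
  · intro ε
    have e : ∀ t, q t + ((ε : ℤ) : ℂ) • H1.deriv (H1.ofWeakDeriv (p t) (d t) (hw t)) = v ε t := by
      intro t
      rw [H1.deriv_ofWeakDeriv]
      rcases Int.units_eq_one_or ε with rfl | rfl
      · simp only [q, d]; push_cast; module
      · simp only [q, d]; push_cast; module
    have := hv ε
    rwa [← (funext e : (fun t => _) = v ε)] at this
  · exact State.ext_of_eq hp0 hq0

/-! ### Test functions on the plane -/

/-- Smooth compactly supported functions on the plane. -/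
structure IsPlaneTest (Φ : ℝ × ℝ → ℝ) : Prop where
  smooth : ContDiff ℝ ∞ Φ
  supp : HasCompactSupport Φ

/-- The derivative with respect to the second variable. -/
def timeDeriv (Φ : ℝ × ℝ → ℝ) (z : ℝ × ℝ) : ℝ := deriv (fun s => Φ (z.1, s)) z.2

/-- The derivative with respect to the first variable. -/
def spaceDeriv (Φ : ℝ × ℝ → ℝ) (z : ℝ × ℝ) : ℝ := deriv (fun y => Φ (y, z.2)) z.1

namespace IsPlaneTest

variable {Φ : ℝ × ℝ → ℝ}

lemma exists_bound (hΦ : IsPlaneTest Φ) :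
    ∃ R, ∀ x t, (R < |x| ∨ R < |t|) → Φ (x, t) = 0 := by
  obtain ⟨R, hR⟩ := hΦ.supp.isCompact.isBounded.subset_closedBall 0
  refine ⟨R, fun x t hxt => ?_⟩
  by_contra hne
  have := hR (subset_tsupport _ hne)
  rw [mem_closedBall_zero_iff, Prod.norm_def, max_le_iff, Real.norm_eq_abs, Real.norm_eq_abs] at this
  rcases hxt with h | h <;> linarith [this.1, this.2]

lemma of_bound (h : ContDiff ℝ ∞ Φ) {R : ℝ}
    (hR : ∀ x t, (R < |x| ∨ R < |t|) → Φ (x, t) = 0) : IsPlaneTest Φ := by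
  refine ⟨h, HasCompactSupport.intro ((isCompact_Icc (a := -R) (b := R)).prod
    (isCompact_Icc (a := -R) (b := R))) ?_⟩
  rintro ⟨x, t⟩ hxt
  rw [mem_prod, mem_Icc, mem_Icc, ← abs_le, ← abs_le, not_and_or, not_le, not_le] at hxt
  exact hR x t hxt

lemma timeDeriv_eq (hΦ : IsPlaneTest Φ) : timeDeriv Φ = fun z => fderiv ℝ Φ z (0, 1) := by
  funext z
  have h1 : HasDerivAt (fun s : ℝ => (z.1, s)) ((0 : ℝ), (1 : ℝ)) z.2 :=
    (hasDerivAt_const _ _).prodMk (hasDerivAt_id _)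
  exact (((hΦ.smooth.differentiable (by simp)) z).hasFDerivAt.comp_hasDerivAt z.2 h1).deriv

lemma spaceDeriv_eq (hΦ : IsPlaneTest Φ) : spaceDeriv Φ = fun z => fderiv ℝ Φ z (1, 0) := by
  funext z
  have h1 : HasDerivAt (fun s : ℝ => (s, z.2)) ((1 : ℝ), (0 : ℝ)) z.1 :=
    (hasDerivAt_id _).prodMk (hasDerivAt_const _ _)
  exact (((hΦ.smooth.differentiable (by simp)) z).hasFDerivAt.comp_hasDerivAt z.1 h1).deriv

lemma fderiv_apply (hΦ : IsPlaneTest Φ) (v : ℝ × ℝ) : IsPlaneTest fun z => fderiv ℝ Φ z v :=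
  ⟨(hΦ.smooth.fderiv_right (by simp)).clm_apply contDiff_const, hΦ.supp.fderiv_apply ℝ v⟩

lemma timeDeriv (hΦ : IsPlaneTest Φ) : IsPlaneTest (timeDeriv Φ) := by
  rw [hΦ.timeDeriv_eq]
  exact hΦ.fderiv_apply _

lemma spaceDeriv (hΦ : IsPlaneTest Φ) : IsPlaneTest (spaceDeriv Φ) := by
  rw [hΦ.spaceDeriv_eq]
  exact hΦ.fderiv_apply _

lemma slice (hΦ : IsPlaneTest Φ) (t : ℝ) : IsTest fun x => Φ (x, t) := by
  obtain ⟨R, hR⟩ := hΦ.exists_bound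
  refine ⟨hΦ.smooth.comp (by fun_prop), HasCompactSupport.intro (isCompact_Icc (a := -R) (b := R)) ?_⟩
  intro x hx
  rw [mem_Icc, ← abs_le, not_le] at hx
  exact hR x t (Or.inl hx)

/-- The curve in `L²(ℝ)` given by a test function. -/
def curve (Φ : ℝ × ℝ → ℝ) (t : ℝ) : L2 := toL2 fun x => Φ (x, t)

lemma hasDerivAt_curve (hΦ : IsPlaneTest Φ) (t : ℝ) :
    HasDerivAt (curve Φ) (curve (KleinGordonOscillator.timeDeriv Φ) t) t := by
  obtain ⟨R, hR⟩ := hΦ.exists_bound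
  exact hasDerivAt_toL2 hΦ.smooth fun s _ x hx => hR x s (Or.inl hx)

lemma continuous_curve (hΦ : IsPlaneTest Φ) : Continuous (curve Φ) :=
  continuous_iff_continuousAt.mpr fun t => (hΦ.hasDerivAt_curve t).continuousAt

lemma toL2_zero : toL2 (fun _ => (0 : ℝ)) = 0 := by
  refine toL2_eq_of_ae ⟨contDiff_const, HasCompactSupport.zero⟩ ?_
  filter_upwards [Lp.coeFn_zero ℂ 2 (volume : Measure ℝ)] with x h0
  exact h0.trans Complex.ofReal_zero.symm

lemma hasCompactSupport_curve (hΦ : IsPlaneTest Φ) : HasCompactSupport (curve Φ) := by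
  obtain ⟨R, hR⟩ := hΦ.exists_bound
  refine HasCompactSupport.intro (isCompact_Icc (a := -R) (b := R)) fun t ht => ?_
  rw [mem_Icc, ← abs_le, not_le] at ht
  rw [curve, show (fun x => Φ (x, t)) = fun _ => 0 from funext fun x => hR x t (Or.inr ht), toL2_zero]

lemma hasCompactSupport_inner (hΦ : IsPlaneTest Φ) (g : ℝ → L2) :
    HasCompactSupport fun t => ⟪curve Φ t, g t⟫_ℂ := by
  refine hΦ.hasCompactSupport_curve.mono fun t ht => ?_
  rw [Function.mem_support] at ht ⊢
  rintro h0
  exact ht (by rw [h0, inner_zero_left])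

lemma integrable_inner (hΦ : IsPlaneTest Φ) {g : ℝ → L2} (hg : Continuous g) :
    Integrable fun t => ⟪curve Φ t, g t⟫_ℂ :=
  (hΦ.continuous_curve.inner hg).integrable_of_hasCompactSupport (hΦ.hasCompactSupport_inner g)

lemma inner_curve (hΦ : IsPlaneTest Φ) (g : L2) (t : ℝ) :
    ⟪curve Φ t, g⟫_ℂ = ∫ x, Φ (x, t) • g x := (hΦ.slice t).inner_toL2 g

lemma curve_spaceDeriv (Φ : ℝ × ℝ → ℝ) (t : ℝ) :
    curve (KleinGordonOscillator.spaceDeriv Φ) t = toL2 (deriv fun x => Φ (x, t)) := rfl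

lemma inner_curve_spaceDeriv (hΦ : IsPlaneTest Φ) (ψ : H1) (t : ℝ) :
    ⟪curve (KleinGordonOscillator.spaceDeriv Φ) t, (ψ : L2)⟫_ℂ = -⟪curve Φ t, H1.deriv ψ⟫_ℂ := by
  rw [curve_spaceDeriv, curve]
  exact isWeakDeriv_iff_inner.mp (H1.isWeakDeriv ψ) _ (hΦ.slice t)

lemma integrable_trace (hΦ : IsPlaneTest Φ) {f : ℝ → ℂ} (hf : Continuous f) :
    Integrable fun t => Φ (0, t) • f t := by
  obtain ⟨R, hR⟩ := hΦ.exists_bound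
  have hc : Continuous fun t => Φ (0, t) := hΦ.smooth.continuous.comp (by fun_prop)
  refine (hc.smul hf).integrable_of_hasCompactSupport
    (HasCompactSupport.intro (isCompact_Icc (a := -R) (b := R)) fun t ht => ?_)
  rw [mem_Icc, ← abs_le, not_le] at ht
  change Φ (0, t) • f t = 0
  rw [hR 0 t (Or.inr ht), zero_smul]

lemma inner_mass (hΦ : IsPlaneTest Φ) (m t : ℝ) (g : L2) :
    ∫ x, (iteratedDeriv 2 (fun y => Φ (y, t)) x - m ^ 2 * Φ (x, t)) • g x =
      ⟪curve (KleinGordonOscillator.spaceDeriv (KleinGordonOscillator.spaceDeriv Φ)) t, g⟫_ℂ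
        + ⟪curve Φ t, (-(m : ℂ) ^ 2) • g⟫_ℂ := by
  rw [inner_smul_right, inner_curve hΦ, inner_curve hΦ.spaceDeriv.spaceDeriv]
  have e : ∀ x, iteratedDeriv 2 (fun y => Φ (y, t)) x =
      KleinGordonOscillator.spaceDeriv (KleinGordonOscillator.spaceDeriv Φ) (x, t) := by
    intro x
    rw [iteratedDeriv_succ, iteratedDeriv_one]
    rfl
  simp only [e, sub_smul, mul_smul]
  have i1 := L2.integrable_smul g (hΦ.spaceDeriv.spaceDeriv.slice t).smooth.continuous
    (hΦ.spaceDeriv.spaceDeriv.slice t).supp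
  have i2 := L2.integrable_smul g (hΦ.slice t).smooth.continuous (hΦ.slice t).supp
  have i3 : Integrable (fun x => m ^ 2 • (Φ (x, t) • g x)) := i2.smul (m ^ 2)
  rw [integral_sub i1 i3, integral_smul, Complex.real_smul]
  push_cast
  ring

end IsPlaneTest

open IsPlaneTest

/-! ### Equivalence of distributional and integrated solutions -/

/-- The source `-m² ψ`. -/
def massSource (m : ℝ) (Ψ : ℝ → State) (t : ℝ) : L2 := (-(m : ℂ) ^ 2) • ((Ψ t).psi : L2)

/-- The weak formulation of the Cauchy problem through inner products in `L²(ℝ)`. -/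
lemma isSolution_iff_inner {m : ℝ} (hm : 0 < m) {F : ℂ → ℂ} {Ψ₀ : State} {Ψ : ℝ → State} :
    IsSolution m F Ψ₀ Ψ ↔ (Continuous (fun t => ((Ψ t).psi : L2)) ∧
      Continuous (fun t => H1.deriv (Ψ t).psi) ∧ Continuous (fun t => (Ψ t).mom)) ∧
      (∀ Φ, IsPlaneTest Φ → -(∫ t, ⟪curve (timeDeriv Φ) t, ((Ψ t).psi : L2)⟫_ℂ) =
        ∫ t, ⟪curve Φ t, (Ψ t).mom⟫_ℂ) ∧
      (∀ Φ, IsPlaneTest Φ → -(∫ t, ⟪curve (timeDeriv Φ) t, (Ψ t).mom⟫_ℂ) =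
        (∫ t, (⟪curve (spaceDeriv (spaceDeriv Φ)) t, ((Ψ t).psi : L2)⟫_ℂ
          + ⟪curve Φ t, massSource m Ψ t⟫_ℂ)) + ∫ t, Φ (0, t) • F (H1.eval (Ψ t).psi 0)) ∧
      Ψ 0 = Ψ₀ := by
  have e1 : ∀ Φ, IsPlaneTest Φ → ∀ g : ℝ → L2, ∫ t, ⟪curve (timeDeriv Φ) t, g t⟫_ℂ =
      ∫ t, ∫ x, deriv (fun s => Φ (x, s)) t • g t x := fun Φ hΦ g =>
    integral_congr_ae (Eventually.of_forall fun t => hΦ.timeDeriv.inner_curve (g t) t)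
  have e2 : ∀ Φ, IsPlaneTest Φ → ∀ g : ℝ → L2, ∫ t, ⟪curve Φ t, g t⟫_ℂ =
      ∫ t, ∫ x, Φ (x, t) • g t x := fun Φ hΦ g =>
    integral_congr_ae (Eventually.of_forall fun t => hΦ.inner_curve (g t) t)
  have e3 : ∀ Φ, IsPlaneTest Φ → ∫ t, (⟪curve (spaceDeriv (spaceDeriv Φ)) t, ((Ψ t).psi : L2)⟫_ℂ
          + ⟪curve Φ t, massSource m Ψ t⟫_ℂ) = ∫ t, ∫ x, (iteratedDeriv 2 (fun y => Φ (y, t)) x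
            - m ^ 2 * Φ (x, t)) • ((Ψ t).psi : L2) x := fun Φ hΦ =>
    integral_congr_ae (Eventually.of_forall fun t => (hΦ.inner_mass m t _).symm)
  constructor
  · rintro ⟨h1, h2, h3, h4⟩
    refine ⟨(continuous_energyTopology_iff hm).mp h1, fun Φ hΦ => ?_, fun Φ hΦ => ?_, h4⟩
    · rw [e1 Φ hΦ, e2 Φ hΦ]
      exact h2 Φ hΦ.smooth hΦ.supp
    · rw [e1 Φ hΦ, e3 Φ hΦ]
      exact h3 Φ hΦ.smooth hΦ.supp
  · rintro ⟨h1, h2, h3, h4⟩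
    refine ⟨(continuous_energyTopology_iff hm).mpr h1, fun Φ hΦ hc => ?_, fun Φ hΦ hc => ?_, h4⟩
    · have := h2 Φ ⟨hΦ, hc⟩
      rwa [e1 Φ ⟨hΦ, hc⟩, e2 Φ ⟨hΦ, hc⟩] at this
    · have := h3 Φ ⟨hΦ, hc⟩
      rwa [e1 Φ ⟨hΦ, hc⟩, e3 Φ ⟨hΦ, hc⟩] at this

lemma continuous_massSource {m : ℝ} {Ψ : ℝ → State} (h : Continuous fun t => ((Ψ t).psi : L2)) :
    Continuous (massSource m Ψ) := h.const_smul (-(m : ℂ) ^ 2)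

/-- Solutions in the integrated form are solutions in the sense of distributions. -/
lemma IsMild.isSolution {m : ℝ} (hm : 0 < m) {F : ℂ → ℂ} (hF : Continuous F) {Ψ : ℝ → State}
    (H : IsMild (massSource m Ψ) (fun t => F (H1.eval (Ψ t).psi 0)) Ψ) :
    IsSolution m F (Ψ 0) Ψ := by
  have hp := H.continuous_psi
  have hq := H.continuous_mom
  have hd := H.continuous_deriv
  have hh : Continuous (massSource m Ψ) := continuous_massSource hp
  have hf : Continuous fun t => F (H1.eval (Ψ t).psi 0) := hF.comp H.continuous_eval
  refine (isSolution_iff_inner hm).mpr ⟨⟨hp, hd, hq⟩, fun Φ hΦ => ?_, fun Φ hΦ => ?_, rfl⟩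
  · have hder : ∀ t, HasDerivAt (fun t => ⟪curve Φ t, ((Ψ t).psi : L2)⟫_ℂ)
        (⟪curve (timeDeriv Φ) t, ((Ψ t).psi : L2)⟫_ℂ + ⟪curve Φ t, (Ψ t).mom⟫_ℂ) t := fun t => by
      rw [add_comm]
      exact (hΦ.hasDerivAt_curve t).inner ℂ (H.hasDerivAt_psi t)
    have i1 := hΦ.timeDeriv.integrable_inner hp
    have i2 := hΦ.integrable_inner hq
    have h0 := integral_eq_zero_of_hasDerivAt_of_integrable hder (i1.add i2)
      (hΦ.integrable_inner hp)
    rw [integral_add i1 i2] at h0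
    exact neg_eq_of_add_eq_zero_right h0
  · have hder : ∀ t, HasDerivAt (fun t => ⟪curve Φ t, (Ψ t).mom⟫_ℂ)
        (⟪curve (timeDeriv Φ) t, (Ψ t).mom⟫_ℂ
          + ((⟪curve (spaceDeriv (spaceDeriv Φ)) t, ((Ψ t).psi : L2)⟫_ℂ
            + ⟪curve Φ t, massSource m Ψ t⟫_ℂ) + Φ (0, t) • F (H1.eval (Ψ t).psi 0))) t := fun t => by
      -- The momentum is continuous in L² but differentiable only against H¹ functions, which is
      -- exactly what the weak product rule needs.
      refine HasDerivAt.inner_of_weak (hΦ.hasDerivAt_curve t) hq.continuousAt ?_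
      refine (H.hasDerivAt_inner_mom hh hf (hΦ.slice t).toH1 t).congr_deriv ?_
      rw [IsTest.eval_toH1, IsTest.deriv_toH1, hΦ.spaceDeriv.inner_curve_spaceDeriv,
        curve_spaceDeriv, IsTest.coe_toH1]
      simp [curve, mul_comm]
    have i1 := hΦ.timeDeriv.integrable_inner hq
    have i2 : Integrable fun t => ⟪curve (spaceDeriv (spaceDeriv Φ)) t, ((Ψ t).psi : L2)⟫_ℂ
        + ⟪curve Φ t, massSource m Ψ t⟫_ℂ :=
      (hΦ.spaceDeriv.spaceDeriv.integrable_inner hp).add (hΦ.integrable_inner hh)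
    have i3 := hΦ.integrable_trace hf
    have i4 : Integrable fun t => (⟪curve (spaceDeriv (spaceDeriv Φ)) t, ((Ψ t).psi : L2)⟫_ℂ
        + ⟪curve Φ t, massSource m Ψ t⟫_ℂ) + Φ (0, t) • F (H1.eval (Ψ t).psi 0) := i2.add i3
    have h0 := integral_eq_zero_of_hasDerivAt_of_integrable hder (i1.add i4)
      (hΦ.integrable_inner hq)
    rw [integral_add i1 i4, integral_add i2 i3] at h0
    exact neg_eq_of_add_eq_zero_right h0

/-- The case k = 0 separates the variables; k = 1 makes the profile constant along the
characteristics εx + t = const. -/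
lemma isPlaneTest_mul {φ θ : ℝ → ℝ} (hφ : IsTest φ) (hθ : IsTest θ) (ε : ℤˣ) (k : ℝ) :
    IsPlaneTest fun z => φ (((ε : ℤ) : ℝ) * z.1 + k * z.2) * θ z.2 := by
  obtain ⟨R, hR⟩ := hφ.supp.isCompact.isBounded.subset_closedBall 0
  obtain ⟨S, hS⟩ := hθ.supp.isCompact.isBounded.subset_closedBall 0
  refine of_bound (R := max (R + |k| * |S|) S)
    ((hφ.smooth.comp (by fun_prop)).mul (hθ.smooth.comp (by fun_prop))) ?_
  intro x t hxt
  by_contra hne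
  obtain ⟨h1, h2⟩ := mul_ne_zero_iff.mp hne
  have a1 := hR (subset_tsupport _ h1)
  have a2 := hS (subset_tsupport _ h2)
  rw [mem_closedBall_zero_iff, Real.norm_eq_abs] at a1 a2
  have a3 : |x| ≤ R + |k| * |S| := by
    have b1 : |((ε : ℤ) : ℝ) * x| ≤ |((ε : ℤ) : ℝ) * x + k * t| + |k * t| := by
      have := abs_sub (((ε : ℤ) : ℝ) * x + k * t) (k * t)
      rwa [add_sub_cancel_right] at this
    rw [abs_mul, abs_units, one_mul, abs_mul] at b1
    have b2 : |k| * |t| ≤ |k| * |S| :=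
      mul_le_mul_of_nonneg_left (a2.trans (le_abs_self S)) (abs_nonneg k)
    simp only at a1
    linarith
  rcases hxt with h | h
  · exact absurd (h.trans_le a3) (not_lt.mpr (le_max_left _ _))
  · exact absurd (h.trans_le a2) (not_lt.mpr (le_max_right _ _))

/-- Solutions in the sense of distributions are solutions in the integrated form. -/
lemma IsSolution.isMild {m : ℝ} (hm : 0 < m) {F : ℂ → ℂ} (hF : Continuous F) {Ψ₀ : State}
    {Ψ : ℝ → State} (H : IsSolution m F Ψ₀ Ψ) :
    IsMild (massSource m Ψ) (fun t => F (H1.eval (Ψ t).psi 0)) Ψ := by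
  obtain ⟨⟨hp, hd, hq⟩, H1', H2', -⟩ := (isSolution_iff_inner hm).mp H
  have hh : Continuous (massSource m Ψ) := continuous_massSource hp
  have hf : Continuous fun t => F (H1.eval (Ψ t).psi 0) := hF.comp (H1.continuous_eval_zero hp hd)
  set f : ℝ → ℂ := fun t => F (H1.eval (Ψ t).psi 0)
  constructor
  · intro t
    refine L2.ext_of_test fun φ hφ => ?_
    rw [inner_add_right, inner_intervalIntegral _ hq]
    refine IsWeakDeriv.eq_primitive (f := fun t => ⟪toL2 φ, ((Ψ t).psi : L2)⟫_ℂ)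
      (g := fun t => ⟪toL2 φ, (Ψ t).mom⟫_ℂ) (continuous_const.inner hp) (continuous_const.inner hq)
      ?_ t
    intro θ hθ hc
    have hθ' : IsTest θ := ⟨hθ, hc⟩
    have hΦ := isPlaneTest_mul hφ hθ' 1 0
    have e1 : ∀ t, curve (fun z : ℝ × ℝ => φ ((((1 : ℤˣ) : ℤ) : ℝ) * z.1 + 0 * z.2) * θ z.2) t =
        (θ t : ℂ) • toL2 φ := by
      intro t
      rw [hφ.smul_toL2]
      simp [curve, mul_comm]
    have e2 : ∀ t, curve (timeDeriv
        (fun z : ℝ × ℝ => φ ((((1 : ℤˣ) : ℤ) : ℝ) * z.1 + 0 * z.2) * θ z.2)) t =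
        ((deriv θ t : ℝ) : ℂ) • toL2 φ := by
      intro t
      rw [hφ.smul_toL2]
      simp [curve, timeDeriv, mul_comm]
    have h := H1' _ hΦ
    simp only [e1, e2, inner_smul_left, Complex.conj_ofReal] at h
    simp only [Complex.real_smul]
    rw [← h, neg_neg]
  · intro ε
    set e : ℝ := ((ε : ℤ) : ℝ)
    set v : ℝ → L2 := fun t => (Ψ t).mom + ((ε : ℤ) : ℂ) • H1.deriv (Ψ t).psi
    have hv : Continuous v := hq.add (hd.const_smul ((ε : ℤ) : ℂ))
    refine ⟨hv, fun t => L2.ext_of_test fun φ hφ => ?_⟩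
    have hcv := continuous_move_comoving ε hv
    have hch := continuous_move_comoving ε hh
    have hφc : Continuous fun t => (φ t : ℂ) := Complex.continuous_ofReal.comp hφ.smooth.continuous
    have hφf : Continuous fun t => (φ t : ℂ) * f t := hφc.mul hf
    have e0 : e * e = 1 := units_mul_self ε
    have emove : ∀ t (g : L2), ⟪toL2 φ, move ε (-e * t) g⟫_ℂ = ⟪move ε t (toL2 φ), g⟫_ℂ := by
      intro t g
      rw [inner_move_right]
      congr 2
      rw [← mul_assoc, neg_mul_neg, e0, one_mul]
    -- The comoving pairing is continuous, as is its claimed derivative, so an identity tested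
    -- against θ(t) already gives the integrated equation at every t.
    have hmain := IsWeakDeriv.eq_primitive (f := fun t => ⟪toL2 φ, move ε (-e * t) (v t)⟫_ℂ)
      (g := fun t => ⟪toL2 φ, move ε (-e * t) (massSource m Ψ t)⟫_ℂ + (φ t : ℂ) * f t)
      (continuous_const.inner hcv) ((continuous_const.inner hch).add hφf) ?_ t
    · simp only [mul_zero] at hmain
      rw [hmain, intervalIntegral.integral_add ((continuous_const.inner hch).intervalIntegrable _ _)
        (hφf.intervalIntegrable _ _), inner_add_right, inner_add_right, inner_cut hf,
        inner_intervalIntegral _ hch, add_assoc]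
      congr 2
      refine intervalIntegral.integral_congr_ae ?_
      filter_upwards [hφ.coeFn_toL2] with x hx _
      rw [hx]
      simp [mul_comm]
    · intro θ hθ hc
      have hθ' : IsTest θ := ⟨hθ, hc⟩
      have hφt : ∀ t, IsTest fun x => φ (e * x + t) := fun t => hφ.comp_motion ε t
      have hφt' : ∀ t, IsTest fun x => deriv φ (e * x + t) := fun t => hφ.deriv.comp_motion ε t
      have hφt'' : ∀ t, IsTest fun x => deriv (deriv φ) (e * x + t) :=
        fun t => hφ.deriv.deriv.comp_motion ε t
      have hdx : ∀ {χ : ℝ → ℝ}, IsTest χ → ∀ t x, HasDerivAt (fun y => χ (e * y + 1 * t))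
          (e * deriv χ (e * x + t)) x := by
        intro χ hχ t x
        have := ((hχ.smooth.differentiable (by simp)) (e * x + t)).hasDerivAt.comp x
          (((hasDerivAt_id x).const_mul e).add_const t)
        rw [mul_one, mul_comm] at this
        simpa [Function.comp_def] using this
      have hdt : ∀ {χ : ℝ → ℝ}, IsTest χ → ∀ t x, HasDerivAt (fun s => χ (e * x + 1 * s) * θ s)
          (deriv χ (e * x + t) * θ t + χ (e * x + t) * deriv θ t) t := by
        intro χ hχ t x
        have := (((hχ.smooth.differentiable (by simp)) (e * x + t)).hasDerivAt.comp t
          ((hasDerivAt_id t).const_add (e * x))).fun_mul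
            ((hθ.differentiable (by simp)) t).hasDerivAt
        rw [mul_one] at this
        simpa [Function.comp_def] using this
      set N0 : ℝ → L2 := fun t => toL2 fun x => φ (e * x + t)
      set N1 : ℝ → L2 := fun t => toL2 fun x => deriv φ (e * x + t)
      set N2 : ℝ → L2 := fun t => toL2 fun x => deriv (deriv φ) (e * x + t)
      have hN0 : ∀ t, N0 t = move ε t (toL2 φ) := fun t => (hφ.move_toL2 ε t).symm
      have hN0c : Continuous N0 := by
        rw [show N0 = fun t => move ε t (toL2 φ) from funext hN0]
        exact continuous_move ε continuous_id continuous_const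
      have hN1c : Continuous N1 := by
        rw [show N1 = fun t => move ε t (toL2 (deriv φ)) from
          funext fun t => (hφ.deriv.move_toL2 ε t).symm]
        exact continuous_move ε continuous_id continuous_const
      have hN2c : Continuous N2 := by
        rw [show N2 = fun t => move ε t (toL2 (deriv (deriv φ))) from
          funext fun t => (hφ.deriv.deriv.move_toL2 ε t).symm]
        exact continuous_move ε continuous_id continuous_const
      have toL2_add : ∀ {α β : ℝ → ℝ}, IsTest α → IsTest β →
          toL2 (fun x => α x + β x) = toL2 α + toL2 β := by
        intro α β hα hβ
        refine toL2_eq_of_ae ⟨hα.smooth.add hβ.smooth, hα.supp.add hβ.supp⟩ ?_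
        filter_upwards [hα.coeFn_toL2, hβ.coeFn_toL2, Lp.coeFn_add (toL2 α) (toL2 β)] with x h1 h2 h3
        rw [h3, Pi.add_apply, h1, h2]
        simp
      -- Φ0 will test the equation for π, and Φ1, its x-derivative up to the factor ε, the equation
      -- for ψ. Together they test the Riemann invariant.
      set Φ0 : ℝ × ℝ → ℝ := fun z => φ (e * z.1 + 1 * z.2) * θ z.2
      set Φ1 : ℝ × ℝ → ℝ := fun z => deriv φ (e * z.1 + 1 * z.2) * θ z.2
      have hΦ0 : IsPlaneTest Φ0 := isPlaneTest_mul hφ hθ' ε 1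
      have hΦ1 : IsPlaneTest Φ1 := isPlaneTest_mul hφ.deriv hθ' ε 1
      have c0 : ∀ t, curve Φ0 t = (θ t : ℂ) • N0 t := by
        intro t
        rw [(hφt t).smul_toL2]
        simp [curve, Φ0, mul_comm]
      have c1 : ∀ t, curve Φ1 t = (θ t : ℂ) • N1 t := by
        intro t
        rw [(hφt' t).smul_toL2]
        simp [curve, Φ1, mul_comm]
      have d0 : ∀ t, curve (timeDeriv Φ0) t = (θ t : ℂ) • N1 t + ((deriv θ t : ℝ) : ℂ) • N0 t := by
        intro t
        rw [(hφt' t).smul_toL2, (hφt t).smul_toL2, ← toL2_add ((hφt' t).const_mul _)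
          ((hφt t).const_mul _)]
        simp only [curve]
        congr 1
        funext x
        rw [timeDeriv, (hdt hφ t x).deriv]
        ring
      have d1 : ∀ t, curve (timeDeriv Φ1) t = (θ t : ℂ) • N2 t + ((deriv θ t : ℝ) : ℂ) • N1 t := by
        intro t
        rw [(hφt'' t).smul_toL2, (hφt' t).smul_toL2, ← toL2_add ((hφt'' t).const_mul _)
          ((hφt' t).const_mul _)]
        simp only [curve]
        congr 1
        funext x
        rw [timeDeriv, (hdt hφ.deriv t x).deriv]
        ring
      have dxx : ∀ t, curve (spaceDeriv (spaceDeriv Φ0)) t = (θ t : ℂ) • N2 t := by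
        intro t
        rw [(hφt'' t).smul_toL2]
        simp only [curve]
        congr 1
        funext x
        have s1 : ∀ y, spaceDeriv Φ0 (y, t) = e * deriv φ (e * y + 1 * t) * θ t := by
          intro y
          rw [spaceDeriv]
          have := ((hdx hφ t y).mul_const (θ t)).deriv
          simp only [Φ0]
          rw [this, one_mul]
        rw [spaceDeriv]
        simp only [s1]
        rw [(((hdx hφ.deriv t x).const_mul e).mul_const (θ t)).deriv, ← mul_assoc, e0]
        ring
      have hN1p : ∀ t, ⟪N1 t, ((Ψ t).psi : L2)⟫_ℂ = -((e : ℂ) * ⟪N0 t, H1.deriv (Ψ t).psi⟫_ℂ) := by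
        intro t
        have h1 := isWeakDeriv_iff_inner.mp (H1.isWeakDeriv (Ψ t).psi) _ (hφt t)
        have h2 : deriv (fun x => φ (e * x + t)) = fun x => e * deriv φ (e * x + t) := by
          funext x
          simpa using (hdx hφ t x).deriv
        rw [h2, ← (hφt' t).smul_toL2, inner_smul_left, Complex.conj_ofReal] at h1
        have ec : (e : ℂ) * (e : ℂ) = 1 := by exact_mod_cast e0
        rw [← mul_neg, ← h1, ← mul_assoc, ec, one_mul]
      have A := H1' Φ1 hΦ1
      have B := H2' Φ0 hΦ0
      simp only [c0, c1, d0, d1, dxx, inner_add_left, inner_smul_left, Complex.conj_ofReal] at A B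
      have hi : ∀ {α : ℝ → ℝ} {w : ℝ → ℂ}, IsTest α → Continuous w →
          Integrable fun t => (α t : ℂ) * w t := by
        intro α w hα hw
        have h : Integrable fun t => α t • w t :=
          (hα.smooth.continuous.smul hw).integrable_of_hasCompactSupport hα.supp.smul_right
        simpa only [Complex.real_smul] using h
      have i1 := hi hθ' (hN2c.inner (𝕜 := ℂ) hp)
      have i2 := hi hθ'.deriv (hN1c.inner (𝕜 := ℂ) hp)
      have i3 := hi hθ' (hN1c.inner (𝕜 := ℂ) hq)
      have i4 := hi hθ'.deriv (hN0c.inner (𝕜 := ℂ) hq)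
      have i5 := hi hθ' (hN0c.inner (𝕜 := ℂ) hh)
      have i6 := hi hθ' hφf
      have e6 : ∀ t, Φ0 (0, t) • F (H1.eval (Ψ t).psi 0) = (θ t : ℂ) * ((φ t : ℂ) * f t) := by
        intro t
        simp only [Φ0, f, mul_zero, zero_add, one_mul, Complex.real_smul]
        push_cast
        ring
      simp only [e6] at B
      rw [integral_add i1 i2] at A
      rw [integral_add i3 i4, integral_add i1 i5] at B
      have L1 : ∫ t, deriv θ t • ⟪toL2 φ, move ε (-e * t) (v t)⟫_ℂ =
          (∫ t, ((deriv θ t : ℝ) : ℂ) * ⟪N0 t, (Ψ t).mom⟫_ℂ)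
            - ∫ t, ((deriv θ t : ℝ) : ℂ) * ⟪N1 t, ((Ψ t).psi : L2)⟫_ℂ := by
        rw [← integral_sub i4 i2]
        refine integral_congr_ae (Eventually.of_forall fun t => ?_)
        simp only
        rw [emove, ← hN0, hN1p]
        simp only [v, inner_add_right, inner_smul_right, Complex.real_smul, e]
        push_cast
        ring
      have L2' : ∫ t, θ t • (⟪toL2 φ, move ε (-e * t) (massSource m Ψ t)⟫_ℂ + (φ t : ℂ) * f t) =
          (∫ t, (θ t : ℂ) * ⟪N0 t, massSource m Ψ t⟫_ℂ) + ∫ t, (θ t : ℂ) * ((φ t : ℂ) * f t) := by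
        rw [← integral_add i5 i6]
        refine integral_congr_ae (Eventually.of_forall fun t => ?_)
        simp only
        rw [emove, ← hN0, Complex.real_smul, mul_add]
      rw [L1, L2']
      -- The subtraction removes both terms in which the derivatives fall only on φ, namely those
      -- with N2 against ψ and N1 against π; this is the factorization of the wave operator in weak
      -- form.
      linear_combination A - B

/-! ### Estimates in domains of dependence -/

/-- A family of sets that contains, with every point at time `t`, the backward (for `t < 0`,
forward) light cone of the point up to the time zero. -/
structure IsCausal (J : ℝ → Set ℝ) : Prop where
  measurableSet : ∀ t, MeasurableSet (J t)
  add_mem : ∀ {s t x r : ℝ}, s ∈ uIcc 0 t → x ∈ J t → |r| ≤ |t - s| → x + r ∈ J s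

lemma isCausal_univ : IsCausal fun _ => univ := ⟨fun _ => MeasurableSet.univ, fun _ _ _ => mem_univ _⟩

/-- Between 0 and t the absolute value is an additive clock, which lets past and future be treated
together. -/
lemma abs_sub_of_mem_uIcc {s t : ℝ} (h : s ∈ uIcc 0 t) : |t - s| = |t| - |s| := by
  rcases le_total 0 t with ht | ht
  · rw [uIcc_of_le ht] at h
    rw [abs_of_nonneg ht, abs_of_nonneg h.1, abs_of_nonneg (by linarith [h.2])]
  · rw [uIcc_of_ge ht] at h
    rw [abs_of_nonpos ht, abs_of_nonpos h.2, abs_of_nonpos (by linarith [h.1])]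
    ring

/-- Intervals whose ends close in at unit speed. These are the domains of dependence behind
continuity in 𝓔_F. -/
lemma isCausal_Ioo (r : ℝ) : IsCausal fun t => Ioo (-(r - |t|)) (r - |t|) := by
  refine ⟨fun t => measurableSet_Ioo, fun {s t x q} hs hx hq => ?_⟩
  rw [abs_sub_of_mem_uIcc hs] at hq
  have := abs_le.mp hq
  simp only [mem_Ioo] at hx ⊢
  constructor <;> linarith [this.1, this.2, hx.1, hx.2]

lemma IsCausal.subset {J : ℝ → Set ℝ} (hJ : IsCausal J) {s t : ℝ} (hs : s ∈ uIcc 0 t) :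
    J t ⊆ J s := by
  intro x hx
  simpa using hJ.add_mem (r := 0) hs hx (by simp)

lemma uIcc_subset_of_mem {s t : ℝ} (hs : s ∈ uIcc 0 t) : uIcc 0 s ⊆ uIcc 0 t :=
  uIcc_subset_uIcc left_mem_uIcc hs

/-- The gain of 1/l per time integration in an exponentially weighted norm, from which the smallness
in the contraction and Gronwall arguments comes. -/
lemma abs_integral_exp_abs_le {l : ℝ} (hl : 0 < l) (t : ℝ) :
    |∫ s in (0 : ℝ)..t, Real.exp (l * |s|)| ≤ Real.exp (l * |t|) / l := by
  have key : ∀ {a : ℝ}, a ≠ 0 → a * t = l * |t| → |a| = l →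
      |∫ s in (0 : ℝ)..t, Real.exp (a * s)| ≤ Real.exp (l * |t|) / l := by
    intro a ha h1 h2
    rw [integral_zero_exp_mul ha, abs_div, h2, h1]
    gcongr
    have : 1 ≤ Real.exp (l * |t|) := Real.one_le_exp (by positivity)
    rw [abs_of_nonneg (by linarith)]
    linarith
  rcases le_total 0 t with ht | ht
  · rw [intervalIntegral.integral_congr (g := fun s => Real.exp (l * s))]
    · exact key hl.ne' (by rw [abs_of_nonneg ht]) (abs_of_pos hl)
    · intro s hs
      rw [uIcc_of_le ht] at hs
      simp only
      rw [abs_of_nonneg hs.1]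
  · rw [intervalIntegral.integral_congr (g := fun s => Real.exp (-l * s))]
    · exact key (neg_ne_zero.mpr hl.ne') (by rw [abs_of_nonpos ht]; ring) (by rw [abs_neg, abs_of_pos hl])
    · intro s hs
      rw [uIcc_of_ge ht] at hs
      simp only
      rw [abs_of_nonpos hs.2, neg_mul_comm]

lemma setNorm_integral_le {J : Set ℝ} {k : ℝ → L2} (hk : Continuous k) {l D t : ℝ} (hl : 0 < l)
    (hD : 0 ≤ D) (h : ∀ s ∈ uIcc 0 t, setNorm J (k s) ≤ D * Real.exp (l * |s|)) :
    setNorm J (∫ s in (0 : ℝ)..t, k s) ≤ D * Real.exp (l * |t|) / l := by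
  rw [← norm_restr, ← (restr J).intervalIntegral_comp_comm (hk.intervalIntegrable _ _)]
  have hg : IntervalIntegrable (fun s => D * Real.exp (l * |s|)) volume 0 t :=
    (by fun_prop : Continuous fun s : ℝ => D * Real.exp (l * |s|)).intervalIntegrable _ _
  refine (intervalIntegral.norm_integral_le_abs_of_norm_le ?_ hg).trans ?_
  · refine (ae_restrict_iff' measurableSet_uIoc).mpr (Eventually.of_forall fun s hs => ?_)
    rw [norm_restr]
    exact h s (uIoc_subset_uIcc hs)
  · rw [intervalIntegral.integral_const_mul, abs_mul, abs_of_nonneg hD, mul_div_assoc]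
    exact mul_le_mul_of_nonneg_left (abs_integral_exp_abs_le hl t) hD

/-- The square of the norm is a time integral, so the point source gains only the square root of
1/l. -/
lemma norm_cut_le {f : ℝ → ℂ} (hf : Continuous f) {l D t : ℝ} (hl : 0 < l) (hD : 0 ≤ D)
    (h : ∀ s ∈ uIcc 0 t, ‖f s‖ ≤ D * Real.exp (l * |s|)) :
    ‖cut f 0 t‖ ≤ D * Real.exp (l * |t|) / √l := by
  refine le_of_sq_le_sq (b := D * Real.exp (l * |t|) / √l) ?_ (by positivity)
  rw [norm_cut_sq hf, ← Real.norm_eq_abs]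
  have hg : IntervalIntegrable (fun s => D ^ 2 * Real.exp ((2 * l) * |s|)) volume 0 t :=
    (by fun_prop : Continuous fun s : ℝ => D ^ 2 * Real.exp ((2 * l) * |s|)).intervalIntegrable _ _
  have e2 : ∀ s : ℝ, Real.exp ((2 * l) * |s|) = Real.exp (l * |s|) ^ 2 := by
    intro s
    rw [← Real.exp_nat_mul]
    congr 1
    push_cast
    ring
  refine (intervalIntegral.norm_integral_le_abs_of_norm_le ?_ hg).trans ?_
  · refine (ae_restrict_iff' measurableSet_uIoc).mpr (Eventually.of_forall fun s hs => ?_)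
    rw [Real.norm_eq_abs, abs_of_nonneg (by positivity), e2, ← mul_pow]
    exact pow_le_pow_left₀ (norm_nonneg _) (h s (uIoc_subset_uIcc hs)) 2
  · rw [intervalIntegral.integral_const_mul, abs_mul, abs_of_nonneg (sq_nonneg D), div_pow,
      Real.sq_sqrt hl.le, mul_pow, mul_div_assoc]
    refine mul_le_mul_of_nonneg_left ((abs_integral_exp_abs_le (by linarith) t).trans ?_)
      (sq_nonneg D)
    rw [e2]
    gcongr
    linarith

section Transport

variable {ε : ℤˣ} {h : ℝ → L2} {f : ℝ → ℂ} {v : ℝ → L2}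

/-- Duhamel's formula, obtained by moving back from the comoving frame. Two reflections cancel, so
the initial value and h are only translated. -/
lemma IsTransport.eq_add (hv : IsTransport ε h f v) (hh : Continuous h) (t : ℝ) :
    v t = move 1 (((ε : ℤ) : ℝ) * t) (v 0)
      + (∫ s in (0 : ℝ)..t, move 1 (((ε : ℤ) : ℝ) * (t - s)) (h s)) + move ε t (cut f 0 t) := by
  have h1 := congrArg (move ε t) (hv.eq t)
  rw [map_add, map_add, move_move, move_move, Int.units_mul_self, add_zero] at h1
  rw [show ((ε : ℤ) : ℝ) * t + -((ε : ℤ) : ℝ) * t = 0 by ring, move_one_zero] at h1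
  rw [h1]
  congr 2
  rw [← LinearIsometry.coe_toContinuousLinearMap,
    ← (move ε t).toContinuousLinearMap.intervalIntegral_comp_comm
      ((continuous_move_comoving ε hh).intervalIntegrable _ _)]
  refine intervalIntegral.integral_congr fun s _ => ?_
  simp only [LinearIsometry.coe_toContinuousLinearMap]
  rw [move_move, Int.units_mul_self]
  congr 2
  ring

/-- Each translated term sees only data in the cone, while the point source is bounded by its full
norm. As l ≥ 1, the weaker gain 1/√l covers both sources, hence the factor 2. -/
lemma IsTransport.setNorm_le (hv : IsTransport ε h f v) (hh : Continuous h) (hf : Continuous f)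
    {J : ℝ → Set ℝ} (hJ : IsCausal J) {l D t : ℝ} (hl : 1 ≤ l) (hD : 0 ≤ D)
    (h1 : ∀ s ∈ uIcc 0 t, setNorm (J s) (h s) ≤ D * Real.exp (l * |s|))
    (h2 : ∀ s ∈ uIcc 0 t, ‖f s‖ ≤ D * Real.exp (l * |s|)) :
    setNorm (J t) (v t) ≤ setNorm (J 0) (v 0) + 2 * (D / √l) * Real.exp (l * |t|) := by
  have hl0 : 0 < l := by linarith
  have hmem : ∀ s ∈ uIcc 0 t, ∀ x ∈ J t,
      (((1 : ℤˣ) : ℤ) : ℝ) * x + ((ε : ℤ) : ℝ) * (t - s) ∈ J s := by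
    intro s hs x hx
    rw [Units.val_one, Int.cast_one, one_mul]
    refine hJ.add_mem hs hx ?_
    rw [abs_mul, abs_units, one_mul]
  rw [hv.eq_add hh t]
  refine (setNorm_add_le _ _ _).trans ((add_le_add_left (setNorm_add_le _ _ _) _).trans ?_)
  have a1 : setNorm (J t) (move 1 (((ε : ℤ) : ℝ) * t) (v 0)) ≤ setNorm (J 0) (v 0) :=
    setNorm_move_le (hJ.measurableSet 0)
      (fun x hx => by simpa using hmem 0 left_mem_uIcc x hx) _
  have a2 := setNorm_integral_le (J := J t) (t := t) (D := D) (l := l)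
    (k := fun s => move 1 (((ε : ℤ) : ℝ) * (t - s)) (h s))
    (continuous_move 1 (by fun_prop) hh) hl0 hD
    (fun s hs => (setNorm_move_le (hJ.measurableSet s) (hmem s hs) _).trans (h1 s hs))
  have a3 : setNorm (J t) (move ε t (cut f 0 t)) ≤ D * Real.exp (l * |t|) / √l :=
    (setNorm_le_norm _ _).trans (((move ε t).norm_map _).le.trans (norm_cut_le hf hl0 hD h2))
  have a4 : D * Real.exp (l * |t|) / l ≤ D * Real.exp (l * |t|) / √l := by
    gcongr
    exact Real.sqrt_le_iff.mpr ⟨hl0.le, by nlinarith⟩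
  have e : 2 * (D / √l) * Real.exp (l * |t|) =
      D * Real.exp (l * |t|) / √l + D * Real.exp (l * |t|) / √l := by ring
  rw [e]
  linarith

end Transport

namespace IsMild

variable {h k : ℝ → L2} {f g : ℝ → ℂ} {Ψ Φ : ℝ → State}

lemma sub (H : IsMild h f Ψ) (H' : IsMild k g Φ) (hh : Continuous h) (hk : Continuous k)
    (hf : Continuous f) (hg : Continuous g) :
    IsMild (fun t => h t - k t) (fun t => f t - g t) (fun t => Ψ t - Φ t) := by
  constructor
  · intro t
    simp only [State.psi_sub, State.mom_sub, Submodule.coe_sub]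
    rw [intervalIntegral.integral_sub (H.continuous_mom.intervalIntegrable _ _)
      (H'.continuous_mom.intervalIntegrable _ _), H.psi_eq t, H'.psi_eq t]
    abel
  · intro ε
    have e : ∀ t, (Ψ t - Φ t).mom + ((ε : ℤ) : ℂ) • H1.deriv (Ψ t - Φ t).psi =
        ((Ψ t).mom + ((ε : ℤ) : ℂ) • H1.deriv (Ψ t).psi)
          - ((Φ t).mom + ((ε : ℤ) : ℂ) • H1.deriv (Φ t).psi) := by
      intro t
      rw [State.mom_sub, State.psi_sub, H1.deriv_sub, smul_sub]
      abel
    simp only [e]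
    refine ⟨(H.transport ε).continuous.sub (H'.transport ε).continuous, fun t => ?_⟩
    simp only [map_sub]
    rw [intervalIntegral.integral_sub ((continuous_move_comoving ε hh).intervalIntegrable _ _)
      ((continuous_move_comoving ε hk).intervalIntegrable _ _), cut_sub hf hg,
      (H.transport ε).eq t, (H'.transport ε).eq t]
    abel

/-- The estimate of the solution in terms of the sources. -/
lemma sumNorm_le (H : IsMild h f Ψ) (hh : Continuous h) (hf : Continuous f)
    {J : ℝ → Set ℝ} (hJ : IsCausal J) {l D t : ℝ} (hl : 1 ≤ l) (hD : 0 ≤ D)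
    (h1 : ∀ s ∈ uIcc 0 t, setNorm (J s) (h s) ≤ D * Real.exp (l * |s|))
    (h2 : ∀ s ∈ uIcc 0 t, ‖f s‖ ≤ D * Real.exp (l * |s|)) :
    (Ψ t).sumNorm (J t) ≤ (4 * (Ψ 0).sumNorm (J 0) + 6 * (D / √l)) * Real.exp (l * |t|) := by
  have hl0 : 0 < l := by linarith
  set a := (Ψ 0).sumNorm (J 0) with ha
  set b := 2 * (D / √l)
  have ha0 : 0 ≤ a := State.sumNorm_nonneg _ _
  have hb0 : 0 ≤ b := by positivity
  have hexp : ∀ s, 1 ≤ Real.exp (l * |s|) := fun s => Real.one_le_exp (by positivity)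
  have hv0 : ∀ ε : ℤˣ, setNorm (J 0) ((Ψ 0).mom + ((ε : ℤ) : ℂ) • H1.deriv (Ψ 0).psi) ≤ a := by
    intro ε
    refine (setNorm_add_le _ _ _).trans ?_
    rw [setNorm_smul, norm_units, one_mul, ha, State.sumNorm]
    exact le_add_of_nonneg_right (setNorm_nonneg _ _)
  have hv : ∀ ε : ℤˣ, ∀ s ∈ uIcc 0 t, setNorm (J s) ((Ψ s).mom + ((ε : ℤ) : ℂ) • H1.deriv (Ψ s).psi)
      ≤ (a + b) * Real.exp (l * |s|) := by
    intro ε s hs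
    have := (H.transport ε).setNorm_le hh hf hJ hl hD
      (fun r hr => h1 r (uIcc_subset_of_mem hs hr)) (fun r hr => h2 r (uIcc_subset_of_mem hs hr))
    refine this.trans ?_
    have := mul_le_mul_of_nonneg_left (hexp s) ha0
    linarith [hv0 ε]
  have hhalf : ‖(1 / 2 : ℂ)‖ = 1 / 2 := by simp
  have hq : ∀ s ∈ uIcc 0 t, setNorm (J s) (Ψ s).mom ≤ (a + b) * Real.exp (l * |s|) := by
    intro s hs
    rw [mom_eq, setNorm_smul, hhalf]
    linarith [setNorm_add_le (J s) ((Ψ s).mom + (((1 : ℤˣ) : ℤ) : ℂ) • H1.deriv (Ψ s).psi)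
      ((Ψ s).mom + (((-1 : ℤˣ) : ℤ) : ℂ) • H1.deriv (Ψ s).psi), hv 1 s hs, hv (-1) s hs]
  have hd : setNorm (J t) (H1.deriv (Ψ t).psi) ≤ (a + b) * Real.exp (l * |t|) := by
    rw [deriv_eq, setNorm_smul, hhalf]
    linarith [setNorm_sub_le (J t) ((Ψ t).mom + (((1 : ℤˣ) : ℤ) : ℂ) • H1.deriv (Ψ t).psi)
      ((Ψ t).mom + (((-1 : ℤˣ) : ℤ) : ℂ) • H1.deriv (Ψ t).psi), hv 1 t right_mem_uIcc,
      hv (-1) t right_mem_uIcc]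
  have hp : setNorm (J t) ((Ψ t).psi : L2) ≤ a + (a + b) * Real.exp (l * |t|) := by
    rw [H.psi_eq t]
    refine (setNorm_add_le _ _ _).trans (add_le_add ?_ ?_)
    · refine (setNorm_mono (hJ.subset left_mem_uIcc) _).trans ?_
      rw [ha, State.sumNorm]
      exact le_add_of_nonneg_left (add_nonneg (setNorm_nonneg _ _) (setNorm_nonneg _ _))
    · refine (setNorm_integral_le H.continuous_mom hl0 (by positivity)
        fun s hs => (setNorm_mono (hJ.subset hs) _).trans (hq s hs)).trans ?_
      exact div_le_self (by positivity) hl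
  have := mul_le_mul_of_nonneg_left (hexp t) ha0
  -- Each of the three components costs a + b with b = 2D/√l, and ψ costs one further a for its
  -- initial value.
  have e : (4 * a + 6 * (D / √l)) * Real.exp (l * |t|) =
      a * Real.exp (l * |t|) + 3 * ((a + b) * Real.exp (l * |t|)) := by
    simp only [b]; ring
  rw [e, State.sumNorm]
  linarith [hq t right_mem_uIcc]

lemma continuous_sumNorm (H : IsMild h f Ψ) : Continuous fun t => (Ψ t).sumNorm univ := by
  simp only [State.sumNorm, ← norm_eq_setNorm_univ]
  exact (H.continuous_mom.norm.add H.continuous_deriv.norm).add H.continuous_psi.norm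

end IsMild

lemma State.sumNorm_mono {J K : Set ℝ} (h : J ⊆ K) (Ψ : State) : Ψ.sumNorm J ≤ Ψ.sumNorm K :=
  add_le_add (add_le_add (setNorm_mono h _) (setNorm_mono h _)) (setNorm_mono h _)

lemma setNorm_psi_le_sumNorm (J : Set ℝ) (Ψ : State) : setNorm J (Ψ.psi : L2) ≤ Ψ.sumNorm J :=
  le_add_of_nonneg_left (add_nonneg (setNorm_nonneg _ _) (setNorm_nonneg _ _))

lemma norm_eval_le_sumNorm {J : Set ℝ} (hJ : Ioo 0 1 ⊆ J) (Ψ : State) :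
    ‖H1.eval Ψ.psi 0‖ ≤ Ψ.sumNorm J := by
  refine (H1.norm_eval_zero_le hJ _).trans ?_
  rw [State.sumNorm]
  linarith [setNorm_nonneg J Ψ.mom]

lemma setNorm_massSource (m : ℝ) (J : Set ℝ) (Ψ : ℝ → State) (t : ℝ) :
    setNorm J (massSource m Ψ t) = m ^ 2 * setNorm J ((Ψ t).psi : L2) := by
  rw [massSource, setNorm_smul, norm_neg, norm_pow, Complex.norm_real, Real.norm_eq_abs, sq_abs]

lemma massSource_sub (m : ℝ) (Ψ Φ : ℝ → State) (t : ℝ) :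
    massSource m Ψ t - massSource m Φ t = massSource m (fun t => Ψ t - Φ t) t := by
  simp only [massSource, State.psi_sub, Submodule.coe_sub, smul_sub]

/-- The Gronwall inequality for the Klein-Gordon equation. -/
lemma IsMild.sumNorm_le_exp {m : ℝ} {f : ℝ → ℂ} {Ψ : ℝ → State}
    (H : IsMild (massSource m Ψ) f Ψ) (hf : Continuous f) {J : ℝ → Set ℝ} (hJ : IsCausal J)
    {K t : ℝ} (hK : 1 ≤ K) (hmK : m ^ 2 ≤ K)
    (hfK : ∀ s ∈ uIcc 0 t, ‖f s‖ ≤ K * (Ψ s).sumNorm (J s)) :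
    (Ψ t).sumNorm (J t) ≤ 8 * Real.exp ((12 * K) ^ 2 * |t|) * (Ψ 0).sumNorm (J 0) := by
  -- Chosen so that 6K/√l = 1/2: the sources are then absorbed into the left-hand side.
  set l := (12 * K) ^ 2 with hl
  have hl1 : 1 ≤ l := by nlinarith
  have hsl : √l = 12 * K := Real.sqrt_sq (by linarith)
  set a := (Ψ 0).sumNorm (J 0)
  -- Working with a supremum avoids any continuity of the norm over the moving sets J s; boundedness
  -- comes from the continuous norm over the whole line.
  set S := (fun s => (Ψ s).sumNorm (J s) * Real.exp (-(l * |s|))) '' uIcc 0 t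
  have hne : S.Nonempty := ⟨_, mem_image_of_mem _ left_mem_uIcc⟩
  have hbdd : BddAbove S := by
    obtain ⟨M, hM⟩ := (isCompact_uIcc (a := (0 : ℝ)) (b := t)).bddAbove_image
      H.continuous_sumNorm.continuousOn
    refine ⟨M, ?_⟩
    rintro _ ⟨s, hs, rfl⟩
    refine le_trans ?_ (hM (mem_image_of_mem _ hs))
    refine (mul_le_of_le_one_right (State.sumNorm_nonneg _ _) ?_).trans
      (State.sumNorm_mono (subset_univ _) _)
    rw [Real.exp_le_one_iff, neg_nonpos]
    positivity
  have hS : ∀ s ∈ uIcc 0 t, (Ψ s).sumNorm (J s) ≤ sSup S * Real.exp (l * |s|) := by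
    intro s hs
    have := le_csSup hbdd (mem_image_of_mem _ hs)
    rwa [Real.exp_neg, ← div_eq_mul_inv, div_le_iff₀ (Real.exp_pos _)] at this
  have hS0 : 0 ≤ sSup S := by
    have := (State.sumNorm_nonneg _ _).trans (hS 0 left_mem_uIcc)
    exact nonneg_of_mul_nonneg_left this (Real.exp_pos _)
  have hle : sSup S ≤ 4 * a + sSup S / 2 := by
    refine csSup_le hne ?_
    rintro _ ⟨s, hs, rfl⟩
    simp only
    rw [Real.exp_neg, ← div_eq_mul_inv, div_le_iff₀ (Real.exp_pos _)]
    have key : ∀ r ∈ uIcc 0 s, K * (Ψ r).sumNorm (J r) ≤ (K * sSup S) * Real.exp (l * |r|) := by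
      intro r hr
      rw [mul_assoc]
      exact mul_le_mul_of_nonneg_left (hS r (uIcc_subset_of_mem hs hr)) (by linarith)
    refine (H.sumNorm_le (D := K * sSup S) (l := l) (continuous_massSource H.continuous_psi) hf hJ
      hl1 (by positivity) (fun r hr => ?_) (fun r hr => ?_)).trans_eq ?_
    · rw [setNorm_massSource]
      refine le_trans ?_ (key r hr)
      exact mul_le_mul hmK (setNorm_psi_le_sumNorm _ _) (setNorm_nonneg _ _) (by linarith)
    · exact (hfK r (uIcc_subset_of_mem hs hr)).trans (key r hr)
    · rw [hsl]
      have : K ≠ 0 := by linarith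
      field_simp
      ring
  refine (hS t right_mem_uIcc).trans ?_
  rw [mul_right_comm]
  exact mul_le_mul_of_nonneg_right (by linarith) (Real.exp_pos _).le

/-! ### Existence for a globally Lipschitz nonlinearity -/

/-- Existence for a globally Lipschitz nonlinearity, by contraction in a weighted space of
curves `t ↦ (ψ(t), ψ(0,t))`. -/
lemma exists_isMild_of_lipschitz (m : ℝ) {G : ℂ → ℂ} {κ : NNReal} (hG : LipschitzWith κ G)
    (Ψ₀ : State) : ∃ Ψ : ℝ → State,
      IsMild (massSource m Ψ) (fun t => G (H1.eval (Ψ t).psi 0)) Ψ ∧ Ψ 0 = Ψ₀ := by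
  set K : ℝ := max 1 (max (m ^ 2) κ)
  have hK1 : 1 ≤ K := le_max_left _ _
  have hKm : m ^ 2 ≤ K := (le_max_left _ _).trans (le_max_right _ _)
  have hKκ : (κ : ℝ) ≤ K := (le_max_right _ _).trans (le_max_right _ _)
  set l : ℝ := (12 * K) ^ 2
  have hl1 : 1 ≤ l := by nlinarith
  have hsl : √l = 12 * K := Real.sqrt_sq (by linarith)
  -- Only ψ and its trace are recorded, since the sources depend on nothing else. A curve in X is
  -- the unknown divided by ρ, and the trace is an independent coordinate until the fixed point is
  -- reached.
  set X := BoundedContinuousFunction ℝ (L2 × ℂ)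
  set ρ : ℝ → ℝ := fun t => Real.exp (l * |t|)
  have hρ : Continuous ρ := by fun_prop
  have hρ0 : ∀ t, 0 < ρ t := fun t => Real.exp_pos _
  have hρ1 : ∀ t, 1 ≤ ρ t := fun t => Real.one_le_exp (by positivity)
  set h : X → ℝ → L2 := fun w t => (-(m : ℂ) ^ 2) • (ρ t • (w t).1)
  set f : X → ℝ → ℂ := fun w t => G (ρ t • (w t).2)
  have hh : ∀ w, Continuous (h w) := fun w =>
    (hρ.smul (continuous_fst.comp w.continuous)).const_smul (-(m : ℂ) ^ 2)
  have hf : ∀ w, Continuous (f w) := fun w =>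
    hG.continuous.comp (hρ.smul (continuous_snd.comp w.continuous))
  have hnm : ‖(-(m : ℂ) ^ 2)‖ = m ^ 2 := by
    rw [norm_neg, norm_pow, Complex.norm_real, Real.norm_eq_abs, sq_abs]
  have hdh : ∀ w w' t, ‖h w t - h w' t‖ ≤ K * dist w w' * ρ t := by
    intro w w' t
    simp only [h]
    rw [← smul_sub, ← smul_sub, norm_smul, norm_smul, hnm, Real.norm_eq_abs, abs_of_pos (hρ0 t)]
    have h1 : ‖(w t).1 - (w' t).1‖ ≤ dist w w' := by
      rw [← dist_eq_norm]
      exact (le_max_left _ _).trans (w.dist_coe_le_dist t)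
    calc m ^ 2 * (ρ t * ‖(w t).1 - (w' t).1‖) ≤ K * (ρ t * dist w w') := by
          gcongr
      _ = K * dist w w' * ρ t := by ring
  have hdf : ∀ w w' t, ‖f w t - f w' t‖ ≤ K * dist w w' * ρ t := by
    intro w w' t
    simp only [f]
    have h1 : ‖(w t).2 - (w' t).2‖ ≤ dist w w' := by
      rw [← dist_eq_norm]
      exact (le_max_right _ _).trans (w.dist_coe_le_dist t)
    have h2 := hG.dist_le_mul (ρ t • (w t).2) (ρ t • (w' t).2)
    rw [dist_eq_norm, dist_eq_norm, ← smul_sub, norm_smul, Real.norm_eq_abs, abs_of_pos (hρ0 t)] at h2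
    calc _ ≤ (κ : ℝ) * (ρ t * ‖(w t).2 - (w' t).2‖) := h2
      _ ≤ K * (ρ t * dist w w') := by
          gcongr
      _ = K * dist w w' * ρ t := by ring
  choose S hS hS0 using fun w => exists_isMild Ψ₀ (hh w) (hf w)
  have hnormle : ∀ (Ψ : State) (t c : ℝ), Ψ.sumNorm univ ≤ c * ρ t →
      ‖(ρ t)⁻¹ • (((Ψ.psi : L2), H1.eval Ψ.psi 0) : L2 × ℂ)‖ ≤ c := by
    intro Ψ t c hc
    rw [norm_smul, norm_inv, Real.norm_eq_abs, abs_of_pos (hρ0 t), inv_mul_le_iff₀ (hρ0 t), mul_comm]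
    refine max_le ?_ ((norm_eval_le_sumNorm (subset_univ _) Ψ).trans hc)
    rw [norm_eq_setNorm_univ]
    exact (setNorm_psi_le_sumNorm univ Ψ).trans hc
  -- At w = 0 the sources are 0 and the constant G 0, so the Lipschitz bounds give linear growth and
  -- the new curve is bounded after division by ρ.
  have hbound : ∀ w t, ((S w) t).sumNorm univ ≤
      (4 * Ψ₀.sumNorm univ + 6 * ((K * ‖w‖ + ‖G 0‖) / √l)) * ρ t := by
    intro w t
    rw [← hS0 w]
    have e0 : ∀ s, (0 : X) s = 0 := fun s => rfl
    have e1 : ∀ s, h 0 s = 0 := fun s => by simp only [h, e0, Prod.fst_zero, smul_zero]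
    have e2 : ∀ s, f 0 s = G 0 := fun s => by simp only [f, e0, Prod.snd_zero, smul_zero]
    refine (hS w).sumNorm_le (hh w) (hf w) isCausal_univ hl1 (by positivity)
      (fun s _ => ?_) (fun s _ => ?_)
    · rw [← norm_eq_setNorm_univ]
      have := hdh w 0 s
      rw [e1, sub_zero, dist_zero_right] at this
      refine this.trans (mul_le_mul_of_nonneg_right ?_ (hρ0 s).le)
      exact le_add_of_nonneg_right (norm_nonneg _)
    · have := hdf w 0 s
      rw [e2, dist_zero_right] at this
      have h3 : ‖f w s‖ ≤ ‖f w s - G 0‖ + ‖G 0‖ := by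
        simpa using norm_add_le (f w s - G 0) (G 0)
      have h4 := mul_le_mul_of_nonneg_left (hρ1 s) (norm_nonneg (G 0))
      rw [add_mul]
      linarith
  set T : X → X := fun w => BoundedContinuousFunction.ofNormedAddCommGroup
    (fun t => (ρ t)⁻¹ • ((((S w t).psi : L2), H1.eval (S w t).psi 0) : L2 × ℂ))
    ((hρ.inv₀ fun t => (hρ0 t).ne').smul ((hS w).continuous_psi.prodMk (hS w).continuous_eval)) _
    (fun t => hnormle (S w t) t _ (hbound w t))
  have hT : ∀ w t, T w t = (ρ t)⁻¹ • ((((S w t).psi : L2), H1.eval (S w t).psi 0) : L2 × ℂ) :=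
    fun w t => rfl
  have hcontr : ContractingWith (1 / 2) T := by
    refine ⟨by rw [← NNReal.coe_lt_coe]; norm_num, LipschitzWith.of_dist_le_mul fun w w' => ?_⟩
    rw [BoundedContinuousFunction.dist_le (by positivity)]
    intro t
    rw [hT, hT, dist_eq_norm, ← smul_sub, Prod.mk_sub_mk, ← Submodule.coe_sub, ← H1.eval_sub,
      ← State.psi_sub]
    refine hnormle _ t _ ?_
    -- The difference starts from zero, so only the source term 6K dist/√l = dist/2 remains.
    have h5 := ((hS w).sub (hS w') (hh w) (hh w') (hf w) (hf w')).sumNorm_le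
      (D := K * dist w w') (t := t) ((hh w).sub (hh w')) ((hf w).sub (hf w')) isCausal_univ hl1
      (by positivity) (fun s _ => by rw [← norm_eq_setNorm_univ]; exact hdh w w' s)
      (fun s _ => hdf w w' s)
    refine h5.trans_eq ?_
    have h6 : (S w 0 - S w' 0).sumNorm univ = 0 := by
      rw [hS0, hS0, sub_self, State.sumNorm]
      have e1 : (0 : State).mom = 0 := rfl
      have e2 : (0 : State).psi = 0 := rfl
      have e3 : H1.deriv (0 : H1) = 0 := by simpa using H1.deriv_smul 0 0
      rw [e1, e2, e3, ← norm_eq_setNorm_univ, ← norm_eq_setNorm_univ]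
      simp
    rw [h6, hsl]
    have : K ≠ 0 := by linarith
    push_cast
    field_simp
    ring
  have hfix := hcontr.fixedPoint_isFixedPt
  set w := ContractingWith.fixedPoint T hcontr
  have hw : ∀ t, ρ t • w t = (((S w t).psi : L2), H1.eval (S w t).psi 0) := by
    intro t
    have h7 : w t = T w t := by rw [hfix]
    rw [h7, hT, smul_smul, mul_inv_cancel₀ (hρ0 t).ne', one_smul]
  refine ⟨S w, ?_, hS0 w⟩
  have e1 : massSource m (S w) = h w := by
    funext t
    have := congrArg Prod.fst (hw t)
    simp only [Prod.smul_fst] at this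
    simp only [massSource, h, this]
  have e2 : (fun t => G (H1.eval (S w t).psi 0)) = f w := by
    funext t
    have := congrArg Prod.snd (hw t)
    simp only [Prod.smul_snd] at this
    simp only [f, this]
  rw [e1, e2]
  exact hS w

/-! ### Conservation of energy -/

lemma continuous_sub_shift {e : ℝ → ℝ → ℝ} (he : Continuous (Function.uncurry e)) (h : ℝ) :
    Continuous fun t => e h t - e h (t - h) :=
  (he.comp (by fun_prop : Continuous fun t : ℝ => (h, t))).sub
    (he.comp (by fun_prop : Continuous fun t : ℝ => (h, t - h)))

/-- The limit of the difference quotients of integrals with a parameter. -/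
lemma tendsto_integral_sub_shift {e : ℝ → ℝ → ℝ} (he : Continuous (Function.uncurry e)) (a b : ℝ) :
    Tendsto (fun h => h⁻¹ * ∫ t in a..b, (e h t - e h (t - h))) (𝓝[≠] 0)
      (𝓝 (e 0 b - e 0 a)) := by
  have hc : ∀ h, Continuous (e h) := fun h =>
    he.comp (continuous_const.prodMk continuous_id : Continuous fun t : ℝ => (h, t))
  -- For h ≠ 0 this is the mean of e h over [c - h, c]. After rescaling to [0,1] it is continuous in
  -- h, including h = 0.
  have key : ∀ c, Tendsto (fun h => ∫ s in (0 : ℝ)..1, e h (c - h + h * s)) (𝓝 0) (𝓝 (e 0 c)) := by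
    intro c
    have h1 : Continuous fun h => ∫ s in (0 : ℝ)..1, e h (c - h + h * s) :=
      intervalIntegral.continuous_parametric_intervalIntegral_of_continuous'
        (f := fun h s => e h (c - h + h * s))
        (he.comp (by fun_prop : Continuous fun z : ℝ × ℝ => (z.1, c - z.1 + z.1 * z.2))) 0 1
    have h2 := h1.tendsto 0
    simpa using h2
  refine Tendsto.congr' ?_ (((key b).sub (key a)).mono_left nhdsWithin_le_nhds)
  filter_upwards [self_mem_nhdsWithin] with h hh
  have hi : ∀ x y, IntervalIntegrable (e h) volume x y := fun x y => (hc h).intervalIntegrable x y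
  have hi' : IntervalIntegrable (fun t => e h (t - h)) volume a b :=
    ((hc h).comp (continuous_id.sub continuous_const)).intervalIntegrable _ _
  have h3 : ∀ c, ∫ s in (0 : ℝ)..1, e h (c - h + h * s) = h⁻¹ * ∫ s in (c - h)..c, e h s := by
    intro c
    have := intervalIntegral.mul_integral_comp_add_mul (a := 0) (b := 1) (f := e h) h (c - h)
    rw [mul_zero, add_zero, mul_one, sub_add_cancel] at this
    rw [← this, inv_mul_cancel_left₀ hh]
  rw [h3, h3, ← mul_sub, intervalIntegral.integral_sub (hi _ _) hi',
    intervalIntegral.integral_comp_sub_right,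
    intervalIntegral.integral_interval_sub_interval_comm (hi _ _) (hi _ _) (hi _ _)]
  congr 1
  rw [intervalIntegral.integral_symm (a - h) (b - h), intervalIntegral.integral_symm a b]
  ring

/-- Twice the energy of the free field. -/
def freeEnergy (m : ℝ) (Ψ : State) : ℝ :=
  ‖Ψ.mom‖ ^ 2 + ‖H1.deriv Ψ.psi‖ ^ 2 + m ^ 2 * ‖(Ψ.psi : L2)‖ ^ 2

lemma hamiltonian_eq (m : ℝ) (U : ℂ → ℝ) (Ψ : State) :
    hamiltonian m U Ψ = 1 / 2 * freeEnergy m Ψ + U (H1.eval Ψ.psi 0) := by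
  have i1 := L2.integrable_norm_sq Ψ.mom
  have i2 := L2.integrable_norm_sq (H1.deriv Ψ.psi)
  have i3 := (L2.integrable_norm_sq (Ψ.psi : L2)).const_mul (m ^ 2)
  have i4 : Integrable (fun x => ‖Ψ.mom x‖ ^ 2 + ‖H1.deriv Ψ.psi x‖ ^ 2) := i1.add i2
  rw [hamiltonian, freeEnergy, integral_add i4 i3, integral_add i1 i2, integral_const_mul,
    ← L2.norm_sq_eq_integral, ← L2.norm_sq_eq_integral, ← L2.norm_sq_eq_integral]

section Energy

variable {m : ℝ} {f : ℝ → ℂ} {Ψ : ℝ → State}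

/-- The polarized density of the action. -/
def actionForm (m : ℝ) (Ψ : ℝ → State) (s t : ℝ) : ℝ :=
  (⟪H1.deriv (Ψ s).psi, H1.deriv (Ψ t).psi⟫_ℂ).re
    + m ^ 2 * (⟪((Ψ s).psi : L2), ((Ψ t).psi : L2)⟫_ℂ).re - (⟪(Ψ s).mom, (Ψ t).mom⟫_ℂ).re

lemma actionForm_comm (m : ℝ) (Ψ : ℝ → State) (s t : ℝ) :
    actionForm m Ψ s t = actionForm m Ψ t s := by
  have c : ∀ g k : L2, (⟪g, k⟫_ℂ).re = (⟪k, g⟫_ℂ).re := fun g k => inner_re_symm (𝕜 := ℂ) g k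
  rw [actionForm, actionForm, c (H1.deriv _), c ((Ψ s).psi : L2), c (Ψ s).mom]

lemma re_inner_self (g : L2) : (⟪g, g⟫_ℂ).re = ‖g‖ ^ 2 := inner_self_eq_norm_sq (𝕜 := ℂ) g

lemma actionForm_self (m : ℝ) (Ψ : ℝ → State) (t : ℝ) :
    actionForm m Ψ t t = freeEnergy m (Ψ t) - 2 * ‖(Ψ t).mom‖ ^ 2 := by
  rw [actionForm, re_inner_self, re_inner_self, re_inner_self, freeEnergy]
  ring

lemma continuous_re_inner_shift {g : ℝ → L2} (hg : Continuous g) :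
    Continuous fun z : ℝ × ℝ => (⟪g (z.2 + z.1), g z.2⟫_ℂ).re :=
  Complex.continuous_re.comp ((hg.comp (continuous_snd.add continuous_fst)).inner
    (hg.comp continuous_snd))

lemma IsMild.continuous_actionForm (H : IsMild (massSource m Ψ) f Ψ) :
    Continuous (Function.uncurry fun h t => actionForm m Ψ (t + h) t) :=
  ((continuous_re_inner_shift H.continuous_deriv).add
    ((continuous_re_inner_shift H.continuous_psi).const_mul (m ^ 2))).sub
      (continuous_re_inner_shift H.continuous_mom)

/-- The increment ψ(t+h) - ψ(t-h) is an admissible H¹ test function. The symmetry of `actionForm`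
turns its value at (t, t-h) into a shift by h of its value at (t+h, t), so the time integral
telescopes to averages at the end points. -/
lemma IsMild.hasDerivAt_re_inner (H : IsMild (massSource m Ψ) f Ψ) (hf : Continuous f) (h t : ℝ) :
    HasDerivAt (fun s => (⟪((Ψ (s + h)).psi : L2) - (Ψ (s - h)).psi, (Ψ s).mom⟫_ℂ).re)
      (-(actionForm m Ψ (t + h) t - actionForm m Ψ (t - h + h) (t - h))
        + (⟪H1.eval (Ψ (t + h)).psi 0 - H1.eval (Ψ (t - h)).psi 0, f t⟫_ℂ).re) t := by
  have h1 : HasDerivAt (fun s => ((Ψ (s + h)).psi : L2) - (Ψ (s - h)).psi)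
      ((Ψ (t + h)).mom - (Ψ (t - h)).mom) t :=
    ((H.hasDerivAt_psi (t + h)).comp_add_const t h).fun_sub
      ((H.hasDerivAt_psi (t - h)).comp_sub_const t h)
  have h2 := H.hasDerivAt_inner_mom (continuous_massSource H.continuous_psi) hf
    ((Ψ (t + h)).psi - (Ψ (t - h)).psi) t
  have h3 := HasDerivAt.inner_of_weak h1 H.continuous_mom.continuousAt h2
  refine (Complex.reCLM.hasFDerivAt.comp_hasDerivAt t h3).congr_deriv ?_
  rw [H1.deriv_sub, H1.eval_sub, Submodule.coe_sub, sub_add_cancel,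
    actionForm_comm m Ψ t (t - h), actionForm, actionForm, massSource, inner_smul_right,
    inner_sub_left, inner_sub_left, inner_sub_left, Complex.reCLM_apply, ← Complex.ofReal_pow,
    ← Complex.ofReal_neg, Complex.add_re, Complex.add_re, Complex.add_re, Complex.re_ofReal_mul,
    Complex.sub_re, Complex.neg_re, Complex.sub_re, Complex.sub_re]
  ring

lemma IsMild.tendsto_re_inner (H : IsMild (massSource m Ψ) f Ψ) (c : ℝ) :
    Tendsto (fun h => h⁻¹ * (⟪((Ψ (c + h)).psi : L2) - (Ψ (c - h)).psi, (Ψ c).mom⟫_ℂ).re) (𝓝[≠] 0)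
      (𝓝 (2 * ‖(Ψ c).mom‖ ^ 2)) := by
  have h5 : HasDerivAt (fun h => ((Ψ (c + h)).psi : L2) - (Ψ (c - h)).psi)
      ((Ψ c).mom - -(Ψ c).mom) 0 := by
    refine HasDerivAt.fun_sub ?_ ?_
    · exact HasDerivAt.comp_const_add c 0 (by rw [add_zero]; exact H.hasDerivAt_psi c)
    · exact HasDerivAt.comp_const_sub c 0 (by rw [sub_zero]; exact H.hasDerivAt_psi c)
  have h6 := Complex.reCLM.hasFDerivAt.comp_hasDerivAt (0 : ℝ)
    (h5.inner ℂ (hasDerivAt_const (0 : ℝ) (Ψ c).mom))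
  have h7 := hasDerivAt_iff_tendsto_slope_zero.mp h6
  rw [inner_zero_right, zero_add, sub_neg_eq_add, inner_add_left, Complex.reCLM_apply,
    Complex.add_re, re_inner_self, ← two_mul] at h7
  refine h7.congr fun h => ?_
  simp

/-- The work of the source is the increment of the energy of the free field. -/
lemma IsMild.tendsto_work (H : IsMild (massSource m Ψ) f Ψ) (hf : Continuous f) (a b : ℝ) :
    Tendsto (fun h => h⁻¹ * ∫ t in a..b,
        (⟪H1.eval (Ψ (t + h)).psi 0 - H1.eval (Ψ (t - h)).psi 0, f t⟫_ℂ).re) (𝓝[≠] 0)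
      (𝓝 (freeEnergy m (Ψ b) - freeEnergy m (Ψ a))) := by
  have hy := H.continuous_eval
  have hDc : ∀ h, Continuous fun t =>
      (⟪H1.eval (Ψ (t + h)).psi 0 - H1.eval (Ψ (t - h)).psi 0, f t⟫_ℂ).re := fun h =>
    Complex.continuous_re.comp (((hy.comp (continuous_id.add continuous_const)).sub
      (hy.comp (continuous_id.sub continuous_const))).inner hf)
  have hEc : ∀ h, Continuous fun t =>
      actionForm m Ψ (t + h) t - actionForm m Ψ (t - h + h) (t - h) :=
    continuous_sub_shift H.continuous_actionForm
  have hEn : ∀ h, Continuous fun t =>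
      -(actionForm m Ψ (t + h) t - actionForm m Ψ (t - h + h) (t - h)) := fun h => (hEc h).neg
  have hmain := ((H.tendsto_re_inner b).sub (H.tendsto_re_inner a)).add
    (tendsto_integral_sub_shift H.continuous_actionForm a b)
  -- The boundary pairings contribute 2‖π‖², which is exactly what the action density lacks to be
  -- twice the free energy.
  have hval : 2 * ‖(Ψ b).mom‖ ^ 2 - 2 * ‖(Ψ a).mom‖ ^ 2
      + (actionForm m Ψ (b + 0) b - actionForm m Ψ (a + 0) a) =
      freeEnergy m (Ψ b) - freeEnergy m (Ψ a) := by
    rw [add_zero, add_zero, actionForm_self, actionForm_self]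
    ring
  rw [hval] at hmain
  refine hmain.congr fun h => ?_
  have h4 := intervalIntegral.integral_eq_sub_of_hasDerivAt (a := a) (b := b)
    (fun t _ => H.hasDerivAt_re_inner hf h t) (((hEn h).add (hDc h)).intervalIntegrable _ _)
  rw [intervalIntegral.integral_add ((hEn h).intervalIntegrable _ _)
    ((hDc h).intervalIntegrable _ _), intervalIntegral.integral_neg] at h4
  rw [← mul_sub, ← mul_add, ← h4]
  ring

lemma IsMild.norm_psi_sub_le (H : IsMild (massSource m Ψ) f Ψ) {M s t : ℝ}
    (hM : ∀ r ∈ uIcc s t, ‖(Ψ r).mom‖ ≤ M) :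
    ‖((Ψ t).psi : L2) - (Ψ s).psi‖ ≤ M * |t - s| := by
  have e : ((Ψ t).psi : L2) - (Ψ s).psi = ∫ r in s..t, (Ψ r).mom := by
    rw [H.psi_eq t, H.psi_eq s, add_sub_add_left_eq_sub,
      intervalIntegral.integral_interval_sub_left (H.continuous_mom.intervalIntegrable _ _)
        (H.continuous_mom.intervalIntegrable _ _)]
  rw [e]
  exact intervalIntegral.norm_integral_le_of_norm_le_const fun r hr => hM r (uIoc_subset_uIcc hr)

/-- The trace at zero has small quadratic variation. -/
lemma IsMild.eventually_norm_eval_sub_sq_le (H : IsMild (massSource m Ψ) f Ψ) (a b : ℝ) {ε : ℝ}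
    (hε : 0 < ε) : ∀ᶠ h in 𝓝 (0 : ℝ), ∀ t ∈ uIcc a b,
      ‖H1.eval (Ψ (t + h)).psi 0 - H1.eval (Ψ t).psi 0‖ ^ 2 ≤ ε * |h| := by
  obtain ⟨M, hM⟩ := (isCompact_Icc (a := min a b - 1) (b := max a b + 1)).bddAbove_image
    H.continuous_mom.norm.continuousOn
  have hM' : ∀ r ∈ Icc (min a b - 1) (max a b + 1), ‖(Ψ r).mom‖ ≤ max M 1 := fun r hr =>
    (hM (mem_image_of_mem _ hr)).trans (le_max_left _ _)
  have hM0 : 0 < max M 1 := lt_of_lt_of_le one_pos (le_max_right _ _)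
  have h1 : ∀ᶠ h in 𝓝 (0 : ℝ), ∀ t ∈ uIcc a b,
      ‖H1.deriv (Ψ (t + h)).psi - H1.deriv (Ψ t).psi‖ < ε / max M 1 := by
    refine isCompact_uIcc.eventually_forall_of_forall_eventually
      (P := fun h t => ‖H1.deriv (Ψ (t + h)).psi - H1.deriv (Ψ t).psi‖ < ε / max M 1) fun t _ => ?_
    have hc : Continuous fun z : ℝ × ℝ => ‖H1.deriv (Ψ (z.2 + z.1)).psi - H1.deriv (Ψ z.2).psi‖ :=
      ((H.continuous_deriv.comp (by fun_prop : Continuous fun z : ℝ × ℝ => z.2 + z.1)).sub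
        (H.continuous_deriv.comp continuous_snd)).norm
    refine hc.continuousAt.eventually_lt continuousAt_const ?_
    simp only [add_zero, sub_self, norm_zero]
    positivity
  have h2 : ∀ᶠ h in 𝓝 (0 : ℝ), |h| < 1 := by
    have : Tendsto (fun h : ℝ => |h|) (𝓝 0) (𝓝 0) := by simpa using (continuous_abs.tendsto (0 : ℝ))
    exact this.eventually_lt_const one_pos
  filter_upwards [h1, h2] with h h1 h2 t ht
  rw [← H1.eval_sub]
  -- By interpolation: the L² increment of ψ is O(|h|) since π is bounded, and the increment of ψ'
  -- is o(1) uniformly on the segment.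
  refine (H1.norm_eval_zero_sq_le_mul _).trans ?_
  rw [H1.deriv_sub]
  have h3 : ‖((Ψ (t + h)).psi : L2) - (Ψ t).psi‖ ≤ max M 1 * |h| := by
    have := H.norm_psi_sub_le (M := max M 1) (s := t) (t := t + h) fun r hr => hM' r ?_
    · rwa [add_sub_cancel_left] at this
    · have h4 := abs_lt.mp h2
      rw [mem_uIcc] at ht hr
      constructor
      · rcases hr with hr | hr <;> rcases ht with ht | ht <;>
          linarith [min_le_left a b, min_le_right a b, hr.1, hr.2, ht.1, ht.2, h4.1, h4.2]
      · rcases hr with hr | hr <;> rcases ht with ht | ht <;>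
          linarith [le_max_left a b, le_max_right a b, hr.1, hr.2, ht.1, ht.2, h4.1, h4.2]
  calc _ ≤ (max M 1 * |h|) * (ε / max M 1) :=
        mul_le_mul h3 (h1 t ht).le (norm_nonneg _) (by positivity)
    _ = ε * |h| := by field_simp

/-- F = -∇U is Lipschitz on the ball, so along the segment from z to w the gradient differs from its
value at z by O(|w - z|); the mean value inequality gives the quadratic remainder. -/
lemma exists_taylor {U : ℂ → ℝ} {F : ℂ → ℂ} (hU : ∀ z, HasGradientAt U (-F z) z)
    (hF : ContDiff ℝ 1 F) (R : ℝ) : ∃ C, 0 ≤ C ∧ ∀ z w, ‖z‖ ≤ R → ‖w‖ ≤ R →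
      |U w - U z + (⟪w - z, F z⟫_ℂ).re| ≤ C * ‖w - z‖ ^ 2 := by
  obtain ⟨C, hC⟩ := hF.contDiffOn.exists_lipschitzOnWith one_ne_zero (convex_closedBall (0 : ℂ) R)
    (isCompact_closedBall _ _)
  refine ⟨C, C.2, fun z w hz hw => ?_⟩
  have hz' : z ∈ Metric.closedBall (0 : ℂ) R := by simpa using hz
  have hw' : w ∈ Metric.closedBall (0 : ℂ) R := by simpa using hw
  have hseg := (convex_closedBall (0 : ℂ) R).segment_subset hz' hw'
  have h := (convex_segment z w).norm_image_sub_le_of_norm_hasFDerivWithin_le' (𝕜 := ℝ)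
    (f := U) (f' := fun x => InnerProductSpace.toDual ℝ ℂ (-F x))
    (φ := InnerProductSpace.toDual ℝ ℂ (-F z)) (C := C * ‖w - z‖)
    (fun x _ => (hU x).hasFDerivAt.hasFDerivWithinAt) (fun x hx => ?_)
    (left_mem_segment ℝ z w) (right_mem_segment ℝ z w)
  · rw [Real.norm_eq_abs, InnerProductSpace.toDual_apply_apply, inner_neg_left, sub_neg_eq_add,
      real_inner_comm, mul_assoc, ← sq] at h
    exact h
  · rw [← map_sub, LinearIsometryEquiv.norm_map, neg_sub_neg, ← dist_eq_norm, dist_comm]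
    refine (hC.dist_le_mul x (hseg hx) z hz').trans (mul_le_mul_of_nonneg_left ?_ C.2)
    rw [dist_eq_norm]
    obtain ⟨θ, hθ, rfl⟩ := (segment_eq_image' ℝ z w ▸ hx :)
    rw [add_sub_cancel_left, norm_smul, Real.norm_eq_abs, abs_of_nonneg hθ.1]
    exact mul_le_of_le_one_left (norm_nonneg _) hθ.2

/-- The energy is conserved as long as the source is the nonlinear one. -/
lemma IsMild.hamiltonian_eq {U : ℂ → ℝ} {F : ℂ → ℂ} (hU : ∀ z, HasGradientAt U (-F z) z)
    (hF : ContDiff ℝ 1 F) (H : IsMild (massSource m Ψ) f Ψ) (hf : Continuous f) {a b : ℝ}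
    (hfF : ∀ t ∈ uIcc a b, f t = F (H1.eval (Ψ t).psi 0)) :
    hamiltonian m U (Ψ b) = hamiltonian m U (Ψ a) := by
  set y : ℝ → ℂ := fun t => H1.eval (Ψ t).psi 0
  have hy : Continuous y := H.continuous_eval
  have hUc : Continuous U := continuous_iff_continuousAt.mpr fun z => (hU z).continuousAt
  obtain ⟨R, hR⟩ := (isCompact_Icc (a := min a b - 1) (b := max a b + 1)).bddAbove_image
    hy.norm.continuousOn
  obtain ⟨C, hC0, hC⟩ := exists_taylor hU hF R
  set w : ℝ → ℝ → ℝ := fun h t => (⟪y (t + h) - y (t - h), f t⟫_ℂ).re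
  set g : ℝ → ℝ → ℝ := fun h t => U (y (t + h)) - U (y (t - h))
  have hwc : ∀ h, Continuous (w h) := fun h =>
    Complex.continuous_re.comp (((hy.comp (by fun_prop)).sub (hy.comp (by fun_prop))).inner hf)
  have hgc : ∀ h, Continuous (g h) := fun h =>
    (hUc.comp (hy.comp (by fun_prop))).sub (hUc.comp (hy.comp (by fun_prop)))
  have hg : Tendsto (fun h => h⁻¹ * ∫ t in a..b, g h t) (𝓝[≠] 0)
      (𝓝 (2 * (U (y b) - U (y a)))) := by
    -- The symmetric increment of U∘y is a difference shifted by h, once the middle term U(y(t)) is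
    -- inserted; the limit doubles because the increment spans 2h.
    have h1 := tendsto_integral_sub_shift (e := fun h t => U (y (t + h)) + U (y t))
      ((hUc.comp (hy.comp (by fun_prop : Continuous fun z : ℝ × ℝ => z.2 + z.1))).add
        (hUc.comp (hy.comp continuous_snd))) a b
    have e1 : U (y (b + 0)) + U (y b) - (U (y (a + 0)) + U (y a)) = 2 * (U (y b) - U (y a)) := by
      rw [add_zero, add_zero]; ring
    rw [e1] at h1
    refine h1.congr fun h => ?_
    congr 1
    refine intervalIntegral.integral_congr fun t _ => ?_
    simp only [g, sub_add_cancel]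
    ring
  have hrem : Tendsto (fun h => h⁻¹ * ∫ t in a..b, (w h t + g h t)) (𝓝[≠] 0) (𝓝 0) := by
    rw [Metric.tendsto_nhds]
    intro ε hε
    -- The integrand is a difference of two Taylor remainders at y(t), each at most Cη|h|, and this
    -- η makes 2Cη|b - a| < ε.
    set η : ℝ := ε / (4 * (C + 1) * (|b - a| + 1))
    have hη : 0 < η := by positivity
    have h1 := H.eventually_norm_eval_sub_sq_le a b hη
    have h2 : ∀ᶠ h in 𝓝 (0 : ℝ), ∀ t ∈ uIcc a b, ‖y (t + -h) - y t‖ ^ 2 ≤ η * |-h| := by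
      have : Tendsto (fun h : ℝ => -h) (𝓝 0) (𝓝 0) := by simpa using (continuous_neg.tendsto (0 : ℝ))
      exact this.eventually h1
    have h3 : ∀ᶠ h in 𝓝 (0 : ℝ), |h| < 1 := by
      have : Tendsto (fun h : ℝ => |h|) (𝓝 0) (𝓝 0) := by
        simpa using (continuous_abs.tendsto (0 : ℝ))
      exact this.eventually_lt_const one_pos
    filter_upwards [nhdsWithin_le_nhds h1, nhdsWithin_le_nhds h2, nhdsWithin_le_nhds h3,
      self_mem_nhdsWithin] with h h1 h2 h3 hh
    have hpos : 0 < |h| := abs_pos.mpr hh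
    have hball : ∀ t ∈ uIcc a b, ∀ r, |r| < 1 → ‖y (t + r)‖ ≤ R := by
      intro t ht r hr
      refine hR (mem_image_of_mem (fun t => ‖y t‖) ?_)
      rw [uIcc, mem_Icc] at ht
      have := abs_lt.mp hr
      exact ⟨by linarith [ht.1], by linarith [ht.2]⟩
    have hpt : ∀ t ∈ uIcc a b, |w h t + g h t| ≤ 2 * C * η * |h| := by
      intro t ht
      have a0 : ‖y t‖ ≤ R := by simpa using hball t ht 0 (by simp)
      have a1 := hC (y t) (y (t + h)) a0 (hball t ht h h3)
      have a2 := hC (y t) (y (t + -h)) a0 (hball t ht (-h) (by rwa [abs_neg]))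
      have a3 := mul_le_mul_of_nonneg_left (h1 t ht) hC0
      have a4 := mul_le_mul_of_nonneg_left (h2 t ht) hC0
      rw [abs_neg] at a4
      have e2 : w h t + g h t = (U (y (t + h)) - U (y t) + (⟪y (t + h) - y t, F (y t)⟫_ℂ).re)
          - (U (y (t + -h)) - U (y t) + (⟪y (t + -h) - y t, F (y t)⟫_ℂ).re) := by
        simp only [w, g]
        rw [hfF t ht, ← sub_eq_add_neg]
        simp only [inner_sub_left, Complex.sub_re]
        ring
      rw [e2]
      refine (abs_sub _ _).trans ?_
      have a5 : ‖y (t + h) - y t‖ ^ 2 ≤ η * |h| := h1 t ht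
      linarith
    rw [dist_zero_right, norm_mul, norm_inv, Real.norm_eq_abs, inv_mul_lt_iff₀ hpos]
    refine (intervalIntegral.norm_integral_le_of_norm_le_const fun t ht =>
      hpt t (uIoc_subset_uIcc ht)).trans_lt ?_
    have e3 : η * (4 * (C + 1) * (|b - a| + 1)) = ε := div_mul_cancel₀ _ (by positivity)
    have e4 : 2 * C * η * |b - a| < ε := by
      rw [← e3]
      nlinarith [mul_nonneg hC0 (abs_nonneg (b - a)), abs_nonneg (b - a),
        mul_nonneg hη.le (mul_nonneg hC0 (abs_nonneg (b - a))), mul_nonneg hη.le hC0,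
        mul_nonneg hη.le (abs_nonneg (b - a))]
    calc _ = (2 * C * η * |b - a|) * |h| := by ring
      _ < ε * |h| := by gcongr
      _ = |h| * ε := mul_comm _ _
  have hw := H.tendsto_work hf a b
  have hlim := hrem.sub hg
  have e5 : (fun h => h⁻¹ * (∫ t in a..b, (w h t + g h t)) - h⁻¹ * ∫ t in a..b, g h t) =
      fun h => h⁻¹ * ∫ t in a..b, w h t := by
    funext h
    rw [intervalIntegral.integral_add ((hwc h).intervalIntegrable _ _)
      ((hgc h).intervalIntegrable _ _)]
    ring
  rw [e5] at hlim
  have := tendsto_nhds_unique hw hlim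
  rw [KleinGordonOscillator.hamiltonian_eq, KleinGordonOscillator.hamiltonian_eq]
  linarith

end Energy

/-! ### Global well-posedness -/

/-- A continuity argument on the segment between the times zero and `T`. -/
lemma forall_lt_of_bootstrap {g : ℝ → ℝ} (hg : Continuous g) {M T : ℝ} (h0 : g 0 < M)
    (h : ∀ t ∈ uIcc 0 T, (∀ s ∈ uIcc 0 t, g s ≤ M) → g t < M) : ∀ t ∈ uIcc 0 T, g t < M := by
  intro t ht
  by_contra! hlt
  have hmem : ∀ θ ∈ Icc (0 : ℝ) 1, ∀ s ∈ uIcc 0 (θ * t), ∃ η ∈ Icc 0 θ, s = η * t := by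
    intro θ hθ s hs
    rw [← segment_eq_uIcc, segment_eq_image'] at hs
    obtain ⟨η, hη, rfl⟩ := hs
    refine ⟨η * θ, ⟨mul_nonneg hη.1 hθ.1, mul_le_of_le_one_left hθ.1 hη.2⟩, ?_⟩
    simp [mul_assoc]
  have hsub : ∀ θ ∈ Icc (0 : ℝ) 1, θ * t ∈ uIcc 0 T := by
    intro θ hθ
    refine uIcc_subset_of_mem ht ?_
    rw [← segment_eq_uIcc, segment_eq_image']
    exact ⟨θ, hθ, by simp⟩
  -- Parametrizing the segment from 0 to t by [0,1] makes the first violation a least element for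
  -- either sign of t.
  set S := {θ ∈ Icc (0 : ℝ) 1 | M ≤ g (θ * t)}
  have hc : Continuous fun θ => g (θ * t) := hg.comp (by fun_prop)
  have hS : IsCompact S :=
    isCompact_Icc.inter_right (isClosed_le continuous_const hc)
  have hne : S.Nonempty := ⟨1, ⟨zero_le_one, le_rfl⟩, by simpa using hlt⟩
  obtain ⟨θ, hθ⟩ := hS.exists_isLeast hne
  obtain ⟨⟨hθ1, hθM⟩, hmin⟩ := hθ
  have hlt' : ∀ η ∈ Ico 0 θ, g (η * t) < M := by
    intro η hη
    by_contra! hle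
    exact absurd (hmin ⟨⟨hη.1, hη.2.le.trans hθ1.2⟩, hle⟩) (not_le.mpr hη.2)
  have hθ0 : 0 < θ := by
    refine hθ1.1.lt_of_ne ?_
    rintro rfl
    rw [zero_mul] at hθM
    linarith
  have hle : ∀ η ∈ Icc 0 θ, g (η * t) ≤ M := by
    intro η hη
    have hcl : closure (Ico 0 θ) ⊆ {η | g (η * t) ≤ M} :=
      closure_minimal (fun η hη => (hlt' η hη).le) (isClosed_le hc continuous_const)
    rw [closure_Ico hθ0.ne] at hcl
    exact hcl hη
  refine absurd (h (θ * t) (hsub θ hθ1) fun s hs => ?_) (not_lt.mpr hθM)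
  obtain ⟨η, hη, rfl⟩ := hmem θ hθ1 s hs
  exact hle η hη

/-! ### Stability, uniqueness and continuity of the flow -/

section Stability

variable {m : ℝ} {F : ℂ → ℂ}

/-- Solutions depend Lipschitz continuously on the initial states in domains of dependence. -/
lemma IsSolution.stability (hm : 0 < m) (hF : ContDiff ℝ 1 F) {Ψ₀ : State} {Ψ : ℝ → State}
    (HΨ : IsSolution m F Ψ₀ Ψ) {J : ℝ → Set ℝ} (hJ : IsCausal J) {T : ℝ}
    (hJT : ∀ s ∈ uIcc 0 T, Ioo 0 1 ⊆ J s) :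
    ∃ C, 0 < C ∧ ∀ (Φ₀ : State) (Φ : ℝ → State), IsSolution m F Φ₀ Φ →
      C * (Φ₀ - Ψ₀).sumNorm (J 0) < 1 →
      (Φ T - Ψ T).sumNorm (J T) ≤ C * (Φ₀ - Ψ₀).sumNorm (J 0) := by
  have hFc := hF.continuous
  have MΨ := HΨ.isMild hm hFc
  set y : ℝ → ℂ := fun t => H1.eval (Ψ t).psi 0
  have hy : Continuous y := MΨ.continuous_eval
  obtain ⟨R, hR⟩ := (isCompact_uIcc (a := (0 : ℝ)) (b := T)).bddAbove_image hy.norm.continuousOn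
  -- The bootstrap keeps the trace of the other solution within distance 1 of y, so one Lipschitz
  -- constant on the ball of radius R + 1 serves all nearby solutions.
  obtain ⟨κ, hκ⟩ := hF.contDiffOn.exists_lipschitzOnWith one_ne_zero
    (convex_closedBall (0 : ℂ) (R + 1)) (isCompact_closedBall _ _)
  set K : ℝ := max 1 (max (m ^ 2) κ)
  have hK1 : 1 ≤ K := le_max_left _ _
  have hKm : m ^ 2 ≤ K := (le_max_left _ _).trans (le_max_right _ _)
  have hKκ : (κ : ℝ) ≤ K := (le_max_right _ _).trans (le_max_right _ _)
  set C : ℝ := 8 * Real.exp ((12 * K) ^ 2 * |T|)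
  refine ⟨C, by positivity, fun Φ₀ Φ HΦ hsmall => ?_⟩
  have MΦ := HΦ.isMild hm hFc
  set z : ℝ → ℂ := fun t => H1.eval (Φ t).psi 0
  have hz : Continuous z := MΦ.continuous_eval
  have Mc : IsMild (massSource m fun t => Φ t - Ψ t) (fun t => F (z t) - F (y t))
      (fun t => Φ t - Ψ t) := by
    have h1 := MΦ.sub MΨ (continuous_massSource MΦ.continuous_psi)
      (continuous_massSource MΨ.continuous_psi) (hFc.comp hz) (hFc.comp hy)
    simp only [massSource_sub] at h1
    exact h1
  have hzy : ∀ t, z t - y t = H1.eval (Φ t - Ψ t).psi 0 := fun t => by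
    rw [State.psi_sub, H1.eval_sub]
  have h0 : ((fun t => Φ t - Ψ t) 0).sumNorm (J 0) = (Φ₀ - Ψ₀).sumNorm (J 0) := by
    simp only [HΦ.initial, HΨ.initial]
  have est : ∀ t ∈ uIcc 0 T, (∀ s ∈ uIcc 0 t, ‖z s - y s‖ ≤ 1) →
      (Φ t - Ψ t).sumNorm (J t) ≤ C * (Φ₀ - Ψ₀).sumNorm (J 0) := by
    intro t ht hs
    have h2 := Mc.sumNorm_le_exp ((hFc.comp hz).sub (hFc.comp hy)) hJ (t := t) hK1 hKm ?_
    · rw [h0] at h2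
      refine h2.trans (mul_le_mul_of_nonneg_right ?_ (State.sumNorm_nonneg _ _))
      have h3 : |t| ≤ |T| := by
        have := abs_sub_of_mem_uIcc ht
        linarith [abs_nonneg (T - t)]
      simp only [C]
      gcongr
    · intro s hst
      have hsT := uIcc_subset_of_mem ht hst
      have hyR : ‖y s‖ ≤ R := hR (mem_image_of_mem (fun t => ‖y t‖) hsT)
      have hzR : ‖z s‖ ≤ R + 1 := by
        have := norm_add_le (y s) (z s - y s)
        rw [add_sub_cancel] at this
        linarith [hs s hst]
      have h4 := hκ.dist_le_mul (z s) (by simpa using hzR) (y s) (by simp; linarith)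
      rw [dist_eq_norm, dist_eq_norm, hzy] at h4
      refine h4.trans ?_
      exact mul_le_mul hKκ (norm_eval_le_sumNorm (hJT s hsT) _) (norm_nonneg _) (by linarith)
  have hlt : ∀ t ∈ uIcc 0 T, ‖z t - y t‖ < 1 := by
    have hC1 : 1 ≤ C := by
      have : 1 ≤ Real.exp ((12 * K) ^ 2 * |T|) := Real.one_le_exp (by positivity)
      simp only [C]
      linarith
    -- The Gronwall bound available while the traces differ by at most 1 makes them differ by
    -- strictly less than 1, because C times the initial difference is below 1.
    refine forall_lt_of_bootstrap (g := fun t => ‖z t - y t‖) (hz.sub hy).norm ?_ fun t ht hs => ?_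
    · simp only [hzy]
      refine ((norm_eval_le_sumNorm (hJT 0 left_mem_uIcc) _).trans ?_).trans_lt hsmall
      rw [HΦ.initial, HΨ.initial]
      exact le_mul_of_one_le_left (State.sumNorm_nonneg _ _) hC1
    · rw [hzy]
      exact ((norm_eval_le_sumNorm (hJT t ht) _).trans (est t ht hs)).trans_lt hsmall
  exact est T right_mem_uIcc fun s hs => (hlt s hs).le

lemma State.eq_of_sumNorm_eq_zero {Ψ Φ : State} (h : (Φ - Ψ).sumNorm univ = 0) : Φ = Ψ := by
  rw [State.sumNorm, ← norm_eq_setNorm_univ, ← norm_eq_setNorm_univ, ← norm_eq_setNorm_univ,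
    State.mom_sub, State.psi_sub, Submodule.coe_sub] at h
  have h1 := norm_nonneg (Φ.mom - Ψ.mom)
  have h2 := norm_nonneg (H1.deriv (Φ.psi - Ψ.psi))
  have h3 := norm_nonneg ((Φ.psi : L2) - Ψ.psi)
  exact State.ext_of_eq (sub_eq_zero.mp (norm_eq_zero.mp (by linarith)))
    (sub_eq_zero.mp (norm_eq_zero.mp (by linarith)))

lemma State.sumNorm_self_sub (J : Set ℝ) (Ψ : State) : (Ψ - Ψ).sumNorm J = 0 := by
  rw [State.sumNorm, State.mom_sub, State.psi_sub, H1.deriv_sub, Submodule.coe_sub, sub_self,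
    sub_self, sub_self, ← norm_restr, map_zero, norm_zero]
  simp

/-- Stability with zero initial difference; the smallness condition is then automatic. -/
lemma IsSolution.unique (hm : 0 < m) (hF : ContDiff ℝ 1 F) {Ψ₀ : State} {Ψ Φ : ℝ → State}
    (HΨ : IsSolution m F Ψ₀ Ψ) (HΦ : IsSolution m F Ψ₀ Φ) : Φ = Ψ := by
  funext T
  obtain ⟨C, -, hC⟩ := HΨ.stability hm hF isCausal_univ (T := T) fun _ _ => subset_univ _
  have h := hC Ψ₀ Φ HΦ
  rw [State.sumNorm_self_sub, mul_zero] at h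
  exact State.eq_of_sumNorm_eq_zero (le_antisymm (h one_pos) (State.sumNorm_nonneg _ _))

variable {W : ℝ → State → State}

lemma tendsto_flow (hm : 0 < m) (hF : ContDiff ℝ 1 F)
    (hW : ∀ Ψ₀, IsSolution m F Ψ₀ fun t => W t Ψ₀) (T : ℝ) {Ψ₀ : State} {l : Filter State}
    (hl : Tendsto (fun Φ : State => (Φ - Ψ₀).sumNorm univ) l (𝓝 0)) :
    Tendsto (fun Φ : State => (W T Φ - W T Ψ₀).sumNorm univ) l (𝓝 0) := by
  obtain ⟨C, -, hC⟩ := (hW Ψ₀).stability (J := fun _ => univ) hm hF isCausal_univ (T := T)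
    fun _ _ => subset_univ (Ioo 0 1)
  have h1 := hl.const_mul C
  rw [mul_zero] at h1
  exact tendsto_of_tendsto_of_tendsto_of_le_of_le' tendsto_const_nhds h1
    (Eventually.of_forall fun Φ => State.sumNorm_nonneg _ _)
    ((h1.eventually_lt_const one_pos).mono fun Φ hΦ => hC Φ (fun t => W t Φ) (hW Φ) hΦ)

lemma tendsto_sumNorm_sub (hm : 0 < m) (Ψ₀ : State) :
    Tendsto (fun Φ : State => (Φ - Ψ₀).sumNorm univ) (@nhds State (energyTopology m) Ψ₀) (𝓝 0) :=
  (tendsto_nhds_energyTopology' (u := fun Φ : State => Φ) hm).mp tendsto_id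

lemma continuous_flow_energyTopology (hm : 0 < m) (hF : ContDiff ℝ 1 F)
    (hW : ∀ Ψ₀, IsSolution m F Ψ₀ fun t => W t Ψ₀) (T : ℝ) :
    @Continuous State State (energyTopology m) (energyTopology m) (W T) :=
  (@continuous_iff_continuousAt _ _ (energyTopology m) (energyTopology m) _).mpr fun Ψ₀ =>
    (tendsto_nhds_energyTopology' hm).mpr (tendsto_flow hm hF hW T (tendsto_sumNorm_sub hm Ψ₀))

lemma withSeminorms_localEnergyTopology (m : ℝ) :
    @WithSeminorms ℂ State (Ioi (0 : ℝ)) _ _ _ (fun R : Ioi (0 : ℝ) => localEnergyNorm m R)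
      (localEnergyTopology m) :=
  @WithSeminorms.mk _ _ _ _ _ _ _ (localEnergyTopology m) rfl

/-- At time T the state on (-R, R) is controlled by the initial state on an interval enlarged by
|T|, so a single seminorm of the initial difference suffices. -/
lemma continuous_flow_localEnergyTopology (hm : 0 < m) (hF : ContDiff ℝ 1 F)
    (hW : ∀ Ψ₀, IsSolution m F Ψ₀ fun t => W t Ψ₀) (T : ℝ) :
    @Continuous State State (localEnergyTopology m) (localEnergyTopology m) (W T) := by
  let _ : TopologicalSpace State := localEnergyTopology m
  have hws : WithSeminorms fun R : Ioi (0 : ℝ) => localEnergyNorm m R :=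
    withSeminorms_localEnergyTopology m
  rw [continuous_iff_continuousAt]
  intro Ψ₀
  refine (hws.tendsto_nhds _ _).mpr fun R ε hε => ?_
  -- Radius at least 1 keeps (0,1) inside the shrinking interval up to time T, as the local Sobolev
  -- bound for the trace requires.
  set r : ℝ := max (R : ℝ) 1 + |T|
  have hr : 0 < r := by positivity
  obtain ⟨C, hC0, hC⟩ := (hW Ψ₀).stability hm hF (isCausal_Ioo r) (T := T) fun s hs => by
    have h1 := abs_sub_of_mem_uIcc hs
    have h2 := abs_nonneg (T - s)
    have h3 : (1 : ℝ) ≤ max (R : ℝ) 1 := le_max_right _ _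
    have h4 : 1 ≤ r - |s| := by simp only [r]; linarith
    exact Ioo_subset_Ioo (by linarith) h4
  have hD : 0 < C * (2 + 1 / m) := by positivity
  have hev := (hws.tendsto_nhds id Ψ₀).mp tendsto_id ⟨r, hr⟩
    (min 1 (ε / (1 + m)) / (C * (2 + 1 / m))) (by positivity)
  filter_upwards [hev] with Φ hΦ
  rw [id, lt_div_iff₀ hD] at hΦ
  have h5 := sumNorm_le_localEnergyNorm hm r (Φ - Ψ₀)
  have h6 : C * (Φ - Ψ₀).sumNorm (Ioo (-(r - |0|)) (r - |0|)) < min 1 (ε / (1 + m)) := by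
    rw [abs_zero, sub_zero]
    have := mul_le_mul_of_nonneg_left h5 hC0.le
    linarith
  have h7 := hC Φ _ (hW Φ) (h6.trans_le (min_le_left _ _))
  have h8 : r - |T| = max (R : ℝ) 1 := by simp only [r]; ring
  rw [h8] at h7
  have h9 : Ioo (-(R : ℝ)) R ⊆ Ioo (-(max (R : ℝ) 1)) (max (R : ℝ) 1) :=
    Ioo_subset_Ioo (neg_le_neg (le_max_left _ _)) (le_max_left _ _)
  have h10 := (State.sumNorm_mono h9 (W T Φ - W T Ψ₀)).trans h7
  have h11 := h10.trans_lt (h6.trans_le (min_le_right _ _))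
  rw [lt_div_iff₀ (by linarith)] at h11
  refine (localEnergyNorm_le hm.le R _).trans_lt ?_
  linarith

end Stability

/-! ### Coercivity and global existence -/

section Global

variable {m A B : ℝ} {U : ℂ → ℝ} {F : ℂ → ℂ}

/-- Coercivity of the Hamilton functional. -/
lemma freeEnergy_le (hB : 0 ≤ B) (hBm : B < m) (hbound : ∀ z, A - B * ‖z‖ ^ 2 ≤ U z) (Ψ : State) :
    (m - B) * freeEnergy m Ψ ≤ 2 * m * (hamiltonian m U Ψ - A) := by
  have hm : 0 < m := hB.trans_lt hBm
  -- The choice l = m matches the mass term of the energy and makes the condition B < m exactly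
  -- sufficient.
  have h1 := H1.norm_eval_zero_sq_le Ψ.psi hm
  have h2 := hbound (H1.eval Ψ.psi 0)
  rw [KleinGordonOscillator.hamiltonian_eq]
  have h3 : 2 * m * ‖H1.eval Ψ.psi 0‖ ^ 2 ≤ freeEnergy m Ψ := by
    rw [freeEnergy]
    have h4 : m ^ 2 * ‖Ψ.psi‖ ^ 2 = m ^ 2 * ‖(Ψ.psi : L2)‖ ^ 2 := rfl
    linarith [sq_nonneg ‖Ψ.mom‖]
  have h4 := mul_le_mul_of_nonneg_left h3 hB
  have h5 := mul_le_mul_of_nonneg_left h2 hm.le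
  nlinarith

lemma norm_eval_sq_le (hm : 0 < m) (Ψ : State) :
    ‖H1.eval Ψ.psi 0‖ ^ 2 ≤ freeEnergy m Ψ / (2 * m) := by
  have h1 := H1.norm_eval_zero_sq_le Ψ.psi hm
  rw [le_div_iff₀ (by positivity), freeEnergy]
  have h4 : m ^ 2 * ‖Ψ.psi‖ ^ 2 = m ^ 2 * ‖(Ψ.psi : L2)‖ ^ 2 := rfl
  linarith [sq_nonneg ‖Ψ.mom‖]

/-- Global existence, by the a priori estimate for the truncated equation. -/
lemma exists_isSolution (hU : ∀ z, HasGradientAt U (-F z) z) (hF : ContDiff ℝ 1 F) (hB : 0 ≤ B)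
    (hBm : B < m) (hbound : ∀ z, A - B * ‖z‖ ^ 2 ≤ U z) (Ψ₀ : State) :
    ∃ Ψ, IsSolution m F Ψ₀ Ψ := by
  have hm : 0 < m := hB.trans_lt hBm
  have hmB : 0 < m - B := by linarith
  set E : ℝ := 2 * m * (hamiltonian m U Ψ₀ - A) / (m - B)
  have hE : ∀ Φ : State, hamiltonian m U Φ = hamiltonian m U Ψ₀ →
      ‖H1.eval Φ.psi 0‖ < E / (2 * m) + 1 := by
    intro Φ hΦ
    have h1 : freeEnergy m Φ ≤ E := by
      rw [le_div_iff₀ hmB, mul_comm, ← hΦ]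
      exact freeEnergy_le hB hBm hbound Φ
    have h2 := (norm_eval_sq_le hm Φ).trans
      (div_le_div_of_nonneg_right h1 (by positivity : (0 : ℝ) ≤ 2 * m))
    -- For real x one has x ≤ x² + 1/4, so the bound on the square gives a strict bound on the norm
    -- without a square root.
    nlinarith [norm_nonneg (H1.eval Φ.psi 0), sq_nonneg (‖H1.eval Φ.psi 0‖ - 1 / 2)]
  set M : ℝ := E / (2 * m) + 1
  obtain ⟨κ, hκ⟩ := hF.contDiffOn.exists_lipschitzOnWith one_ne_zero
    (convex_closedBall (0 : ℂ) M) (isCompact_closedBall _ _)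
  -- The extension G need not be a gradient: the energy identity is used only while the trace stays
  -- where G = F.
  obtain ⟨G, hG, hFG⟩ := hκ.extend_finite_dimension
  obtain ⟨Ψ, H, h0⟩ := exists_isMild_of_lipschitz m hG Ψ₀
  have hbd : ∀ T, ‖H1.eval (Ψ T).psi 0‖ < M := by
    intro T
    refine forall_lt_of_bootstrap (g := fun t => ‖H1.eval (Ψ t).psi 0‖) (T := T)
      H.continuous_eval.norm (by simp only [h0]; exact hE Ψ₀ rfl) (fun t _ hs => ?_) T right_mem_uIcc
    refine hE (Ψ t) ?_
    rw [← h0]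
    -- Up to time t the trace is assumed to lie in the closed ball of radius M, so the original
    -- Hamiltonian is conserved and `hE` improves the bound to a strict one.
    refine H.hamiltonian_eq hU hF (hG.continuous.comp H.continuous_eval) fun s hst => ?_
    exact (hFG (by simpa using hs s hst)).symm
  have e : (fun t => G (H1.eval (Ψ t).psi 0)) = fun t => F (H1.eval (Ψ t).psi 0) := by
    funext t
    exact (hFG (by simpa using (hbd t).le)).symm
  rw [e] at H
  exact ⟨Ψ, h0 ▸ H.isSolution hm hF.continuous⟩

end Global

/-- U is C² as a composition with the smooth function |z|², and the gradient is the Fréchet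
derivative followed by the Riesz isomorphism, so one derivative is lost. -/
lemma hasGradientAt_of_radial {u : ℝ → ℝ} {U : ℂ → ℝ} {F : ℂ → ℂ} (hu : ContDiff ℝ 2 u)
    (hU : ∀ z : ℂ, U z = u (‖z‖ ^ 2)) (hF : ∀ z : ℂ, F z = -gradient U z) :
    (∀ z, HasGradientAt U (-F z) z) ∧ ContDiff ℝ 1 F := by
  have hU2 : ContDiff ℝ 2 U := by
    rw [funext hU]
    exact hu.comp (contDiff_norm_sq ℝ)
  refine ⟨fun z => ?_, ?_⟩
  · rw [hF, neg_neg]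
    exact (hU2.differentiable (by simp) z).hasGradientAt
  · rw [funext hF]
    exact ((InnerProductSpace.toDual ℝ ℂ).symm.toContinuousLinearEquiv.contDiff.comp
      (hU2.fderiv_right (m := 1) (by norm_num))).neg

end KleinGordonOscillator

end

open KleinGordonOscillator in
theorem theorem2p1 (m : ℝ) (u : ℝ → ℝ) (U : ℂ → ℝ) (F : ℂ → ℂ) (A B : ℝ)
    (hu : ContDiff ℝ 2 u)
    (hU : ∀ z : ℂ, U z = u (‖z‖ ^ 2))
    (hF : ∀ z : ℂ, F z = -gradient U z)
    (hB : 0 ≤ B) (hBm : B < m)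
    (hbound : ∀ z : ℂ, A - B * ‖z‖ ^ 2 ≤ U z) :
    ∃ W : ℝ → State → State,
      (∀ Ψ₀ : State,
        IsSolution m F Ψ₀ (fun t => W t Ψ₀) ∧
        ∀ Φ : ℝ → State, IsSolution m F Ψ₀ Φ → Φ = fun t => W t Ψ₀) ∧
      (∀ t : ℝ,
        @Continuous State State (energyTopology m) (energyTopology m) (W t) ∧
        @Continuous State State (localEnergyTopology m) (localEnergyTopology m) (W t)) ∧
      (∀ (Ψ₀ : State) (t : ℝ), hamiltonian m U (W t Ψ₀) = hamiltonian m U Ψ₀) ∧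
      (∀ Ψ₀ : State, ∃ C : ℝ, ∀ t : ℝ, energyNorm m (W t Ψ₀) ≤ C) := by
  obtain ⟨hg, hF1⟩ := hasGradientAt_of_radial hu hU hF
  have hm : 0 < m := hB.trans_lt hBm
  choose S hS using fun Ψ₀ => exists_isSolution hg hF1 hB hBm hbound Ψ₀
  have hW : ∀ Ψ₀, IsSolution m F Ψ₀ fun t => S Ψ₀ t := hS
  have hH : ∀ (Ψ₀ : State) (t : ℝ), hamiltonian m U (S Ψ₀ t) = hamiltonian m U Ψ₀ := by
    intro Ψ₀ t
    have H := (hS Ψ₀).isMild hm hF1.continuous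
    have h := H.hamiltonian_eq hg hF1 (hF1.continuous.comp H.continuous_eval) (a := 0) (b := t)
      fun _ _ => rfl
    rwa [(hS Ψ₀).initial] at h
  refine ⟨fun t Ψ₀ => S Ψ₀ t, fun Ψ₀ => ⟨hS Ψ₀, fun Φ hΦ => (hS Ψ₀).unique hm hF1 hΦ⟩,
    fun t => ⟨continuous_flow_energyTopology hm hF1 hW t,
      continuous_flow_localEnergyTopology hm hF1 hW t⟩, hH, fun Ψ₀ => ?_⟩
  -- The square of the energy norm is `freeEnergy`, and coercivity bounds it by the conserved
  -- Hamiltonian.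
  refine ⟨√(2 * m * (hamiltonian m U Ψ₀ - A) / (m - B)), fun t => ?_⟩
  rw [energyNorm_apply]
  refine Real.sqrt_le_sqrt ?_
  rw [le_div_iff₀ (by linarith), mul_comm, ← hH Ψ₀ t]
  exact freeEnergy_le hB hBm hbound (S Ψ₀ t)
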